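/- Let $X$ be a smooth $n$-dimensional manifold (without boundary, Hausdorff, $\sigma$-compact; $n\ge 0$), and let $L=\bigoplus_{i\in\mathbb Z}L^i$ be a $\mathbb Z$-graded real vector space with $\dim L^i<\infty$ for all $i$, endowed with a pointed formal $Q$-structure ($L_\infty$-structure) $Q_L$, i.e. a degree $1$ coderivation of square zero of the graded symmetric coalgebra $\mathrm{Sym}^+_c(L)$, given by its Taylor coefficients $l_k\colon \mathrm{Sym}^k(L)\to L[1]$, $k\ge1$. Let $\alpha^\bullet$ be the graded vector bundle with $\alpha^q=\bigoplus_{j}\Lambda^jT^*X\otimes L^{q-j}$, and let $Q_{\mathrm{BRST}}=Q_{\mathrm{DR}}+Q_L$ be the homological vector field on $\Gamma(\alpha^\bullet)=\Omega^\bullet(X)\otimes L$ given by the $L$-twisted de Rham operator and the $\Omega^\bullet(X)$-multilinear extension of the $l_k$. Let $\mathcal C^{p,g}$ be the space of horizontal $p$-forms of ghost degree $g$ on the infinite jet space of $\alpha^\bullet$ that are polynomial in the jet variables and vanish on the zero section. That is, $\mathcal C^{p,g}=[\mathrm{Sym}^+\mathcal D(\alpha^\bullet,\Lambda^p_X)]^g$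 is the space of finite sums, over $l\ge1$, of graded symmetric $l$-linear differential operators of finite order $\Gamma(\alpha^\bullet)^l\to\Omega^p(X)$, involving finitely many of the $L^i$ and nonzero only on arguments of total degree $-g$. Let $\widehat{\mathcal C}^{p,g}$ be its formal completion: the same with infinite sums over $l$ and over the bidegrees $(j,i)$ of the arguments in $\Omega^j(X)\otimes L^i$ allowed, each component of fixed $l$ and fixed bidegrees being of finite order. Let $\mathrm d_h$ be the horizontal differential $(\mathrm d_hF)[\phi]=\mathrm d(F[\phi])$ and let $\mathbf s$ be the evolutionary vector field of $Q_{\mathrm{BRST}}$, with the sign $(-1)^p$ on $p$-forms that makes it anticommute with $\mathrm d_h$. The differential $\mathbf s$ is defined on $\widehat{\mathcal C}$ for every $Q_L$. It preserves $\mathcal C$ if $Q_L$ is polynomial, i.e. if for each $r$ the component of $(l_k)_k$ with values in $L^r$ involves only finitely many $k$ and finitely many of the $L^i$. Put $H^{g,n}(\mathbf s\mid \mathrm d_h)=H^g\big(H^n(\mathcal C^{\bullet,\bullet},\mathrm d_h),\mathbf s\big)$ and let $H^{m}(\mathbf s+\mathrm d_h)$ be the cohomology of $\bigoplus_{p+g=m}\mathcal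 C^{p,g}$ with the differential $\mathbf s+\mathrm d_h$; define both likewise for $\widehat{\mathcal C}$. **Proposition.** For every $g\in\mathbb Z$ there is an isomorphism of real vector spaces $$H^{g+n}(\mathbf s+\mathrm d_h)\;\cong\;H^{g,n}(\mathbf s\mid \mathrm d_h),$$ which sends the class of a total cocycle $\sum_p z^p$, $z^p$ of form degree $p$, to the class of its component $z^n$ of top horizontal degree. This holds for the polynomial complex $\mathcal C$ whenever $Q_L$ is polynomial, and for the formal complex $\widehat{\mathcal C}$ with arbitrary $Q_L$. -/

import Mathlib

noncomputable section

namespace LocalBRST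

section Forms

variable (A : Type*) [CommRing A] [Algebra ℝ A]

/-- Differential `p`-forms over a commutative real algebra `A`: alternating `A`-multilinear maps
`Der(A)^p → A`. For `A = C^∞(X)` the derivations of `A` are the smooth vector fields on `X`, and this
is the `A`-module `Ω^p(X)` of smooth differential `p`-forms. -/
abbrev Form (p : ℕ) : Type _ := (Derivation ℝ A A) [⋀^Fin p]→ₗ[A] A

/-- Inhomogeneous differential forms `α = ∑_p α_p`, with `α_p` of degree `p` (on an
`n`-dimensional manifold `α_p = 0` for `p > n`, so that this is the direct sum of the `Ω^p(X)`). -/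
abbrev Forms : Type _ := ∀ p : ℕ, Form A p

variable {A}

theorem form_eq_zero_of_eq {m : ℕ} (f : (Fin (m + 1) → Derivation ℝ A A) → A)
    (F : Derivation ℝ A A → Form A m) (hF : ∀ v, f v = F (v 0) (Fin.tail v))
    (h01 : ∀ v : Fin (m + 1) → Derivation ℝ A A, ∀ k : Fin m, (k : ℕ) = 0 → v k.succ = v 0 → f v = 0)
    (v : Fin (m + 1) → Derivation ℝ A A) (i j : Fin (m + 1)) (hv : v i = v j) (hij : i ≠ j) :
    f v = 0 := by
  have key : ∀ (v : Fin (m + 1) → Derivation ℝ A A) (k : Fin m), v k.succ = v 0 → f v = 0 := by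
    intro v k hk
    obtain ⟨m, rfl⟩ : ∃ m', m = m' + 1 := ⟨m - 1, by have := k.pos; omega⟩
    by_cases hk0 : k = 0
    · exact h01 v k (by simp [hk0]) hk
    · have h1 := (F (v 0)).map_swap (Fin.tail v) hk0
      have h2 : f (Fin.cons (v 0) (Fin.tail v ∘ Equiv.swap k 0)) = 0 := by
        refine h01 _ 0 (by simp) ?_
        simp [Fin.tail, hk]
      rw [hF] at h2 ⊢
      simp only [Fin.cons_zero, Fin.tail_cons] at h2
      rw [h2] at h1
      exact neg_eq_zero.mp h1.symm
  rcases Fin.eq_zero_or_eq_succ i with rfl | ⟨i, rfl⟩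
  · rcases Fin.eq_zero_or_eq_succ j with rfl | ⟨j, rfl⟩
    · exact absurd rfl hij
    · exact key v j hv.symm
  · rcases Fin.eq_zero_or_eq_succ j with rfl | ⟨j, rfl⟩
    · exact key v i hv
    · rw [hF]
      exact (F (v 0)).map_eq_zero_of_eq (Fin.tail v) (i := i) (j := j) hv
        (fun h => hij (by rw [h]))

/-- The interior product `ι_v α`. -/
def contract (v : Derivation ℝ A A) : Forms A →ₗ[A] Forms A where
  toFun α p := (α (p + 1)).curryLeft v
  map_add' _ _ := rfl
  map_smul' _ _ := rfl

/-- The parity operator, equal to `(-1)^p` on `p`-forms. -/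
def parity : Forms A →ₗ[A] Forms A where
  toFun α p := (-1 : A) ^ p • α p
  map_add' _ _ := by funext p; simp
  map_smul' a α := by funext p; exact smul_comm ((-1 : A) ^ p) a (α p)

theorem contract_add (v w : Derivation ℝ A A) (α : Forms A) :
    contract (v + w) α = contract v α + contract w α :=
  funext fun p => map_add (α (p + 1)).curryLeft v w

theorem contract_smul (a : A) (v : Derivation ℝ A A) (α : Forms A) :
    contract (a • v) α = a • contract v α :=
  funext fun p => map_smul (α (p + 1)).curryLeft a v

theorem contract_self (v : Derivation ℝ A A) (α : Forms A) : contract v (contract v α) = 0 := by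
  funext p; exact AlternatingMap.curryLeft_same _ _

theorem contract_parity (v : Derivation ℝ A A) (α : Forms A) :
    contract v (parity α) = - parity (contract v α) := by
  funext p
  ext w
  change (-1 : A) ^ (p + 1) * _ = -((-1 : A) ^ p * _)
  rw [pow_succ]
  simp
  rfl

/-- The values of the exterior product, through `(α ∧ β)_0 = α_0 β_0` and the antiderivation rule
`ι_v (α ∧ β) = ι_v α ∧ β + (-1)^{|α|} α ∧ ι_v β`. -/
def wedgeFun : (m : ℕ) → Forms A → Forms A → (Fin m → Derivation ℝ A A) → A
  | 0, α, β, v => α 0 v * β 0 v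
  | m + 1, α, β, v =>
      wedgeFun m (contract (v 0) α) β (Fin.tail v) +
        wedgeFun m (parity α) (contract (v 0) β) (Fin.tail v)

theorem wedgeFun_add_left (m : ℕ) (α α' β : Forms A) (v : Fin m → Derivation ℝ A A) :
    wedgeFun m (α + α') β v = wedgeFun m α β v + wedgeFun m α' β v := by
  induction m generalizing α α' β with
  | zero => simp [wedgeFun, add_mul]
  | succ m ih => simp only [wedgeFun, map_add, ih]; ring

theorem wedgeFun_add_right (m : ℕ) (α β β' : Forms A) (v : Fin m → Derivation ℝ A A) :
    wedgeFun m α (β + β') v = wedgeFun m α β v + wedgeFun m α β' v := by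
  induction m generalizing α β β' with
  | zero => simp [wedgeFun, mul_add]
  | succ m ih => simp only [wedgeFun, map_add, ih]; ring

theorem wedgeFun_smul_left (m : ℕ) (a : A) (α β : Forms A) (v : Fin m → Derivation ℝ A A) :
    wedgeFun m (a • α) β v = a * wedgeFun m α β v := by
  induction m generalizing α β with
  | zero => simp [wedgeFun, mul_assoc]
  | succ m ih => simp only [wedgeFun, map_smul, ih]; ring

theorem wedgeFun_smul_right (m : ℕ) (a : A) (α β : Forms A) (v : Fin m → Derivation ℝ A A) :
    wedgeFun m α (a • β) v = a * wedgeFun m α β v := by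
  induction m generalizing α β with
  | zero => simp [wedgeFun, mul_left_comm]
  | succ m ih => simp only [wedgeFun, map_smul, ih]; ring

theorem wedgeFun_zero_left (m : ℕ) (β : Forms A) (v : Fin m → Derivation ℝ A A) :
    wedgeFun m 0 β v = 0 := by
  simpa using wedgeFun_smul_left m 0 0 β v

theorem wedgeFun_zero_right (m : ℕ) (α : Forms A) (v : Fin m → Derivation ℝ A A) :
    wedgeFun m α 0 v = 0 := by
  simpa using wedgeFun_smul_right m 0 α 0 v

theorem wedgeFun_neg_left (m : ℕ) (α β : Forms A) (v : Fin m → Derivation ℝ A A) :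
    wedgeFun m (-α) β v = - wedgeFun m α β v := by
  rw [← neg_one_smul A α, wedgeFun_smul_left, neg_one_mul]

theorem wedgeFun_update_add (m : ℕ) (α β : Forms A) (v : Fin m → Derivation ℝ A A) (i : Fin m)
    (x y : Derivation ℝ A A) :
    wedgeFun m α β (Function.update v i (x + y)) =
      wedgeFun m α β (Function.update v i x) + wedgeFun m α β (Function.update v i y) := by
  induction m generalizing α β with
  | zero => exact i.elim0
  | succ m ih =>
    rcases Fin.eq_zero_or_eq_succ i with rfl | ⟨i, rfl⟩
    · simp only [wedgeFun, Function.update_self, Fin.tail_update_zero, contract_add,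
        wedgeFun_add_left, wedgeFun_add_right]
      ring
    · simp only [wedgeFun, Fin.tail_update_succ, ih,
        Function.update_of_ne (Fin.succ_ne_zero i).symm]
      ring

theorem wedgeFun_update_smul (m : ℕ) (α β : Forms A) (v : Fin m → Derivation ℝ A A) (i : Fin m)
    (a : A) (x : Derivation ℝ A A) :
    wedgeFun m α β (Function.update v i (a • x)) =
      a * wedgeFun m α β (Function.update v i x) := by
  induction m generalizing α β with
  | zero => exact i.elim0
  | succ m ih =>
    rcases Fin.eq_zero_or_eq_succ i with rfl | ⟨i, rfl⟩
    · simp only [wedgeFun, Function.update_self, Fin.tail_update_zero, contract_smul,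
        wedgeFun_smul_left, wedgeFun_smul_right]
      ring
    · simp only [wedgeFun, Fin.tail_update_succ, ih,
        Function.update_of_ne (Fin.succ_ne_zero i).symm]
      ring

theorem wedgeFun_eq_zero (m : ℕ) : ∀ (α β : Forms A) (v : Fin m → Derivation ℝ A A) (i j : Fin m),
    v i = v j → i ≠ j → wedgeFun m α β v = 0 := by
  induction m with
  | zero => intro _ _ _ i; exact i.elim0
  | succ m ih =>
    intro α β
    let W : Forms A → Forms A → Form A m := fun α β =>
      { toFun := wedgeFun m α β
        map_update_add' := fun {inst} v i x y => by
          rw [Subsingleton.elim inst (instDecidableEqFin m)]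
          exact wedgeFun_update_add m α β v i x y
        map_update_smul' := fun {inst} v i a x => by
          rw [Subsingleton.elim inst (instDecidableEqFin m)]
          exact wedgeFun_update_smul m α β v i a x
        map_eq_zero_of_eq' := ih α β }
    refine form_eq_zero_of_eq (wedgeFun (m + 1) α β)
      (fun x => W (contract x α) β + W (parity α) (contract x β)) (fun v => rfl) ?_
    intro v k hk hv
    obtain ⟨m, rfl⟩ : ∃ m', m = m' + 1 := ⟨m - 1, by have := k.pos; omega⟩
    obtain rfl : k = 0 := Fin.ext hk
    have h0 : Fin.tail v 0 = v 0 := hv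
    simp only [wedgeFun, h0, contract_self, contract_parity, wedgeFun_zero_left,
      wedgeFun_zero_right, wedgeFun_neg_left]
    ring

/-- The exterior product of differential forms, normalised so that
`(α ∧ β)(v, w) = α(v) β(w) - α(w) β(v)` for `1`-forms. -/
def wedge (α β : Forms A) : Forms A := fun m =>
  { toFun := wedgeFun m α β
    map_update_add' := fun {inst} v i x y => by
      rw [Subsingleton.elim inst (instDecidableEqFin m)]
      exact wedgeFun_update_add m α β v i x y
    map_update_smul' := fun {inst} v i a x => by
      rw [Subsingleton.elim inst (instDecidableEqFin m)]
      exact wedgeFun_update_smul m α β v i a x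
    map_eq_zero_of_eq' := wedgeFun_eq_zero m α β }

/-- The values of the exterior derivative. Unfolding the recursion gives Koszul's formula
`dα(v_0,…,v_p) = ∑_i (-1)^i v_i(α(…,v̂_i,…)) + ∑_{i<j} (-1)^{i+j} α([v_i,v_j],…,v̂_i,…,v̂_j,…)`;
one step of it is Cartan's formula `ι_v d α = L_v α - d ι_v α`. -/
def dFun : (m : ℕ) → Forms A → (Fin m → Derivation ℝ A A) → A
  | 0, _, _ => 0
  | m + 1, α, v =>
      v 0 (α m (Fin.tail v)) -
        ∑ i, α m (Function.update (Fin.tail v) i ⁅v 0, Fin.tail v i⁆) -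
        dFun m (contract (v 0) α) (Fin.tail v)

theorem dFun_add (m : ℕ) (α β : Forms A) (v : Fin m → Derivation ℝ A A) :
    dFun m (α + β) v = dFun m α v + dFun m β v := by
  induction m generalizing α β with
  | zero => simp [dFun]
  | succ m ih =>
    simp only [dFun, map_add, ih, Pi.add_apply, AlternatingMap.add_apply, Finset.sum_add_distrib]
    ring

theorem dFun_real_smul (m : ℕ) (c : ℝ) (α : Forms A) (v : Fin m → Derivation ℝ A A) :
    dFun m (c • α) v = c • dFun m α v := by
  induction m generalizing α with
  | zero => simp [dFun]
  | succ m ih =>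
    have h : contract (v 0) (c • α) = c • contract (v 0) α := by
      funext p; rfl
    simp only [dFun, h, ih, Pi.smul_apply, AlternatingMap.smul_apply, Finset.smul_sum,
      Derivation.map_smul, smul_sub]

/-- The values of `da ∧ α` for a function `a`. -/
def dwFun (a : A) : (m : ℕ) → Forms A → (Fin m → Derivation ℝ A A) → A
  | 0, _, _ => 0
  | m + 1, α, v => v 0 a * α m (Fin.tail v) - dwFun a m (contract (v 0) α) (Fin.tail v)

theorem dFun_smul (m : ℕ) (a : A) (α : Forms A) (v : Fin m → Derivation ℝ A A) :
    dFun m (a • α) v = a * dFun m α v + dwFun a m α v := by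
  induction m generalizing α with
  | zero => simp [dFun, dwFun]
  | succ m ih =>
    simp only [dFun, dwFun, map_smul, ih, Pi.smul_apply, AlternatingMap.smul_apply, smul_eq_mul,
      Derivation.leibniz, ← Finset.mul_sum]
    ring

theorem dwFun_contract_swap (a : A) (m : ℕ) (x y : Derivation ℝ A A) (α : Forms A)
    (v : Fin m → Derivation ℝ A A) :
    dwFun a m (contract x (contract y α)) v = - dwFun a m (contract y (contract x α)) v := by
  have hz : ∀ (m : ℕ) (v : Fin m → Derivation ℝ A A), dwFun a m 0 v = 0 := by
    intro m
    induction m with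
    | zero => intro v; rfl
    | succ m ih => intro v; simp [dwFun, ih]
  have hadd : ∀ (m : ℕ) (α β : Forms A) (v : Fin m → Derivation ℝ A A),
      dwFun a m (α + β) v = dwFun a m α v + dwFun a m β v := by
    intro m
    induction m with
    | zero => intro α β v; simp [dwFun]
    | succ m ih => intro α β v; simp only [dwFun, map_add, ih, Pi.add_apply,
                    AlternatingMap.add_apply]; ring
  have h := contract_self (x + y) α
  simp only [contract_add, map_add, contract_self, zero_add, add_zero] at h
  have h2 := hz m v
  rw [← h, hadd] at h2
  exact eq_neg_of_add_eq_zero_right h2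

theorem dwFun_contract (a : A) (m : ℕ) (x : Derivation ℝ A A) (α : Forms A)
    (v : Fin m → Derivation ℝ A A) :
    dwFun a m (contract x α) v = ∑ i, v i a * α m (Function.update v i x) := by
  induction m generalizing α with
  | zero => simp [dwFun]
  | succ m ih =>
    rw [dwFun, dwFun_contract_swap, ih, Fin.sum_univ_succ, sub_neg_eq_add]
    congr 1
    · congr 1
      change α (m + 1) (Matrix.vecCons x (Fin.tail v)) = _
      congr 1
      funext k
      refine Fin.cases ?_ (fun k => ?_) k <;> simp [Fin.tail]
    · refine Finset.sum_congr rfl fun i _ => ?_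
      congr 1
      change α (m + 1) (Matrix.vecCons (v 0) (Function.update (Fin.tail v) i x)) = _
      congr 1
      rw [← Fin.tail_update_succ]
      funext k
      refine Fin.cases ?_ (fun k => ?_) k
      · exact (Function.update_of_ne (Fin.succ_ne_zero i).symm _ _).symm
      · rfl

theorem dFun_update_add (m : ℕ) (α : Forms A) (v : Fin m → Derivation ℝ A A) (i : Fin m)
    (x y : Derivation ℝ A A) :
    dFun m α (Function.update v i (x + y)) =
      dFun m α (Function.update v i x) + dFun m α (Function.update v i y) := by
  induction m generalizing α with
  | zero => exact i.elim0
  | succ m ih =>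
    rcases Fin.eq_zero_or_eq_succ i with rfl | ⟨i, rfl⟩
    · simp only [dFun, Function.update_self, Fin.tail_update_zero, contract_add, dFun_add,
        Derivation.add_apply, add_lie, AlternatingMap.map_update_add, Finset.sum_add_distrib]
      ring
    · simp only [dFun, Fin.tail_update_succ, ih, Function.update_of_ne (Fin.succ_ne_zero i).symm,
        AlternatingMap.map_update_add, map_add]
      have h : ∀ z : Derivation ℝ A A,
          ∑ k, α m (Function.update (Function.update (Fin.tail v) i z) k
            ⁅v 0, Function.update (Fin.tail v) i z k⁆) =
          α m (Function.update (Fin.tail v) i ⁅v 0, z⁆) +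
          ∑ k ∈ Finset.univ.erase i, α m (Function.update (Function.update (Fin.tail v) k
            ⁅v 0, Fin.tail v k⁆) i z) := by
        intro z
        rw [← Finset.add_sum_erase _ _ (Finset.mem_univ i)]
        congr 1
        · simp
        · refine Finset.sum_congr rfl fun k hk => ?_
          have hk := Finset.ne_of_mem_erase hk
          rw [Function.update_of_ne hk, Function.update_comm hk.symm]
      simp only [h, lie_add, AlternatingMap.map_update_add, Finset.sum_add_distrib]
      ring

theorem derivation_lie_smul (a : A) (x y : Derivation ℝ A A) : ⁅x, a • y⁆ = a • ⁅x, y⁆ + x a • y := by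
  ext b
  simp [Derivation.commutator_apply]

theorem derivation_smul_lie (a : A) (x y : Derivation ℝ A A) : ⁅a • x, y⁆ = a • ⁅x, y⁆ - y a • x := by
  ext b
  simp [Derivation.commutator_apply]
  ring

theorem dFun_update_smul (m : ℕ) (α : Forms A) (v : Fin m → Derivation ℝ A A) (i : Fin m)
    (a : A) (x : Derivation ℝ A A) :
    dFun m α (Function.update v i (a • x)) = a * dFun m α (Function.update v i x) := by
  induction m generalizing α with
  | zero => exact i.elim0
  | succ m ih =>
    rcases Fin.eq_zero_or_eq_succ i with rfl | ⟨i, rfl⟩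
    · simp only [dFun, Function.update_self, Fin.tail_update_zero, contract_smul, dFun_smul,
        dwFun_contract, Derivation.smul_apply, derivation_smul_lie, AlternatingMap.map_update_sub,
        AlternatingMap.map_update_smul, Finset.sum_sub_distrib, smul_eq_mul, ← Finset.mul_sum]
      ring
    · simp only [dFun, Fin.tail_update_succ, ih, Function.update_of_ne (Fin.succ_ne_zero i).symm,
        AlternatingMap.map_update_smul]
      have h : ∀ z : Derivation ℝ A A,
          ∑ k, α m (Function.update (Function.update (Fin.tail v) i z) k
            ⁅v 0, Function.update (Fin.tail v) i z k⁆) =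
          α m (Function.update (Fin.tail v) i ⁅v 0, z⁆) +
          ∑ k ∈ Finset.univ.erase i, α m (Function.update (Function.update (Fin.tail v) k
            ⁅v 0, Fin.tail v k⁆) i z) := by
        intro z
        rw [← Finset.add_sum_erase _ _ (Finset.mem_univ i)]
        congr 1
        · simp
        · refine Finset.sum_congr rfl fun k hk => ?_
          have hk := Finset.ne_of_mem_erase hk
          rw [Function.update_of_ne hk, Function.update_comm hk.symm]
      simp only [h, derivation_lie_smul, AlternatingMap.map_update_add, AlternatingMap.map_update_smul,
        smul_eq_mul, Derivation.leibniz, ← Finset.mul_sum]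
      ring

theorem dFun_eq_zero (m : ℕ) : ∀ (α : Forms A) (v : Fin m → Derivation ℝ A A) (i j : Fin m),
    v i = v j → i ≠ j → dFun m α v = 0 := by
  induction m with
  | zero => intro _ _ i; exact i.elim0
  | succ m ih =>
    intro α v i j hv hij
    let D : Forms A → Form A m := fun α =>
      { toFun := dFun m α
        map_update_add' := fun {inst} v i x y => by
          rw [Subsingleton.elim inst (instDecidableEqFin m)]
          exact dFun_update_add m α v i x y
        map_update_smul' := fun {inst} v i a x => by
          rw [Subsingleton.elim inst (instDecidableEqFin m)]
          exact dFun_update_smul m α v i a x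
        map_eq_zero_of_eq' := ih α }
    let Lie : Derivation ℝ A A → Form A m := fun x =>
      { toFun := fun w => dFun (m + 1) α (Fin.cons x w) + D (contract x α) w
        map_update_add' := fun {inst} v i y z => by
          rw [Subsingleton.elim inst (instDecidableEqFin m)]
          simp only [Fin.cons_update, dFun_update_add, AlternatingMap.map_update_add]
          ring
        map_update_smul' := fun {inst} v i a y => by
          rw [Subsingleton.elim inst (instDecidableEqFin m)]
          simp only [Fin.cons_update, dFun_update_smul, AlternatingMap.map_update_smul, smul_eq_mul]
          ring
        map_eq_zero_of_eq' := fun w i j hw hij => by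
          have hsum : ∑ k, α m (Function.update w k ⁅x, w k⁆) = 0 := by
            refine (Finset.sum_eq_add i j hij (fun k _ hk => ?_) (by simp) (by simp)).trans ?_
            · refine (α m).map_eq_zero_of_eq _ (i := i) (j := j) ?_ hij
              rw [Function.update_of_ne hk.1.symm, Function.update_of_ne hk.2.symm, hw]
            · have h1 : Function.update w j ⁅x, w j⁆ =
                  Function.update w i ⁅x, w i⁆ ∘ Equiv.swap i j := by
                funext k
                by_cases hki : k = i
                · subst hki
                  simp [Function.update_of_ne hij, Function.update_of_ne hij.symm, hw]
                · by_cases hkj : k = j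
                  · subst hkj
                    simp [hw]
                  · simp [Equiv.swap_apply_of_ne_of_ne hki hkj, Function.update_of_ne hki,
                      Function.update_of_ne hkj]
              rw [h1, (α m).map_swap _ hij, add_neg_cancel]
          simp only [dFun, Fin.cons_zero, Fin.tail_cons, hsum, (α m).map_eq_zero_of_eq w hw hij,
            map_zero]
          change 0 - 0 - dFun m (contract x α) w + dFun m (contract x α) w = 0
          ring }
    refine form_eq_zero_of_eq (dFun (m + 1) α) (fun x => Lie x - D (contract x α)) ?_ ?_ v i j hv hij
    · intro v
      simp [Lie, Fin.cons_self_tail]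
    · intro v k hk hv
      obtain ⟨m, rfl⟩ : ∃ m', m = m' + 1 := ⟨m - 1, by have := k.pos; omega⟩
      obtain rfl : k = 0 := Fin.ext hk
      have h0 : Fin.tail v 0 = v 0 := hv
      have hz : dFun m (contract (v 0) (contract (v 0) α)) (Fin.tail (Fin.tail v)) = 0 := by
        rw [contract_self]
        simpa using dFun_real_smul m 0 0 (Fin.tail (Fin.tail v))
      have hα : ∀ w : Fin m → Derivation ℝ A A,
          contract (v 0) α m w = α (m + 1) (Fin.cons (v 0) w) := fun w => rfl
      have ht : (Fin.cons (v 0) (Fin.tail (Fin.tail v)) : Fin (m + 1) → Derivation ℝ A A) =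
          Fin.tail v := by
        rw [← h0, Fin.cons_self_tail]
      have hs : ∀ i : Fin m, Function.update (Fin.tail v) i.succ ⁅v 0, Fin.tail v i.succ⁆ =
          Fin.cons (v 0) (Function.update (Fin.tail (Fin.tail v)) i
            ⁅v 0, Fin.tail (Fin.tail v) i⁆) := by
        intro i
        rw [Fin.cons_update, ht]
        rfl
      have hb : α (m + 1) (Function.update (Fin.tail v) 0 ⁅v 0, v 0⁆) = 0 := by
        rw [lie_self]
        exact (α (m + 1)).map_coord_zero 0 (by simp)
      simp only [dFun, Fin.sum_univ_succ, hb, hs, hα, h0, ht, hz]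
      ring

/-- The exterior derivative. -/
def extD : Forms A →ₗ[ℝ] Forms A where
  toFun α m :=
    { toFun := dFun m α
      map_update_add' := fun {inst} v i x y => by
        rw [Subsingleton.elim inst (instDecidableEqFin m)]
        exact dFun_update_add m α v i x y
      map_update_smul' := fun {inst} v i a x => by
        rw [Subsingleton.elim inst (instDecidableEqFin m)]
        exact dFun_update_smul m α v i a x
      map_eq_zero_of_eq' := dFun_eq_zero m α }
  map_add' α β := by
    funext m
    ext v
    exact dFun_add m α β v
  map_smul' c α := by
    funext m
    ext v
    exact dFun_real_smul m c α v

/-- The constant function `1` as a form of degree `0`. -/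
def oneForm : Forms A
  | 0 => AlternatingMap.constOfIsEmpty A (Derivation ℝ A A) (Fin 0) 1
  | _ + 1 => 0

variable (A) in
/-- The forms that are homogeneous of degree `p`. -/
def homog (p : ℤ) : Submodule ℝ (Forms A) where
  carrier := {α | ∀ q : ℕ, (q : ℤ) ≠ p → α q = 0}
  zero_mem' _ _ := rfl
  add_mem' ha hb q hq := by simp [ha q hq, hb q hq]
  smul_mem' c α ha q hq := by simp [ha q hq]

theorem oneForm_mem : (oneForm : Forms A) ∈ homog A 0 := by
  intro q hq
  cases q with
  | zero => simp at hq
  | succ q => rfl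

theorem contract_mem {p : ℤ} {α : Forms A} (hα : α ∈ homog A p) (v : Derivation ℝ A A) :
    contract v α ∈ homog A (p - 1) := by
  intro q hq
  have h : α (q + 1) = 0 := hα (q + 1) (by push_cast; omega)
  change (α (q + 1)).curryLeft v = 0
  rw [h]
  rfl

theorem parity_mem {p : ℤ} {α : Forms A} (hα : α ∈ homog A p) : parity α ∈ homog A p := by
  intro q hq
  change (-1 : A) ^ q • α q = 0
  rw [hα q hq, smul_zero]

theorem wedge_mem {p q : ℤ} {α β : Forms A} (hα : α ∈ homog A p) (hβ : β ∈ homog A q) :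
    wedge α β ∈ homog A (p + q) := by
  have key : ∀ (m : ℕ) (p q : ℤ) (α β : Forms A), α ∈ homog A p → β ∈ homog A q →
      (m : ℤ) ≠ p + q → ∀ v, wedgeFun m α β v = 0 := by
    intro m
    induction m with
    | zero =>
      intro p q α β hα hβ hm v
      by_cases hp : p = 0
      · have h : β 0 = 0 := hβ 0 (by push_cast at hm ⊢; omega)
        simp [wedgeFun, h]
      · have h : α 0 = 0 := hα 0 (by push_cast; omega)
        simp [wedgeFun, h]
    | succ m ih =>
      intro p q α β hα hβ hm v
      push_cast at hm
      rw [wedgeFun, ih (p - 1) q _ _ (contract_mem hα _) hβ (by omega),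
        ih p (q - 1) _ _ (parity_mem hα) (contract_mem hβ _) (by omega), add_zero]
  intro m hm
  ext v
  exact key m p q α β hα hβ hm v

theorem extD_mem {p : ℤ} {α : Forms A} (hα : α ∈ homog A p) : extD α ∈ homog A (p + 1) := by
  have key : ∀ (m : ℕ) (p : ℤ) (α : Forms A), α ∈ homog A p → (m : ℤ) ≠ p + 1 →
      ∀ v, dFun m α v = 0 := by
    intro m
    induction m with
    | zero => intro _ _ _ _ _; rfl
    | succ m ih =>
      intro p α hα hm v
      push_cast at hm
      have h : α m = 0 := hα m (by omega)
      rw [dFun, ih (p - 1) _ (contract_mem hα _) (by omega), h]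
      simp
  intro m hm
  ext v
  exact key m p α hα hm v

end Forms

section Graded

/-- The total degree of a list of homogeneous elements. -/
def degSum {T : Type*} (deg : T → ℤ) (xs : List T) : ℤ := (xs.map deg).sum

/-- The sum of `± f S R` over all ways to split the list `xs` of homogeneous elements into a sublist
`S` and the complementary sublist `R`; the sign is the Koszul sign of the unshuffle
`x_1 ⋯ x_m = ± S R` in the free graded commutative algebra. -/
def unshuffle {T M : Type*} [AddCommGroup M] (deg : T → ℤ) :
    (List T → List T → M) → List T → M
  | f, [] => f [] []
  | f, a :: t =>
      unshuffle deg (fun S R => f (a :: S) R) t +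
        unshuffle deg (fun S R => (deg a * degSum deg S).negOnePow • f S (a :: R)) t

variable {L : Type*} [AddCommGroup L] [Module ℝ L]

/-- The value of a family of `k`-ary brackets on a list of homogeneous elements. -/
def evalBracket {𝓛 : ℤ → Submodule ℝ L} (l : ∀ k : ℕ, MultilinearMap ℝ (fun _ : Fin k => L) L)
    (xs : List (Σ i, 𝓛 i)) : L :=
  l xs.length fun k => ((xs.get k).2 : L)

/-- A pointed formal `Q`-structure (Lie-infinity structure) on the graded vector space
`L = ⨁ 𝓛 i`: a degree `1` coderivation of square zero of the graded symmetric coalgebra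
`Sym_c^+(L)`, given by its Taylor coefficients `Sym^k(L) → L[1]`, `k ≥ 1`. -/
structure LInfinity (𝓛 : ℤ → Submodule ℝ L) where
  bracket : ∀ k : ℕ, MultilinearMap ℝ (fun _ : Fin k => L) L
  bracket_zero : bracket 0 = 0
  degree : ∀ xs : List (Σ i, 𝓛 i), evalBracket bracket xs ∈ 𝓛 (degSum Sigma.fst xs + 1)
  symm : ∀ (s : List (Σ i, 𝓛 i)) (a b : Σ i, 𝓛 i) (t : List (Σ i, 𝓛 i)),
    evalBracket bracket (s ++ a :: b :: t) =
      (a.1 * b.1).negOnePow • evalBracket bracket (s ++ b :: a :: t)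
  square_zero : ∀ xs : List (Σ i, 𝓛 i),
    unshuffle Sigma.fst
      (fun S R => evalBracket bracket (⟨_, ⟨evalBracket bracket S, degree S⟩⟩ :: R)) xs = 0

/-- The vector field `Q` is polynomial: each of its components (with values in a fixed `𝓛 r`)
involves only finitely many Taylor coefficients and finitely many of the graded pieces `𝓛 i`.
Equivalently, the corresponding derivation maps polynomial functions on `L` to polynomial ones. -/
def LInfinity.IsPolynomial {𝓛 : ℤ → Submodule ℝ L} (Q : LInfinity 𝓛) : Prop :=
  ∀ r : ℤ, ∃ (N : ℕ) (D : Finset ℤ), ∀ xs : List (Σ i, 𝓛 i), degSum Sigma.fst xs + 1 = r →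
    evalBracket Q.bracket xs ≠ 0 → xs.length ≤ N ∧ ∀ x ∈ xs, x.1 ∈ D

end Graded

section Complex

variable (A : Type*) [CommRing A] [Algebra ℝ A]
variable {L : Type*} [AddCommGroup L] [Module ℝ L] (𝓛 : ℤ → Submodule ℝ L)

/-- A decomposable section `form ⊗ vec` of the bundle `α^{j,i} = Λ^j ⊗ L^i`, with `j = formDeg`,
`i = tgtDeg`. These span `Γ(α^{j,i}) = Ω^j(X) ⊗ L^i`. -/
structure Sec where
  formDeg : ℤ
  tgtDeg : ℤ
  form : homog A formDeg
  vec : 𝓛 tgtDeg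

variable {A 𝓛}

/-- The total degree `q = j + i` of a section of `α^{j,i}`. -/
def Sec.deg (a : Sec A 𝓛) : ℤ := a.formDeg + a.tgtDeg

/-- The twisted de Rham operator `Q_DR (ω ⊗ y) = dω ⊗ y`. -/
def deRhamSec (a : Sec A 𝓛) : Sec A 𝓛 where
  formDeg := a.formDeg + 1
  tgtDeg := a.tgtDeg
  form := ⟨extD (a.form : Forms A), extD_mem a.form.2⟩
  vec := a.vec

/-- `ω_1 ∧ ⋯ ∧ ω_k`. -/
def wedgeAll : List (Sec A 𝓛) → Forms A
  | [] => oneForm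
  | a :: t => wedge (a.form : Forms A) (wedgeAll t)

theorem wedgeAll_mem (S : List (Sec A 𝓛)) : wedgeAll S ∈ homog A (degSum Sec.formDeg S) := by
  induction S with
  | nil => exact oneForm_mem
  | cons a t ih =>
    have h : degSum Sec.formDeg (a :: t) = a.formDeg + degSum Sec.formDeg t := by simp [degSum]
    rw [h]
    exact wedge_mem a.form.2 ih

/-- The Koszul sign of
`(ω_1 ⊗ y_1) ⋯ (ω_k ⊗ y_k) = ± (ω_1 ∧ ⋯ ∧ ω_k) ⊗ (y_1 ⋯ y_k)`. -/
def sepSign : List (Sec A 𝓛) → ℤˣ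
  | [] => 1
  | a :: t => (a.tgtDeg * degSum Sec.formDeg t).negOnePow * sepSign t

/-- The vectors `y_1, …, y_k` of a list of sections `ω_a ⊗ y_a`. -/
def vecs (S : List (Sec A 𝓛)) : List (Σ i, 𝓛 i) := S.map fun a => ⟨a.tgtDeg, a.vec⟩

/-- The `Ω(X)`-multilinear extension of the Taylor coefficients of `Q_L` to sections,
`l_k(ω_1 ⊗ y_1, …, ω_k ⊗ y_k) = ± (ω_1 ∧ ⋯ ∧ ω_k) ⊗ l_k(y_1, …, y_k)`, with the Koszul sign for
moving `l_k` (of degree `1`) and the `y_a` past the forms. -/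
def bracketSec (Q : LInfinity 𝓛) (S : List (Sec A 𝓛)) : Sec A 𝓛 where
  formDeg := degSum Sec.formDeg S
  tgtDeg := degSum Sigma.fst (vecs S) + 1
  form := ((degSum Sec.formDeg S).negOnePow * sepSign S) • ⟨wedgeAll S, wedgeAll_mem S⟩
  vec := ⟨evalBracket Q.bracket (vecs S), Q.degree (vecs S)⟩

variable (A 𝓛) in
/-- Functions of finite lists of decomposable sections with values in differential forms. The
cochains below are those that are multilinear, i.e. that are (sums over `l` of) `l`-linear maps
from `Γ(α^•) = ⨁ Ω^j(X) ⊗ L^i` to `Ω(X)`, and are moreover graded symmetric differential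
operators. -/
def Cochain : Type _ := List (Sec A 𝓛) → Forms A

instance : AddCommGroup (Cochain A 𝓛) := inferInstanceAs (AddCommGroup (List (Sec A 𝓛) → Forms A))

instance : Module ℝ (Cochain A 𝓛) := inferInstanceAs (Module ℝ (List (Sec A 𝓛) → Forms A))

@[simp] theorem Cochain.zero_apply (as : List (Sec A 𝓛)) : (0 : Cochain A 𝓛) as = 0 := rfl

@[simp] theorem Cochain.add_apply (F G : Cochain A 𝓛) (as : List (Sec A 𝓛)) :
    (F + G) as = F as + G as := rfl

@[simp] theorem Cochain.smul_apply (c : ℝ) (F : Cochain A 𝓛) (as : List (Sec A 𝓛)) :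
    (c • F) as = c • F as := rfl

/-- `F` is `ℝ`-multilinear: additive and homogeneous in the form and in the vector of each
argument `ω ⊗ y`. -/
def IsMultilinear (F : Cochain A 𝓛) : Prop :=
  ∀ (s t : List (Sec A 𝓛)) (j i : ℤ),
    (∀ (u u' : homog A j) (y : 𝓛 i),
      F (s ++ ⟨j, i, u + u', y⟩ :: t) = F (s ++ ⟨j, i, u, y⟩ :: t) + F (s ++ ⟨j, i, u', y⟩ :: t)) ∧
    (∀ (u : homog A j) (y y' : 𝓛 i),
      F (s ++ ⟨j, i, u, y + y'⟩ :: t) = F (s ++ ⟨j, i, u, y⟩ :: t) + F (s ++ ⟨j, i, u, y'⟩ :: t)) ∧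
    (∀ (c : ℝ) (u : homog A j) (y : 𝓛 i),
      F (s ++ ⟨j, i, c • u, y⟩ :: t) = c • F (s ++ ⟨j, i, u, y⟩ :: t)) ∧
    (∀ (c : ℝ) (u : homog A j) (y : 𝓛 i),
      F (s ++ ⟨j, i, u, c • y⟩ :: t) = c • F (s ++ ⟨j, i, u, y⟩ :: t))

/-- `F` is symmetric in the graded sense, with respect to the total degree of sections. -/
def IsGradedSymmetric (F : Cochain A 𝓛) : Prop :=
  ∀ (s : List (Sec A 𝓛)) (a b : Sec A 𝓛) (t : List (Sec A 𝓛)),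
    F (s ++ a :: b :: t) = (a.deg * b.deg).negOnePow • F (s ++ b :: a :: t)

variable {X : Type*} (𝔪 : X → Ideal A)

/-- The `k`-jet of a form at the point `x`, with ideal `𝔪 x`, vanishes: all its components lie in
`𝔪_x^{k+1}`. For `k = 0`, the form vanishes at `x`. -/
def JetVanishes (k : ℕ) (x : X) (α : Forms A) : Prop :=
  ∀ (p : ℕ) (v : Fin p → Derivation ℝ A A), α p v ∈ 𝔪 x ^ (k + 1)

/-- On the argument list `as`, the value of `F` at each point depends only on the `k`-jets of the
arguments at that point. -/
def JetLocalAt (F : Cochain A 𝓛) (k : ℕ) (as : List (Sec A 𝓛)) : Prop :=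
  ∀ x : X, (∃ a ∈ as, JetVanishes 𝔪 k x (a.form : Forms A)) → JetVanishes 𝔪 0 x (F as)

theorem JetLocalAt.mono {F : Cochain A 𝓛} {k k' : ℕ} (h : k ≤ k') {as : List (Sec A 𝓛)}
    (hF : JetLocalAt 𝔪 F k as) : JetLocalAt 𝔪 F k' as := by
  rintro x ⟨a, ha, hx⟩
  exact hF x ⟨a, ha, fun p v => Ideal.pow_le_pow_right (by omega) (hx p v)⟩

theorem JetLocalAt.add {F G : Cochain A 𝓛} {k : ℕ} {as : List (Sec A 𝓛)}
    (hF : JetLocalAt 𝔪 F k as) (hG : JetLocalAt 𝔪 G k as) : JetLocalAt 𝔪 (F + G) k as :=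
  fun x hx p v => Ideal.add_mem _ (hF x hx p v) (hG x hx p v)

theorem JetLocalAt.smul {F : Cochain A 𝓛} {k : ℕ} {as : List (Sec A 𝓛)} (c : ℝ)
    (hF : JetLocalAt 𝔪 F k as) : JetLocalAt 𝔪 (c • F) k as :=
  fun x hx p v => Submodule.smul_of_tower_mem _ c (hF x hx p v)

theorem JetLocalAt.zero (k : ℕ) (as : List (Sec A 𝓛)) :
    JetLocalAt 𝔪 (0 : Cochain A 𝓛) k as :=
  fun _ _ _ _ => Ideal.zero_mem _

variable (A 𝓛) in
/-- The algebraic conditions on cochains: multilinear, graded symmetric, and vanishing on the zero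
section (no component with `l = 0` arguments). -/
def symCochains : Submodule ℝ (Cochain A 𝓛) where
  carrier := {F | IsMultilinear F ∧ IsGradedSymmetric F ∧ F [] = 0}
  zero_mem' := by
    exact ⟨fun s t j i => ⟨fun _ _ _ => (add_zero 0).symm, fun _ _ _ => (add_zero 0).symm,
      fun c _ _ => (smul_zero c).symm, fun c _ _ => (smul_zero c).symm⟩,
      fun _ _ _ _ => (smul_zero _).symm, rfl⟩
  add_mem' := by
    rintro F G ⟨hF, hF', hF0⟩ ⟨hG, hG', hG0⟩
    refine ⟨fun s t j i => ⟨fun u u' y => ?_, fun u y y' => ?_, fun c u y => ?_,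
      fun c u y => ?_⟩, fun s a b t => ?_, ?_⟩
    · simp only [Cochain.add_apply, (hF s t j i).1, (hG s t j i).1]
      exact add_add_add_comm _ _ _ _
    · simp only [Cochain.add_apply, (hF s t j i).2.1, (hG s t j i).2.1]
      exact add_add_add_comm _ _ _ _
    · simp only [Cochain.add_apply, (hF s t j i).2.2.1, (hG s t j i).2.2.1, smul_add]
    · simp only [Cochain.add_apply, (hF s t j i).2.2.2, (hG s t j i).2.2.2, smul_add]
    · rw [Cochain.add_apply, hF' s a b t, hG' s a b t, ← smul_add]
      rfl
    · rw [Cochain.add_apply, hF0, hG0, add_zero]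
  smul_mem' := by
    rintro r F ⟨hF, hF', hF0⟩
    refine ⟨fun s t j i => ⟨fun u u' y => ?_, fun u y y' => ?_, fun c u y => ?_,
      fun c u y => ?_⟩, fun s a b t => ?_, ?_⟩
    · simp only [Cochain.smul_apply, (hF s t j i).1, smul_add]
    · simp only [Cochain.smul_apply, (hF s t j i).2.1, smul_add]
    · simp only [Cochain.smul_apply, (hF s t j i).2.2.1]
      exact smul_comm _ _ _
    · simp only [Cochain.smul_apply, (hF s t j i).2.2.2]
      exact smul_comm _ _ _
    · rw [Cochain.smul_apply, hF' s a b t, smul_comm]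
      rfl
    · rw [Cochain.smul_apply, hF0, smul_zero]

variable (𝓛) in
/-- Polynomial horizontal forms vanishing on the zero section, `Sym^+ D(α^•, Λ_X)`: finite sums of
graded symmetric `l`-linear differential operators, `l ≥ 1`, of finite order, involving finitely
many of the bundles `Λ^j ⊗ L^i`. -/
def polyCochains : Submodule ℝ (Cochain A 𝓛) where
  carrier := {F | F ∈ symCochains A 𝓛 ∧ ∃ (N k : ℕ) (D : Finset ℤ),
    (∀ as : List (Sec A 𝓛), F as ≠ 0 → as.length ≤ N ∧ ∀ a ∈ as, a.tgtDeg ∈ D) ∧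
    ∀ as : List (Sec A 𝓛), JetLocalAt 𝔪 F k as}
  zero_mem' := ⟨zero_mem _, 0, 0, ∅, fun _ h => absurd rfl h, fun as => JetLocalAt.zero 𝔪 0 as⟩
  add_mem' := by
    classical
    rintro F G ⟨hF, N, k, D, h1, h2⟩ ⟨hG, N', k', D', h1', h2'⟩
    refine ⟨add_mem hF hG, max N N', max k k', D ∪ D', fun as h => ?_, fun as =>
      ((h2 as).mono 𝔪 (le_max_left _ _)).add 𝔪 ((h2' as).mono 𝔪 (le_max_right _ _))⟩
    by_cases h0 : F as = 0
    · have hG0 : G as ≠ 0 := fun h3 => h (by rw [Cochain.add_apply, h0, h3, add_zero])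
      exact ⟨(h1' as hG0).1.trans (le_max_right _ _),
        fun a ha => Finset.mem_union_right _ ((h1' as hG0).2 a ha)⟩
    · exact ⟨(h1 as h0).1.trans (le_max_left _ _),
        fun a ha => Finset.mem_union_left _ ((h1 as h0).2 a ha)⟩
  smul_mem' := by
    rintro c F ⟨hF, N, k, D, h1, h2⟩
    refine ⟨Submodule.smul_mem _ c hF, N, k, D, fun as h => h1 as fun h0 => h ?_,
      fun as => (h2 as).smul 𝔪 c⟩
    rw [Cochain.smul_apply, h0, smul_zero]

variable (𝓛) in
/-- Formal power series version, `∏_{l ≥ 1} Sym^l D(α^•, Λ_X)`: graded symmetric multilinear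
operators whose components, for a fixed number of arguments of fixed bidegrees, are differential
operators of finite order. -/
def formalCochains : Submodule ℝ (Cochain A 𝓛) where
  carrier := {F | F ∈ symCochains A 𝓛 ∧ ∀ τ : List (ℤ × ℤ), ∃ k : ℕ, ∀ as : List (Sec A 𝓛),
    as.map (fun a => (a.formDeg, a.tgtDeg)) = τ → JetLocalAt 𝔪 F k as}
  zero_mem' := ⟨zero_mem _, fun _ => ⟨0, fun as _ => JetLocalAt.zero 𝔪 0 as⟩⟩
  add_mem' := by
    rintro F G ⟨hF, h⟩ ⟨hG, h'⟩
    refine ⟨add_mem hF hG, fun τ => ?_⟩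
    obtain ⟨k, hk⟩ := h τ
    obtain ⟨k', hk'⟩ := h' τ
    exact ⟨max k k', fun as ha => ((hk as ha).mono 𝔪 (le_max_left _ _)).add 𝔪
      ((hk' as ha).mono 𝔪 (le_max_right _ _))⟩
  smul_mem' := by
    rintro c F ⟨hF, h⟩
    refine ⟨Submodule.smul_mem _ c hF, fun τ => ?_⟩
    obtain ⟨k, hk⟩ := h τ
    exact ⟨k, fun as ha => (hk as ha).smul 𝔪 c⟩

variable (A 𝓛) in
/-- The horizontal differential: composition with the de Rham differential,
`(d_h F)[φ] = d (F[φ])`. -/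
def dH : Cochain A 𝓛 →ₗ[ℝ] Cochain A 𝓛 where
  toFun F as := extD (F as)
  map_add' F G := by funext as; exact map_add extD (F as) (G as)
  map_smul' c F := by funext as; exact map_smul extD c (F as)

/-- The term of `s F` in which the homological vector field `Q_BRST = Q_DR + Q_L` is applied to
the arguments `S` (`Q_DR` is linear), the remaining arguments being `R`. -/
def brstTerm (Q : LInfinity 𝓛) (F : Cochain A 𝓛) (R : List (Sec A 𝓛)) : List (Sec A 𝓛) → Forms A
  | [] => 0
  | [a] => F (deRhamSec a :: R) + F (bracketSec Q [a] :: R)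
  | a :: b :: S => F (bracketSec Q (a :: b :: S) :: R)

theorem unshuffle_add {T M : Type*} [AddCommGroup M] (deg : T → ℤ) (f g : List T → List T → M)
    (xs : List T) :
    unshuffle deg (fun S R => f S R + g S R) xs = unshuffle deg f xs + unshuffle deg g xs := by
  induction xs generalizing f g with
  | nil => rfl
  | cons a t ih => simp only [unshuffle, ih, smul_add]; abel

theorem unshuffle_smul {T M : Type*} [AddCommGroup M] [Module ℝ M] (deg : T → ℤ) (c : ℝ)
    (f : List T → List T → M) (xs : List T) :
    unshuffle deg (fun S R => c • f S R) xs = c • unshuffle deg f xs := by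
  induction xs generalizing f with
  | nil => rfl
  | cons a t ih => simp only [unshuffle, ih, smul_add, smul_comm _ c]

/-- The BRST differential `s`: the evolutionary vector field of `Q_BRST`, acting on the polarised
functionals by `(s F)(φ_1, …, φ_m) = (-1)^p ∑_S ± F(Q_BRST(φ_S), φ_{S^c})` on forms of horizontal
degree `p`; the factor `(-1)^p` makes it anticommute with `d_h`. -/
def brst (Q : LInfinity 𝓛) : Cochain A 𝓛 →ₗ[ℝ] Cochain A 𝓛 where
  toFun F as := parity (unshuffle Sec.deg (fun S R => brstTerm Q F R S) as)
  map_add' F G := by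
    funext as
    have h : (fun S R => brstTerm Q (F + G) R S) =
        fun S R => brstTerm Q F R S + brstTerm Q G R S := by
      funext S R
      rcases S with _ | ⟨a, _ | ⟨b, S⟩⟩
      · exact (add_zero 0).symm
      · exact add_add_add_comm _ _ _ _
      · rfl
    rw [h, unshuffle_add, map_add]
    rfl
  map_smul' c F := by
    funext as
    have h : (fun S R => brstTerm Q (c • F) R S) = fun S R => c • brstTerm Q F R S := by
      funext S R
      rcases S with _ | ⟨a, _ | ⟨b, S⟩⟩
      · exact (smul_zero c).symm
      · exact (smul_add c _ _).symm
      · rfl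
    rw [h, unshuffle_smul]
    funext p
    exact smul_comm ((-1 : A) ^ p) c _

/-- The cochains in `C` of horizontal form degree `p` and ghost degree `g`. Since coordinate
functions on a space of degree `q` have degree `-q`, ghost degree `g` means that `F` is supported
on arguments of total degree `-g`. -/
def bigraded (C : Submodule ℝ (Cochain A 𝓛)) (p g : ℤ) : Submodule ℝ (Cochain A 𝓛) where
  carrier := {F | F ∈ C ∧ ∀ (as : List (Sec A 𝓛)) (q : ℕ),
    ¬ ((q : ℤ) = p ∧ -degSum Sec.deg as = g) → F as q = 0}
  zero_mem' := ⟨zero_mem _, fun _ _ _ => rfl⟩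
  add_mem' := by
    rintro F G ⟨hF, h⟩ ⟨hG, h'⟩
    refine ⟨add_mem hF hG, fun as q hq => ?_⟩
    rw [Cochain.add_apply, Pi.add_apply, h as q hq, h' as q hq, add_zero]
  smul_mem' := by
    rintro c F ⟨hF, h⟩
    refine ⟨Submodule.smul_mem _ c hF, fun as q hq => ?_⟩
    rw [Cochain.smul_apply, Pi.smul_apply, h as q hq, smul_zero]

/-- The cochains in `C` of total degree `m`, where the total degree is the sum of the horizontal
form degree and the ghost degree. -/
def totalGraded (C : Submodule ℝ (Cochain A 𝓛)) (m : ℤ) : Submodule ℝ (Cochain A 𝓛) where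
  carrier := {F | F ∈ C ∧ ∀ (as : List (Sec A 𝓛)) (q : ℕ),
    (q : ℤ) - degSum Sec.deg as ≠ m → F as q = 0}
  zero_mem' := ⟨zero_mem _, fun _ _ _ => rfl⟩
  add_mem' := by
    rintro F G ⟨hF, h⟩ ⟨hG, h'⟩
    refine ⟨add_mem hF hG, fun as q hq => ?_⟩
    rw [Cochain.add_apply, Pi.add_apply, h as q hq, h' as q hq, add_zero]
  smul_mem' := by
    rintro c F ⟨hF, h⟩
    refine ⟨Submodule.smul_mem _ c hF, fun as q hq => ?_⟩
    rw [Cochain.smul_apply, Pi.smul_apply, h as q hq, smul_zero]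

/-- The component of horizontal form degree `p` of a cochain. -/
def component (p : ℕ) (F : Cochain A 𝓛) : Cochain A 𝓛 := fun as => Pi.single p (F as p)

variable (C : Submodule ℝ (Cochain A 𝓛)) (Q : LInfinity 𝓛)

/-- Total cocycles of degree `m`. -/
def totalCocycles (m : ℤ) : Submodule ℝ (Cochain A 𝓛) :=
  totalGraded C m ⊓ LinearMap.ker (brst Q + dH A 𝓛)

/-- Total coboundaries of degree `m`. -/
def totalCoboundaries (m : ℤ) : Submodule ℝ (Cochain A 𝓛) :=
  (totalGraded C (m - 1)).map (brst Q + dH A 𝓛)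

/-- The total cohomology `H^m(s + d_h)`. -/
abbrev TotalCohomology (m : ℤ) : Type _ :=
  totalCocycles C Q m ⧸ (totalCoboundaries C Q m).submoduleOf (totalCocycles C Q m)

/-- The `d_h`-cocycles of bidegree `(p, g)`. -/
def horCocycles (p g : ℤ) : Submodule ℝ (Cochain A 𝓛) := bigraded C p g ⊓ LinearMap.ker (dH A 𝓛)

/-- The `d_h`-coboundaries of bidegree `(p, g)`. -/
def horCoboundaries (p g : ℤ) : Submodule ℝ (Cochain A 𝓛) := (bigraded C (p - 1) g).map (dH A 𝓛)

/-- Representatives of the cocycles of the complex `(H^p(d_h), s)` in ghost degree `g`: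
`d_h`-cocycles `F` with `[s F] = 0` in `H^p(d_h)`. -/
def iteratedCocycles (g p : ℤ) : Submodule ℝ (Cochain A 𝓛) :=
  horCocycles C p g ⊓ (horCoboundaries C p (g + 1)).comap (brst Q)

/-- Representatives of the coboundaries of the complex `(H^p(d_h), s)` in ghost degree `g`:
sums of some `s G`, with `G` a `d_h`-cocycle, and a `d_h`-coboundary. -/
def iteratedCoboundaries (g p : ℤ) : Submodule ℝ (Cochain A 𝓛) :=
  (horCocycles C p (g - 1)).map (brst Q) ⊔ horCoboundaries C p g

/-- The iterated cohomology `H^{g,p}(s | d_h) = H^g(H^p(d_h), s)`. -/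
abbrev IteratedCohomology (g p : ℤ) : Type _ :=
  iteratedCocycles C Q g p ⧸ (iteratedCoboundaries C Q g p).submoduleOf (iteratedCocycles C Q g p)

end Complex

section Manifold

open scoped Manifold ContDiff

variable (n : ℕ) (X : Type*) [TopologicalSpace X] [ChartedSpace (EuclideanSpace ℝ (Fin n)) X]

/-- The algebra `C^∞(X)`. -/
abbrev SmoothFun : Type _ := C^∞⟮𝓡 n, X; ℝ⟯

variable {X}

/-- The ideal of smooth functions vanishing at `x`. -/
def vanishingIdeal (x : X) : Ideal (SmoothFun n X) :=
  RingHom.ker (ContMDiffMap.evalRingHom x : SmoothFun n X →+* ℝ)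

end Manifold

end LocalBRST

end

open scoped Manifold ContDiff
open LocalBRST

/-!
The isomorphism is the descent argument for the double complex with differentials `s` and `d_h`.
Let `z` be a total cocycle of total degree `g + n`. As there are no forms of degree above `n`
(`CoordCover.subsingleton_form`), its top component is `d_h`-closed, and `s zⁿ = -d_h zⁿ⁻¹`, so the
top component is a cocycle of the iterated complex. If `d_h` is exact in the form degrees below `n`,
a cocycle or coboundary of the iterated complex can be completed to a total one by correcting the
components degree by degree downwards; this is `exists_equiv_of_exactBelow`. It needs, besides
exactness, that `s² = 0` and `s d_h + d_h s = 0` (`brst_brst`, `brst_dH`) and that `s` preserves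
the polynomial and the formal cochains (`brst_mem_polyCochains`, `brst_mem_formalCochains`).

**The differential `s`.** It is dual to a coderivation: `s F` is a sum over unshuffles of values of
`F` on arguments some of which are replaced by the value of the homological vector field on them.
Koszul signs are handled once and for all by the coassociativity and cocommutativity of the
unshuffle coproduct. By `evol_anticomm`, the anticommutator of two evolutionary vector fields is
the one of the commutator of the vector fields, and `s² = 0` follows from `d² = 0`, the Leibniz
rule for the de Rham differential, and the relation `Q_L² = 0`.

**Exactness of `d_h` below the top degree.** The argument is algebraic. An operator `P` from forms
to `q`-forms with `d ∘ P = 0` has a symbol of order `m`, and in local coordinates `xⁱ` with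
coordinate vector fields `vᵢ` the Koszul contraction `∑ ι_{vᵢ} ∘ [P, xⁱ]` satisfies, by Cartan's
formula and Euler's identity for the symbol,
`d ∘ (∑ ι_{vᵢ} ∘ [P, xⁱ]) = (n - q + m) P` modulo operators of lower order
(`LocalCoords.extD_koszul`). For `q < n` the factor is not zero, and induction on the order gives a
differential operator `R` with `d ∘ R = P` (`LocalCoords.extD_localHomotopy`). The homotopy is
linear in `P`, so the local ones are glued: `P` is the sum of the operators `P ∘ χ_a` for a partition
of unity `χ_a`, and their homotopies are supported in coordinate neighbourhoods
(`CoordCover.extD_homotopy`). A graded symmetric `l`-linear operator is a differential operator in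
each of its arguments; applying the homotopy to one argument at a time and averaging over the
arguments gives a graded symmetric cochain (`dH_cochainHomotopy`). If the operator has order at
most `k` then the homotopy has order at most `2 k + 1` in all arguments
(`cochainHomotopy_jetLocalAt`), and the homotopy involves no other bidegrees or numbers of arguments.
Hence both complexes are exact below the top degree (`exactBelow_polyCochains`,
`exactBelow_formalCochains`).

**Forms and manifolds.** Forms are alternating multilinear functions of derivations of an algebra
`A`, and jets are described by the powers of the ideals of points. Everything above is done for an
algebra with a family of characters and an abstract cover by coordinate neighbourhoods
(`CoordCover`). Smooth functions on a manifold have such a cover (`exists_coordCover`): the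
coordinates and coordinate vector fields are cut off by bump functions, and Hadamard's lemma shows
that derivations are combinations of the coordinate vector fields, and that functions with
vanishing value and first derivatives at a point lie in the square of its ideal.
-/

noncomputable section

namespace LocalBRST

/-! ### Cartan calculus -/

section Calculus

variable {A : Type*} [CommRing A] [Algebra ℝ A]

theorem contract_apply (v : Derivation ℝ A A) (α : Forms A) (p : ℕ)
    (w : Fin p → Derivation ℝ A A) : contract v α p w = α (p + 1) (Fin.cons v w) := rfl

/-- The components of degree `m + 1` of two forms agree if the components of degree `m` of all
their contractions do. Identities between forms are proved with it by induction on the degree. -/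
theorem form_succ_ext {m : ℕ} {α β : Forms A}
    (h : ∀ v : Derivation ℝ A A, contract v α m = contract v β m) : α (m + 1) = β (m + 1) := by
  ext w
  have := congrArg (fun F : Form A m => F (Fin.tail w)) (h (w 0))
  simpa only [contract_apply, Fin.cons_self_tail] using this

theorem form_zero_ext {α β : Forms A} (h : α 0 ![] = β 0 ![]) : α 0 = β 0 := by
  ext w
  rw [Subsingleton.elim w ![]]
  exact h

@[simp] theorem parity_parity (α : Forms A) : parity (parity α) = α := by
  funext p
  change (-1 : A) ^ p • (-1 : A) ^ p • α p = α p
  rw [smul_smul, ← mul_pow]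
  simp

theorem contract_wedge (v : Derivation ℝ A A) (α β : Forms A) :
    contract v (wedge α β) = wedge (contract v α) β + wedge (parity α) (contract v β) := by
  funext p
  ext w
  change wedgeFun (p + 1) α β (Fin.cons v w) = wedgeFun p _ _ w + wedgeFun p _ _ w
  simp [wedgeFun]

theorem wedge_zero_apply (α β : Forms A) (w : Fin 0 → Derivation ℝ A A) :
    wedge α β 0 w = α 0 w * β 0 w := rfl

theorem wedge_add_left (α α' β : Forms A) : wedge (α + α') β = wedge α β + wedge α' β := by
  funext p; ext w; exact wedgeFun_add_left p α α' β w

theorem wedge_add_right (α β β' : Forms A) : wedge α (β + β') = wedge α β + wedge α β' := by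
  funext p; ext w; exact wedgeFun_add_right p α β β' w

theorem wedge_smul_left (a : A) (α β : Forms A) : wedge (a • α) β = a • wedge α β := by
  funext p; ext w; exact wedgeFun_smul_left p a α β w

theorem wedge_smul_right (a : A) (α β : Forms A) : wedge α (a • β) = a • wedge α β := by
  funext p; ext w; exact wedgeFun_smul_right p a α β w

/-- The exterior product as a bilinear map over the functions. -/
def wedgeₗ : Forms A →ₗ[A] Forms A →ₗ[A] Forms A :=
  LinearMap.mk₂ A wedge wedge_add_left wedge_smul_left wedge_add_right wedge_smul_right

theorem wedge_neg_left (α β : Forms A) : wedge (-α) β = -wedge α β :=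
  LinearMap.map_neg₂ wedgeₗ α β

theorem wedge_neg_right (α β : Forms A) : wedge α (-β) = -wedge α β :=
  map_neg (wedgeₗ α) β

theorem wedge_zero_left (β : Forms A) : wedge 0 β = 0 := LinearMap.map_zero₂ wedgeₗ β

theorem wedge_zero_right (α : Forms A) : wedge α 0 = 0 := map_zero (wedgeₗ α)

theorem parity_wedge (α β : Forms A) : parity (wedge α β) = wedge (parity α) (parity β) := by
  have key : ∀ (m : ℕ) (α β : Forms A), parity (wedge α β) m = wedge (parity α) (parity β) m := by
    intro m
    induction m with
    | zero =>
      intro α β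
      apply form_zero_ext
      change (-1 : A) ^ 0 * (_ * _) = ((-1 : A) ^ 0 * _) * ((-1 : A) ^ 0 * _)
      simp
    | succ m ih =>
      intro α β
      apply form_succ_ext
      intro v
      have h1 := contract_parity v (wedge α β)
      rw [h1, contract_wedge, contract_wedge, contract_parity, contract_parity, map_add,
        wedge_neg_left, wedge_neg_right]
      simp only [Pi.add_apply, Pi.neg_apply, ih, neg_add, parity_parity]
  exact funext fun m => key m α β

theorem wedge_assoc (α β γ : Forms A) : wedge (wedge α β) γ = wedge α (wedge β γ) := by
  have key : ∀ (m : ℕ) (α β γ : Forms A),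
      wedge (wedge α β) γ m = wedge α (wedge β γ) m := by
    intro m
    induction m with
    | zero => intro α β γ; ext w; exact mul_assoc _ _ _
    | succ m ih =>
      intro α β γ
      apply form_succ_ext
      intro v
      simp only [contract_wedge, wedge_add_left, wedge_add_right, Pi.add_apply, ih, parity_wedge]
      abel
  exact funext fun m => key m α β γ

@[simp] theorem contract_oneForm (v : Derivation ℝ A A) : contract v (oneForm : Forms A) = 0 := rfl

@[simp] theorem parity_oneForm : parity (oneForm : Forms A) = oneForm := by
  funext p
  change (-1 : A) ^ p • (oneForm : Forms A) p = _
  cases p with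
  | zero => simp
  | succ p => exact smul_zero _

@[simp] theorem wedge_oneForm (α : Forms A) : wedge α oneForm = α := by
  have key : ∀ (m : ℕ) (α : Forms A), wedge α oneForm m = α m := by
    intro m
    induction m with
    | zero => intro α; ext w; exact mul_one _
    | succ m ih =>
      intro α
      apply form_succ_ext
      intro v
      simp only [contract_wedge, contract_oneForm, wedge_zero_right, add_zero, ih]
  exact funext fun m => key m α

theorem parity_of_mem {p : ℤ} {α : Forms A} (hα : α ∈ homog A p) :
    parity α = p.negOnePow • α := by
  funext q
  change (-1 : A) ^ q • α q = p.negOnePow • α q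
  by_cases h : (q : ℤ) = p
  · subst h
    rw [Int.negOnePow_def, zpow_natCast]
    rcases Nat.even_or_odd q with hq | hq
    · simp [hq.neg_one_pow]
    · ext w
      simp [hq.neg_one_pow, Units.smul_def]
  · rw [hα q h, smul_zero, smul_zero]

theorem wedge_units_smul_left (u : ℤˣ) (α β : Forms A) : wedge (u • α) β = u • wedge α β := by
  rcases Int.units_eq_one_or u with rfl | rfl
  · simp
  · simp [wedge_neg_left]

theorem wedge_units_smul_right (u : ℤˣ) (α β : Forms A) : wedge α (u • β) = u • wedge α β := by
  rcases Int.units_eq_one_or u with rfl | rfl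
  · simp
  · simp [wedge_neg_right]

theorem contract_units_smul (v : Derivation ℝ A A) (u : ℤˣ) (α : Forms A) :
    contract v (u • α) = u • contract v α := rfl

/-- Graded commutativity of the exterior product. -/
theorem wedge_comm {p q : ℤ} {α β : Forms A} (hα : α ∈ homog A p) (hβ : β ∈ homog A q) :
    wedge α β = (p * q).negOnePow • wedge β α := by
  have key : ∀ (m : ℕ) (p q : ℤ) (α β : Forms A), α ∈ homog A p → β ∈ homog A q →
      wedge α β m = (p * q).negOnePow • wedge β α m := by
    intro m
    induction m with
    | zero =>
      intro p q α β hα hβ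
      by_cases h : p = 0 ∧ q = 0
      · obtain ⟨rfl, rfl⟩ := h
        ext w
        simpa [wedge_zero_apply] using mul_comm _ _
      · have : α 0 = 0 ∨ β 0 = 0 := by
          by_cases hp : p = 0
          · exact Or.inr (hβ 0 (by push_cast; tauto))
          · exact Or.inl (hα 0 (by push_cast; tauto))
        have h1 : wedge α β 0 = 0 := by
          ext w; rw [wedge_zero_apply]; rcases this with h | h <;> simp [h]
        have h2 : wedge β α 0 = 0 := by
          ext w; rw [wedge_zero_apply]; rcases this with h | h <;> simp [h]
        rw [h1, h2, smul_zero]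
    | succ m ih =>
      intro p q α β hα hβ
      refine form_succ_ext (β := (p * q).negOnePow • wedge β α) fun v => ?_
      rw [contract_units_smul, contract_wedge, contract_wedge, parity_of_mem hα, parity_of_mem hβ,
        wedge_units_smul_left, wedge_units_smul_left]
      simp only [Pi.add_apply, Pi.smul_apply, smul_add]
      rw [ih _ _ _ _ (contract_mem hα v) hβ, ih _ _ _ _ hα (contract_mem hβ v), add_comm]
      simp only [smul_smul, ← Int.negOnePow_add]
      congr 2
      · congr 1
        ring
      · rw [Int.negOnePow_eq_iff]
        exact ⟨-q, by ring⟩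
  exact funext fun m => key m p q α β hα hβ

/-- The Lie derivative of forms along a derivation, characterised by Cartan's formula. -/
def lieD (v : Derivation ℝ A A) : Forms A →ₗ[ℝ] Forms A where
  toFun α := contract v (extD α) + extD (contract v α)
  map_add' α β := by simp only [map_add]; abel
  map_smul' c α := by
    have h : ∀ β : Forms A, contract v (c • β) = c • contract v β := fun _ => rfl
    simp only [map_smul, h, smul_add, RingHom.id_apply]

/-- Cartan's formula, in the form that drives inductions on the degree. -/
theorem contract_extD (v : Derivation ℝ A A) (α : Forms A) :
    contract v (extD α) = lieD v α - extD (contract v α) :=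
  (add_sub_cancel_right _ _).symm

theorem lieD_eq (v : Derivation ℝ A A) (α : Forms A) :
    lieD v α = contract v (extD α) + extD (contract v α) := rfl

theorem lieD_apply (v : Derivation ℝ A A) (α : Forms A) (p : ℕ) (w : Fin p → Derivation ℝ A A) :
    lieD v α p w = v (α p w) - ∑ i, α p (Function.update w i ⁅v, w i⁆) := by
  change dFun (p + 1) α (Fin.cons v w) + dFun p (contract v α) w = _
  simp [dFun]

theorem extD_zero_apply (α : Forms A) : extD α 0 = 0 := rfl

theorem contract_lieD (v w : Derivation ℝ A A) (α : Forms A) :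
    contract w (lieD v α) = lieD v (contract w α) - contract ⁅v, w⁆ α := by
  funext p
  ext u
  change lieD v α (p + 1) (Fin.cons w u) = lieD v (contract w α) p u - contract ⁅v, w⁆ α p u
  rw [lieD_apply, lieD_apply, Fin.sum_univ_succ]
  simp only [contract_apply, Fin.cons_zero, Fin.cons_succ, Fin.update_cons_zero, Fin.cons_update]
  ring

theorem lieD_lie (v w : Derivation ℝ A A) (α : Forms A) :
    lieD ⁅v, w⁆ α = lieD v (lieD w α) - lieD w (lieD v α) := by
  have key : ∀ (m : ℕ) (v w : Derivation ℝ A A) (α : Forms A),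
      lieD ⁅v, w⁆ α m = lieD v (lieD w α) m - lieD w (lieD v α) m := by
    intro m
    induction m with
    | zero =>
      intro v w α
      ext u
      simp only [AlternatingMap.sub_apply]
      simp [lieD_apply, Derivation.commutator_apply]
    | succ m ih =>
      intro v w α
      refine form_succ_ext (β := lieD v (lieD w α) - lieD w (lieD v α)) fun u => ?_
      rw [map_sub]
      simp only [contract_lieD, map_sub, Pi.sub_apply, ih]
      rw [leibniz_lie v w u]
      simp only [contract_add, Pi.add_apply]
      have h : ⁅⁅v, w⁆, u⁆ = ⁅v, ⁅w, u⁆⁆ - ⁅w, ⁅v, u⁆⁆ := by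
        rw [leibniz_lie v w u]; abel
      rw [h, sub_eq_add_neg ⁅v, ⁅w, u⁆⁆, contract_add, leibniz_lie v w u, h, contract_add, Pi.add_apply, Pi.add_apply]
      abel
  exact funext fun m => key m v w α

theorem extD_lieD (v : Derivation ℝ A A) (α : Forms A) : extD (lieD v α) = lieD v (extD α) := by
  have key : ∀ (m : ℕ) (v : Derivation ℝ A A) (α : Forms A),
      extD (lieD v α) m = lieD v (extD α) m := by
    intro m
    induction m with
    | zero =>
      intro v α
      ext u
      rw [lieD_apply]
      simp [extD_zero_apply]
    | succ m ih =>
      intro v α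
      refine form_succ_ext fun u => ?_
      simp only [contract_extD, contract_lieD, map_sub, Pi.sub_apply, ih, lieD_lie]
      abel
  exact funext fun m => key m v α

theorem extD_extD (α : Forms A) : extD (extD α) = 0 := by
  have key : ∀ (m : ℕ) (α : Forms A), extD (extD α) m = 0 := by
    intro m
    induction m with
    | zero => intro α; rfl
    | succ m ih =>
      intro α
      refine form_succ_ext (β := 0) fun u => ?_
      rw [map_zero]
      simp only [contract_extD, map_sub, Pi.sub_apply, ih, extD_lieD, sub_zero, sub_self, Pi.zero_apply]
  exact funext fun m => key m α

theorem lieD_parity (v : Derivation ℝ A A) (α : Forms A) :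
    lieD v (parity α) = parity (lieD v α) := by
  funext p
  ext u
  have h : ∀ (β : Forms A) (w : Fin p → Derivation ℝ A A),
      parity β p w = (-1 : ℝ) ^ p • β p w := by
    intro β w
    change (-1 : A) ^ p * _ = _
    rw [Algebra.smul_def]
    simp
  rw [lieD_apply, h, h, lieD_apply]
  simp only [h, Derivation.map_smul, smul_sub, Finset.smul_sum]

theorem extD_parity (α : Forms A) : extD (parity α) = -parity (extD α) := by
  have key : ∀ (m : ℕ) (α : Forms A), extD (parity α) m = -parity (extD α) m := by
    intro m
    induction m with
    | zero =>
      intro α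
      change (0 : Form A 0) = -((-1 : A) ^ 0 • 0)
      simp
    | succ m ih =>
      intro α
      refine form_succ_ext (β := -parity (extD α)) fun u => ?_
      rw [map_neg]
      simp only [contract_extD, contract_parity, map_neg, map_sub, Pi.sub_apply, Pi.neg_apply, ih,
        lieD_parity]
      abel
  exact funext fun m => key m α

theorem lieD_wedge (v : Derivation ℝ A A) (α β : Forms A) :
    lieD v (wedge α β) = wedge (lieD v α) β + wedge α (lieD v β) := by
  have key : ∀ (m : ℕ) (α β : Forms A),
      lieD v (wedge α β) m = wedge (lieD v α) β m + wedge α (lieD v β) m := by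
    intro m
    induction m with
    | zero =>
      intro α β
      ext u
      simp only [AlternatingMap.add_apply, wedge_zero_apply, lieD_apply]
      simp [mul_comm, add_comm]
    | succ m ih =>
      intro α β
      refine form_succ_ext (β := wedge (lieD v α) β + wedge α (lieD v β)) fun u => ?_
      simp only [contract_lieD, contract_wedge, map_add, Pi.sub_apply, Pi.add_apply, ih,
        ← lieD_parity]
      have h1 : ∀ x y z : Forms A, wedge (x - y) z = wedge x z - wedge y z := fun x y z => by
        rw [sub_eq_add_neg, wedge_add_left, wedge_neg_left, sub_eq_add_neg]
      have h2 : ∀ x y z : Forms A, wedge x (y - z) = wedge x y - wedge x z := fun x y z => by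
        rw [sub_eq_add_neg, wedge_add_right, wedge_neg_right, sub_eq_add_neg]
      simp only [h1, h2, Pi.sub_apply]
      abel
  exact funext fun m => key m α β

/-- The exterior derivative is an antiderivation of the exterior product. -/
theorem extD_wedge (α β : Forms A) :
    extD (wedge α β) = wedge (extD α) β + wedge (parity α) (extD β) := by
  have key : ∀ (m : ℕ) (α β : Forms A),
      extD (wedge α β) m = wedge (extD α) β m + wedge (parity α) (extD β) m := by
    intro m
    induction m with
    | zero =>
      intro α β
      ext u
      simp only [AlternatingMap.add_apply, wedge_zero_apply, extD_zero_apply]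
      simp
    | succ m ih =>
      intro α β
      refine form_succ_ext (β := wedge (extD α) β + wedge (parity α) (extD β)) fun u => ?_
      simp only [contract_extD, contract_wedge, map_add, Pi.sub_apply, Pi.add_apply, ih,
        lieD_wedge, contract_parity, parity_parity]
      have h1 : ∀ x y z : Forms A, wedge (x - y) z = wedge x z - wedge y z := fun x y z => by
        rw [sub_eq_add_neg, wedge_add_left, wedge_neg_left, sub_eq_add_neg]
      have h2 : ∀ x y z : Forms A, wedge x (y - z) = wedge x y - wedge x z := fun x y z => by
        rw [sub_eq_add_neg, wedge_add_right, wedge_neg_right, sub_eq_add_neg]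
      simp only [h1, h2, Pi.sub_apply, wedge_neg_left, Pi.neg_apply, extD_parity]
      abel
  exact funext fun m => key m α β

@[simp] theorem extD_oneForm : extD (oneForm : Forms A) = 0 := by
  have h : wedge (oneForm : Forms A) oneForm = oneForm := wedge_oneForm _
  have h2 := extD_wedge (oneForm : Forms A) oneForm
  have h3 : wedge (oneForm : Forms A) (extD oneForm) = extD oneForm := by
    rw [wedge_comm oneForm_mem (extD_mem oneForm_mem)]
    simp
  rw [h, wedge_oneForm, parity_oneForm, h3] at h2
  simpa using h2

end Calculus

/-! ### Sums over unshuffles -/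

section Unshuffle

variable {T M N : Type*} [AddCommGroup M] [AddCommGroup N] (deg : T → ℤ)

@[simp] theorem degSum_nil : degSum deg [] = 0 := rfl

@[simp] theorem degSum_cons (a : T) (t : List T) :
    degSum deg (a :: t) = deg a + degSum deg t := by simp [degSum]

@[simp] theorem degSum_append (s t : List T) :
    degSum deg (s ++ t) = degSum deg s + degSum deg t := by simp [degSum]

theorem degSum_perm {s t : List T} (h : s.Perm t) : degSum deg s = degSum deg t :=
  (h.map deg).sum_eq

theorem units_smul_congr {m m' : ℤ} (h : Even (m - m')) (x : M) :
    m.negOnePow • x = m'.negOnePow • x := by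
  rw [(Int.negOnePow_eq_iff m m').mpr h]

theorem unshuffle_nil (f : List T → List T → M) : unshuffle deg f [] = f [] [] := rfl

theorem unshuffle_cons (f : List T → List T → M) (a : T) (t : List T) :
    unshuffle deg f (a :: t) = unshuffle deg (fun S R => f (a :: S) R) t +
      unshuffle deg (fun S R => (deg a * degSum deg S).negOnePow • f S (a :: R)) t := rfl

/-- A relation compatible with sums and signs that holds between the terms of two sums over
unshuffles holds between the sums. -/
theorem unshuffle_rel (r : M → N → Prop)
    (hadd : ∀ a b a' b', r a b → r a' b' → r (a + a') (b + b'))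
    (hsmul : ∀ (u : ℤˣ) a b, r a b → r (u • a) (u • b))
    (f : List T → List T → M) (g : List T → List T → N) (xs : List T)
    (h : ∀ S R, S.Sublist xs → R.Sublist xs → (S ++ R).Perm xs → r (f S R) (g S R)) :
    r (unshuffle deg f xs) (unshuffle deg g xs) := by
  induction xs generalizing f g with
  | nil => exact h [] [] (List.Sublist.refl _) (List.Sublist.refl _) (List.Perm.refl _)
  | cons a t ih =>
    refine hadd _ _ _ _ (ih _ _ fun S R hS hR hp => ?_) (ih _ _ fun S R hS hR hp => ?_)
    · exact h _ _ (hS.cons_cons a) (hR.cons a) (hp.cons a)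
    · refine hsmul _ _ _ (h _ _ (hS.cons a) (hR.cons_cons a) ?_)
      exact List.perm_middle.trans (hp.cons a)

variable {deg}

theorem unshuffle_congr {f g : List T → List T → M} {xs : List T}
    (h : ∀ S R, S.Sublist xs → R.Sublist xs → (S ++ R).Perm xs → f S R = g S R) :
    unshuffle deg f xs = unshuffle deg g xs :=
  unshuffle_rel deg (fun a b => a = b) (by rintro a _ a' _ rfl rfl; rfl)
    (by rintro u a _ rfl; rfl) f g xs h

theorem map_unshuffle (φ : M →+ N) (f : List T → List T → M) (xs : List T) :
    φ (unshuffle deg f xs) = unshuffle deg (fun S R => φ (f S R)) xs :=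
  unshuffle_rel deg (fun a b => φ a = b) (by rintro a _ a' _ rfl rfl; exact map_add φ a a')
    (by
      rintro u a _ rfl
      rcases Int.units_eq_one_or u with rfl | rfl <;> simp) _ _ xs
    (fun _ _ _ _ _ => rfl)

theorem unshuffle_units_smul (u : ℤˣ) (f : List T → List T → M) (xs : List T) :
    unshuffle deg (fun S R => u • f S R) xs = u • unshuffle deg f xs :=
  (map_unshuffle (DistribSMul.toAddMonoidHom M u) f xs).symm

theorem unshuffle_zero (xs : List T) : unshuffle deg (fun _ _ => (0 : M)) xs = 0 :=
  unshuffle_rel deg (fun a (_ : M) => a = 0) (by rintro a _ a' _ rfl rfl; exact add_zero 0)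
    (by rintro u a _ rfl; exact smul_zero u) _ (fun _ _ => (0 : M)) xs (fun _ _ _ _ _ => rfl)

theorem unshuffle_eq_zero {f : List T → List T → M} {xs : List T}
    (h : ∀ S R, S.Sublist xs → R.Sublist xs → (S ++ R).Perm xs → f S R = 0) :
    unshuffle deg f xs = 0 :=
  (unshuffle_congr h).trans (unshuffle_zero xs)

theorem unshuffle_of_right_nil {f : List T → List T → M}
    (h : ∀ S R, R ≠ [] → f S R = 0) (xs : List T) : unshuffle deg f xs = f xs [] := by
  induction xs generalizing f with
  | nil => rfl
  | cons a t ih =>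
    rw [unshuffle_cons, ih fun S R hR => h _ _ hR,
      unshuffle_eq_zero fun S R _ _ _ => by rw [h _ _ (List.cons_ne_nil _ _), smul_zero], add_zero]

theorem unshuffle_of_left_nil {f : List T → List T → M}
    (h : ∀ S R, S ≠ [] → f S R = 0) (xs : List T) : unshuffle deg f xs = f [] xs := by
  induction xs generalizing f with
  | nil => rfl
  | cons a t ih =>
    rw [unshuffle_cons, unshuffle_eq_zero fun S R _ _ _ => h _ _ (List.cons_ne_nil _ _), zero_add,
      ih (f := fun S R => (deg a * degSum deg S).negOnePow • f S (a :: R)) fun S R hS => by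
        rw [h _ _ hS, smul_zero]]
    simp

variable (deg) in
/-- Graded symmetric functions of a list. -/
def GSym (F : List T → M) : Prop :=
  ∀ (s : List T) (a b : T) (t : List T),
    F (s ++ a :: b :: t) = (deg a * deg b).negOnePow • F (s ++ b :: a :: t)

theorem GSym.cons {F : List T → M} (hF : GSym deg F) (a : T) : GSym deg fun xs => F (a :: xs) :=
  fun s b c t => hF (a :: s) b c t

theorem GSym.sign {F : List T → M} (hF : GSym deg F) (c : ℤ → ℤˣ) :
    GSym deg fun xs => c (degSum deg xs) • F xs := fun s a b t => by
  have h : degSum deg (s ++ a :: b :: t) = degSum deg (s ++ b :: a :: t) := by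
    simp; ring
  simp only [hF s a b t, h]
  rw [smul_comm]

/-- The sum over unshuffles of terms that are graded symmetric in both parts is graded
symmetric. -/
theorem GSym.unshuffle {f : List T → List T → M} (h1 : ∀ R, GSym deg fun S => f S R)
    (h2 : ∀ S, GSym deg (f S)) : GSym deg (unshuffle deg f) := by
  intro s
  induction s generalizing f with
  | nil =>
    intro a b t
    simp only [List.nil_append, unshuffle_cons, degSum_cons, smul_add, ← unshuffle_units_smul]
    have e1 : LocalBRST.unshuffle deg (fun S R => f (a :: b :: S) R) t =
        LocalBRST.unshuffle deg (fun S R => (deg a * deg b).negOnePow • f (b :: a :: S) R) t :=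
      unshuffle_congr fun S R _ _ _ => h1 R [] a b S
    have e2 : LocalBRST.unshuffle deg (fun S R => (deg b * degSum deg S).negOnePow •
          (deg a * degSum deg S).negOnePow • f S (a :: b :: R)) t =
        LocalBRST.unshuffle deg (fun S R => (deg a * deg b).negOnePow •
          (deg a * degSum deg S).negOnePow • (deg b * degSum deg S).negOnePow •
            f S (b :: a :: R)) t := by
      refine unshuffle_congr fun S R _ _ _ => ?_
      rw [show f S (a :: b :: R) = _ from h2 S [] a b R]
      simp only [smul_smul, ← Int.negOnePow_add, List.nil_append]
      congr 2; ring
    have e3 : LocalBRST.unshuffle deg (fun S R => (deg b * degSum deg S).negOnePow •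
          f (a :: S) (b :: R)) t =
        LocalBRST.unshuffle deg (fun S R => (deg a * deg b).negOnePow •
          (deg b * (deg a + degSum deg S)).negOnePow • f (a :: S) (b :: R)) t := by
      refine unshuffle_congr fun S R _ _ _ => ?_
      simp only [smul_smul, ← Int.negOnePow_add]
      exact units_smul_congr ⟨-(deg a * deg b), by ring⟩ _
    have e4 : LocalBRST.unshuffle deg (fun S R => (deg a * (deg b + degSum deg S)).negOnePow •
          f (b :: S) (a :: R)) t =
        LocalBRST.unshuffle deg (fun S R => (deg a * deg b).negOnePow •
          (deg a * degSum deg S).negOnePow • f (b :: S) (a :: R)) t := by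
      refine unshuffle_congr fun S R _ _ _ => ?_
      simp only [smul_smul, ← Int.negOnePow_add, mul_add]
    rw [e1, e2, e3, e4]
    abel
  | cons x s ih =>
    intro a b t
    rw [List.cons_append, List.cons_append, unshuffle_cons, unshuffle_cons, smul_add]
    congr 1
    · exact ih (fun R => (h1 R).cons x) (fun S => h2 (x :: S)) a b t
    · refine ih (f := fun S R => (deg x * degSum deg S).negOnePow • f S (x :: R))
        (fun R => (h1 (x :: R)).sign fun m => (deg x * m).negOnePow) (fun S => ?_) a b t
      intro s a b t
      simp only [(h2 S).cons x s a b t]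
      rw [smul_comm]

/-- Coassociativity of the unshuffle coproduct. -/
theorem unshuffle_coassoc (f : List T → List T → List T → M) (xs : List T) :
    unshuffle deg (fun S R => unshuffle deg (fun S₁ S₂ => f S₁ S₂ R) S) xs =
      unshuffle deg (fun S₁ R' => unshuffle deg (fun S₂ R => f S₁ S₂ R) R') xs := by
  induction xs generalizing f with
  | nil => rfl
  | cons a t ih =>
    simp only [unshuffle_cons, unshuffle_add, smul_add, ← unshuffle_units_smul]
    rw [ih, add_assoc]
    congr 1
    rw [ih]
    congr 1
    rw [← ih]
    refine unshuffle_congr fun S R _ _ _ => unshuffle_congr fun S₁ S₂ _ _ hp => ?_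
    rw [← degSum_perm deg hp, degSum_append, smul_smul, ← Int.negOnePow_add, mul_add]

/-- Graded cocommutativity of the unshuffle coproduct. -/
theorem unshuffle_cocomm (f : List T → List T → M) (xs : List T) :
    unshuffle deg f xs =
      unshuffle deg (fun S R => (degSum deg S * degSum deg R).negOnePow • f R S) xs := by
  induction xs generalizing f with
  | nil => simp [unshuffle_nil]
  | cons a t ih =>
    rw [unshuffle_cons, unshuffle_cons, ih, add_comm,
      ih fun S R => (deg a * degSum deg S).negOnePow • f S (a :: R)]
    congr 1
    · refine unshuffle_congr fun S R _ _ _ => ?_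
      simp only [smul_smul, ← Int.negOnePow_add, degSum_cons]
      congr 2; ring
    · refine unshuffle_congr fun S R _ _ _ => ?_
      simp only [smul_smul, ← Int.negOnePow_add, degSum_cons]
      exact units_smul_congr ⟨-(deg a * degSum deg S), by ring⟩ _

/-- The function on splittings supported on those whose first part is a single element. -/
def single (f : T → List T → M) : List T → List T → M
  | [a], R => f a R
  | _, _ => 0

theorem unshuffle_single_cons (f : T → List T → M) (a : T) (t : List T) :
    unshuffle deg (single f) (a :: t) = f a t +
      unshuffle deg (single fun b R => (deg a * deg b).negOnePow • f b (a :: R)) t := by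
  rw [unshuffle_cons]
  congr 1
  · refine (unshuffle_of_left_nil (fun S R hS => ?_) t).trans rfl
    cases S with
    | nil => exact absurd rfl hS
    | cons b S => rfl
  · refine unshuffle_congr fun S R _ _ _ => ?_
    rcases S with _ | ⟨b, _ | ⟨c, S⟩⟩
    · exact smul_zero _
    · simp [single]
    · exact smul_zero _

/-- Moving each argument in turn to the front of a graded symmetric function. -/
theorem GSym.unshuffle_single {F : List T → M} (hF : GSym deg F) (s xs : List T) :
    LocalBRST.unshuffle deg (single fun a R => F (s ++ a :: R)) xs = xs.length • F (s ++ xs) := by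
  induction xs generalizing s with
  | nil => simp [unshuffle_nil, single]
  | cons a t ih =>
    rw [unshuffle_single_cons]
    have h : (fun b R => (deg a * deg b).negOnePow • F (s ++ b :: a :: R)) =
        fun b R => F ((s ++ [a]) ++ b :: R) := by
      funext b R
      simpa using (hF s a b R).symm
    rw [h, ih]
    simp [add_smul, add_comm]

/-- `LinRel c₁ c₂ x x₁ x₂ F` says that the function `F` of lists respects the relation
`x = c₁ x₁ + c₂ x₂` in every argument. -/
def LinRel [Module ℝ M] (c₁ c₂ : ℝ) (x x₁ x₂ : T) (F : List T → M) : Prop :=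
  ∀ s t : List T, F (s ++ x :: t) = c₁ • F (s ++ x₁ :: t) + c₂ • F (s ++ x₂ :: t)

theorem LinRel.cons [Module ℝ M] {c₁ c₂ : ℝ} {x x₁ x₂ : T} {F : List T → M}
    (hF : LinRel c₁ c₂ x x₁ x₂ F) (y : T) : LinRel c₁ c₂ x x₁ x₂ fun xs => F (y :: xs) :=
  fun s t => hF (y :: s) t

theorem LinRel.unshuffle [Module ℝ M] {c₁ c₂ : ℝ} {x x₁ x₂ : T} (hx₁ : deg x₁ = deg x)
    (hx₂ : deg x₂ = deg x) {f : List T → List T → M}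
    (h1 : ∀ R, LinRel c₁ c₂ x x₁ x₂ fun S => f S R) (h2 : ∀ S, LinRel c₁ c₂ x x₁ x₂ (f S)) :
    LinRel c₁ c₂ x x₁ x₂ (unshuffle deg f) := by
  intro s
  induction s generalizing f with
  | nil =>
    intro t
    simp only [List.nil_append, unshuffle_cons, smul_add, ← unshuffle_smul]
    have e1 : LocalBRST.unshuffle deg (fun S R => f (x :: S) R) t =
        LocalBRST.unshuffle deg (fun S R => c₁ • f (x₁ :: S) R + c₂ • f (x₂ :: S) R) t :=
      unshuffle_congr fun S R _ _ _ => h1 R [] S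
    have e2 : LocalBRST.unshuffle deg
          (fun S R => (deg x * degSum deg S).negOnePow • f S (x :: R)) t =
        LocalBRST.unshuffle deg
          (fun S R => c₁ • (deg x₁ * degSum deg S).negOnePow • f S (x₁ :: R) +
            c₂ • (deg x₂ * degSum deg S).negOnePow • f S (x₂ :: R)) t := by
      refine unshuffle_congr fun S R _ _ _ => ?_
      rw [show f S (x :: R) = _ from h2 S [] R, hx₁, hx₂, smul_add, smul_comm c₁, smul_comm c₂]
      rfl
    rw [e1, e2, unshuffle_add, unshuffle_add]
    abel
  | cons y s ih =>
    intro t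
    simp only [List.cons_append, unshuffle_cons, smul_add]
    rw [ih (f := fun S R => f (y :: S) R) (fun R => (h1 R).cons y) (fun S => h2 (y :: S)) t,
      ih (f := fun S R => (deg y * degSum deg S).negOnePow • f S (y :: R)) (fun R => ?_)
        (fun S => ?_) t]
    · abel
    · intro s t
      have e : ∀ z, degSum deg (s ++ z :: t) = degSum deg s + deg z + degSum deg t := by
        intro z; simp; ring
      simp only [e, hx₁, hx₂, h1 (y :: R) s t, smul_add]
      rw [smul_comm c₁, smul_comm c₂]
    · intro s t
      simp only [(h2 S).cons y s t, smul_add]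
      rw [smul_comm c₁, smul_comm c₂]

/-- The evolutionary operator of a formal vector field with Taylor coefficients `q`. -/
def evol (deg : T → ℤ) (q : List T → T) (F : List T → M) : List T → M :=
  unshuffle deg fun S R => F (q S :: R)

/-- The graded commutator of two odd evolutionary operators is the evolutionary operator of the
graded commutator of the vector fields. -/
theorem evol_anticomm {q q' : List T → T} (hq : ∀ S, deg (q S) = degSum deg S + 1)
    (hq' : ∀ S, deg (q' S) = degSum deg S + 1) {F : List T → M} (hF : GSym deg F) (xs : List T) :
    evol deg q' (evol deg q F) xs + evol deg q (evol deg q' F) xs =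
      unshuffle deg (fun S R => unshuffle deg
        (fun S₁ S₂ => F (q (q' S₁ :: S₂) :: R) + F (q' (q S₁ :: S₂) :: R)) S) xs := by
  have e : ∀ q q' : List T → T, (∀ S, deg (q' S) = degSum deg S + 1) →
      evol deg q' (evol deg q F) xs =
      unshuffle deg (fun S R => unshuffle deg (fun S₁ S₂ => F (q (q' S₁ :: S₂) :: R)) S) xs +
      unshuffle deg (fun S R => unshuffle deg (fun S₁ S₂ =>
        ((degSum deg S₁ + 1) * degSum deg S₂).negOnePow • F (q S₂ :: q' S₁ :: R)) S) xs := by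
    intro q q' hq'
    rw [unshuffle_coassoc (fun S₁ S₂ R => F (q (q' S₁ :: S₂) :: R)),
      unshuffle_coassoc (fun S₁ S₂ R =>
        ((degSum deg S₁ + 1) * degSum deg S₂).negOnePow • F (q S₂ :: q' S₁ :: R)), ← unshuffle_add]
    simp only [evol, unshuffle_cons, hq']
  rw [e q q' hq', e q' q hq]
  have h0 : unshuffle deg (fun S R => unshuffle deg (fun S₁ S₂ =>
        ((degSum deg S₁ + 1) * degSum deg S₂).negOnePow • F (q S₂ :: q' S₁ :: R)) S) xs +
      unshuffle deg (fun S R => unshuffle deg (fun S₁ S₂ =>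
        ((degSum deg S₁ + 1) * degSum deg S₂).negOnePow • F (q' S₂ :: q S₁ :: R)) S) xs = 0 := by
    rw [← unshuffle_add]
    refine unshuffle_eq_zero fun S R _ _ _ => ?_
    rw [unshuffle_cocomm (fun S₁ S₂ =>
        ((degSum deg S₁ + 1) * degSum deg S₂).negOnePow • F (q' S₂ :: q S₁ :: R)), ← unshuffle_add]
    refine unshuffle_eq_zero fun S₁ S₂ _ _ _ => ?_
    rw [show F (q' S₁ :: q S₂ :: R) = _ from hF [] (q' S₁) (q S₂) R, List.nil_append, hq, hq']
    simp only [smul_smul, ← Int.negOnePow_add]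
    rw [add_eq_zero_iff_eq_neg, ← Units.neg_smul, ← Int.negOnePow_succ]
    refine units_smul_congr ⟨-degSum deg S₁ * degSum deg S₂ - degSum deg S₁ - 1, ?_⟩ _
    ring
  simp only [unshuffle_add]
  rw [add_add_add_comm, h0, add_zero]

end Unshuffle

/-! ### Jets of forms and multilinear cochains -/

section FormsMore

variable {A : Type*} [CommRing A] [Algebra ℝ A]

@[simp] theorem oneForm_wedge (α : Forms A) : wedge oneForm α = α := by
  have key : ∀ (m : ℕ) (α : Forms A), wedge oneForm α m = α m := by
    intro m
    induction m with
    | zero => intro α; ext w; exact one_mul _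
    | succ m ih =>
      intro α
      apply form_succ_ext
      intro v
      simp only [contract_wedge, contract_oneForm, wedge_zero_left, zero_add, parity_oneForm, ih]
  exact funext fun m => key m α

theorem real_smul_forms (c : ℝ) (α : Forms A) : c • α = algebraMap ℝ A c • α := by
  funext p
  ext w
  exact Algebra.smul_def c _

/-- Left exterior multiplication as a real-linear map. -/
def wedgeLeft (α : Forms A) : Forms A →ₗ[ℝ] Forms A where
  toFun β := wedge α β
  map_add' := wedge_add_right α
  map_smul' c β := by
    rw [real_smul_forms, wedge_smul_right, ← real_smul_forms, RingHom.id_apply]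

theorem wedgeLeft_apply (α β : Forms A) : wedgeLeft α β = wedge α β := rfl

theorem extD_units_smul (u : ℤˣ) (α : Forms A) : extD (u • α) = u • extD α := by
  rcases Int.units_eq_one_or u with rfl | rfl <;> simp

variable (A) in
/-- The projection of inhomogeneous forms to their component of degree `j`. -/
def homogProj (j : ℤ) : Forms A →ₗ[A] Forms A where
  toFun α q := if (q : ℤ) = j then α q else 0
  map_add' α β := by
    funext q; by_cases h : (q : ℤ) = j <;> simp [h]
  map_smul' a α := by
    funext q; by_cases h : (q : ℤ) = j <;> simp [h]

theorem homogProj_apply (j : ℤ) (α : Forms A) (q : ℕ) :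
    homogProj A j α q = if (q : ℤ) = j then α q else 0 := rfl

theorem homogProj_mem (j : ℤ) (α : Forms A) : homogProj A j α ∈ homog A j := fun q hq => by
  rw [homogProj_apply, if_neg hq]

theorem homogProj_of_mem {j : ℤ} {α : Forms A} (hα : α ∈ homog A j) : homogProj A j α = α := by
  funext q
  rw [homogProj_apply]
  split_ifs with h
  · rfl
  · exact (hα q h).symm

/-- The real-linear projection of inhomogeneous forms to the space of forms of degree `j`. -/
def toHomog (j : ℤ) : Forms A →ₗ[ℝ] homog A j where
  toFun α := ⟨homogProj A j α, homogProj_mem j α⟩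
  map_add' α β := Subtype.ext (map_add _ α β)
  map_smul' c α := Subtype.ext (by
    funext q
    by_cases h : (q : ℤ) = j <;> simp [h, homogProj_apply])

@[simp] theorem toHomog_coe {j : ℤ} (u : homog A j) : toHomog j (u : Forms A) = u :=
  Subtype.ext (homogProj_of_mem u.2)

/-- The forms whose coefficients lie in the `m`-th power of an ideal. For the ideal of a point, these
are the forms with vanishing jet of order `m - 1` at this point. -/
def flat (I : Ideal A) (m : ℕ) : Submodule A (Forms A) where
  carrier := {α | ∀ (p : ℕ) (w : Fin p → Derivation ℝ A A), α p w ∈ I ^ m}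
  zero_mem' _ _ := Ideal.zero_mem _
  add_mem' ha hb p w := Ideal.add_mem _ (ha p w) (hb p w)
  smul_mem' c _ ha p w := Ideal.mul_mem_left _ c (ha p w)

theorem mem_flat {I : Ideal A} {m : ℕ} {α : Forms A} :
    α ∈ flat I m ↔ ∀ (p : ℕ) (w : Fin p → Derivation ℝ A A), α p w ∈ I ^ m := Iff.rfl

theorem flat_zero (I : Ideal A) (α : Forms A) : α ∈ flat I 0 := fun _ _ => by simp

theorem flat_mono {I : Ideal A} {m m' : ℕ} (h : m ≤ m') : flat I m' ≤ flat I m :=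
  fun _ hα p w => Ideal.pow_le_pow_right h (hα p w)

theorem mul_flat {I : Ideal A} {k m : ℕ} {f : A} (hf : f ∈ I ^ k) {α : Forms A}
    (hα : α ∈ flat I m) : f • α ∈ flat I (k + m) := fun p w => by
  rw [pow_add]
  exact Ideal.mul_mem_mul hf (hα p w)

theorem flat_units_smul {I : Ideal A} {m : ℕ} (u : ℤˣ) {α : Forms A} (hα : α ∈ flat I m) :
    u • α ∈ flat I m := by
  rcases Int.units_eq_one_or u with rfl | rfl
  · simpa using hα
  · simpa using neg_mem hα

theorem flat_parity {I : Ideal A} {m : ℕ} {α : Forms A} (hα : α ∈ flat I m) :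
    parity α ∈ flat I m := fun p w => Ideal.mul_mem_left _ _ (hα p w)

theorem flat_contract {I : Ideal A} {m : ℕ} (v : Derivation ℝ A A) {α : Forms A}
    (hα : α ∈ flat I m) : contract v α ∈ flat I m := fun p _ => hα (p + 1) _

theorem flat_homogProj {I : Ideal A} {m : ℕ} (j : ℤ) {α : Forms A} (hα : α ∈ flat I m) :
    homogProj A j α ∈ flat I m := fun p w => by
  rw [homogProj_apply]
  split_ifs
  · exact hα p w
  · exact Ideal.zero_mem _

theorem derivation_pow_mem {I : Ideal A} (m : ℕ) (v : Derivation ℝ A A) {f : A}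
    (hf : f ∈ I ^ (m + 1)) : v f ∈ I ^ m := by
  induction m generalizing f with
  | zero => simp
  | succ m ih =>
    rw [pow_succ'] at hf
    refine Submodule.mul_induction_on hf (fun a ha b hb => ?_) (fun a b ha hb => ?_)
    · rw [Derivation.leibniz, smul_eq_mul, smul_eq_mul]
      refine Ideal.add_mem _ ?_ (Ideal.mul_mem_right _ _ hb)
      rw [pow_succ']
      exact Ideal.mul_mem_mul ha (ih hb)
    · rw [map_add]
      exact Ideal.add_mem _ ha hb

theorem flat_lieD {I : Ideal A} {m : ℕ} (v : Derivation ℝ A A) {α : Forms A}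
    (hα : α ∈ flat I (m + 1)) : lieD v α ∈ flat I m := fun p w => by
  rw [lieD_apply]
  refine Ideal.sub_mem _ (derivation_pow_mem m v (hα p w)) (Ideal.sum_mem _ fun i _ => ?_)
  exact Ideal.pow_le_pow_right (Nat.le_succ m) (hα p _)

theorem flat_extD {I : Ideal A} {m : ℕ} {α : Forms A} (hα : α ∈ flat I (m + 1)) :
    extD α ∈ flat I m := by
  have key : ∀ (p : ℕ) (α : Forms A), α ∈ flat I (m + 1) →
      ∀ w : Fin p → Derivation ℝ A A, extD α p w ∈ I ^ m := by
    intro p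
    induction p with
    | zero => intro α _ w; exact Ideal.zero_mem _
    | succ p ih =>
      intro α hα w
      have h : extD α (p + 1) w = contract (w 0) (extD α) p (Fin.tail w) := by
        rw [contract_apply, Fin.cons_self_tail]
      rw [h, contract_extD]
      exact Ideal.sub_mem _ (flat_lieD _ hα p _) (ih _ (flat_contract _ hα) _)
  exact fun p w => key p α hα w

theorem flat_wedge_left {I : Ideal A} {m : ℕ} {α : Forms A} (hα : α ∈ flat I m) (β : Forms A) :
    wedge α β ∈ flat I m := by
  have key : ∀ (p : ℕ) (α β : Forms A), α ∈ flat I m →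
      ∀ w : Fin p → Derivation ℝ A A, wedge α β p w ∈ I ^ m := by
    intro p
    induction p with
    | zero => intro α β hα w; exact Ideal.mul_mem_right _ _ (hα 0 w)
    | succ p ih =>
      intro α β hα w
      exact Ideal.add_mem _ (ih _ _ (flat_contract _ hα) _) (ih _ _ (flat_parity hα) _)
  exact fun p w => key p α β hα w

theorem flat_wedge_right {I : Ideal A} {m : ℕ} (α : Forms A) {β : Forms A} (hβ : β ∈ flat I m) :
    wedge α β ∈ flat I m := by
  have key : ∀ (p : ℕ) (α β : Forms A), β ∈ flat I m →
      ∀ w : Fin p → Derivation ℝ A A, wedge α β p w ∈ I ^ m := by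
    intro p
    induction p with
    | zero => intro α β hβ w; exact Ideal.mul_mem_left _ _ (hβ 0 w)
    | succ p ih =>
      intro α β hβ w
      exact Ideal.add_mem _ (ih _ _ hβ _) (ih _ _ (flat_contract _ hβ) _)
  exact fun p w => key p α β hβ w

end FormsMore

section Brst

variable {A : Type*} [CommRing A] [Algebra ℝ A]
variable {L : Type*} [AddCommGroup L] [Module ℝ L] {𝓛 : ℤ → Submodule ℝ L}
variable {M : Type*} [AddCommGroup M] [Module ℝ M]

/-- Functions of one decomposable section that are linear in the form and in the vector. -/
def SecLinear (Φ : Sec A 𝓛 → M) : Prop :=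
  ∀ (j i : ℤ),
    (∀ (u u' : homog A j) (y : 𝓛 i), Φ ⟨j, i, u + u', y⟩ = Φ ⟨j, i, u, y⟩ + Φ ⟨j, i, u', y⟩) ∧
    (∀ (u : homog A j) (y y' : 𝓛 i), Φ ⟨j, i, u, y + y'⟩ = Φ ⟨j, i, u, y⟩ + Φ ⟨j, i, u, y'⟩) ∧
    (∀ (c : ℝ) (u : homog A j) (y : 𝓛 i), Φ ⟨j, i, c • u, y⟩ = c • Φ ⟨j, i, u, y⟩) ∧
    (∀ (c : ℝ) (u : homog A j) (y : 𝓛 i), Φ ⟨j, i, u, c • y⟩ = c • Φ ⟨j, i, u, y⟩)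

theorem IsMultilinear.secLinear_cons {F : Cochain A 𝓛} (hF : IsMultilinear F)
    (t : List (Sec A 𝓛)) : SecLinear fun a => F (a :: t) := fun j i => hF [] t j i

/-- A function of decomposable sections of fixed bidegree is the restriction of a bilinear map on
all forms and vectors. -/
theorem SecLinear.exists_bilin {Φ : Sec A 𝓛 → M} (hΦ : SecLinear Φ) (j i : ℤ) :
    ∃ B : Forms A →ₗ[ℝ] L →ₗ[ℝ] M, ∀ (u : homog A j) (y : 𝓛 i),
      Φ ⟨j, i, u, y⟩ = B (u : Forms A) (y : L) := by
  obtain ⟨π, hπ⟩ := LinearMap.exists_leftInverse_of_injective (𝓛 i).subtype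
    (LinearMap.ker_eq_bot.mpr (𝓛 i).injective_subtype)
  obtain ⟨h1, h2, h3, h4⟩ := hΦ j i
  let B₀ : homog A j →ₗ[ℝ] 𝓛 i →ₗ[ℝ] M := LinearMap.mk₂ ℝ (fun u y => Φ ⟨j, i, u, y⟩) h1 h3 h2 h4
  refine ⟨B₀.compl₁₂ (toHomog j) π, fun u y => ?_⟩
  have h : π (y : L) = y := LinearMap.congr_fun hπ y
  simp [B₀, h]

theorem SecLinear.vec_zero {Φ : Sec A 𝓛 → M} (hΦ : SecLinear Φ) {a : Sec A 𝓛} (h : (a.vec : L) = 0) :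
    Φ a = 0 := by
  obtain ⟨B, hB⟩ := hΦ.exists_bilin a.formDeg a.tgtDeg
  have := hB a.form a.vec
  rw [h, map_zero] at this
  exact this

theorem SecLinear.form_zero {Φ : Sec A 𝓛 → M} (hΦ : SecLinear Φ) {a : Sec A 𝓛}
    (h : (a.form : Forms A) = 0) : Φ a = 0 := by
  obtain ⟨B, hB⟩ := hΦ.exists_bilin a.formDeg a.tgtDeg
  have := hB a.form a.vec
  rw [h, map_zero] at this
  exact this

theorem isMultilinear_iff_linRel {F : Cochain A 𝓛} : IsMultilinear F ↔ ∀ (j i : ℤ) (c₁ c₂ : ℝ),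
    (∀ (u u' : homog A j) (y : 𝓛 i),
      LinRel c₁ c₂ (M := Forms A) ⟨j, i, c₁ • u + c₂ • u', y⟩ ⟨j, i, u, y⟩ ⟨j, i, u', y⟩ F) ∧
    (∀ (u : homog A j) (y y' : 𝓛 i),
      LinRel c₁ c₂ (M := Forms A) ⟨j, i, u, c₁ • y + c₂ • y'⟩ ⟨j, i, u, y⟩ ⟨j, i, u, y'⟩ F) := by
  constructor
  · intro hF j i c₁ c₂
    refine ⟨fun u u' y s t => ?_, fun u y y' s t => ?_⟩
    · obtain ⟨h1, h2, h3, h4⟩ := hF s t j i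
      rw [h1, h3, h3]
    · obtain ⟨h1, h2, h3, h4⟩ := hF s t j i
      rw [h2, h4, h4]
  · intro h s t j i
    refine ⟨fun u u' y => ?_, fun u y y' => ?_, fun c u y => ?_, fun c u y => ?_⟩
    · simpa using (h j i 1 1).1 u u' y s t
    · simpa using (h j i 1 1).2 u y y' s t
    · simpa using (h j i c 0).1 u 0 y s t
    · simpa using (h j i c 0).2 u y 0 s t

theorem GSym.of_isGradedSymmetric {F : Cochain A 𝓛} (hF : IsGradedSymmetric F) :
    GSym (M := Forms A) Sec.deg F := hF

/-! ### Koszul signs -/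

/-- The form `± ω₁ ∧ ⋯ ∧ ωₖ` with the Koszul sign that separates forms and vectors. -/
def sepForm (S : List (Sec A 𝓛)) : Forms A := sepSign S • wedgeAll S

theorem sepForm_cons (a : Sec A 𝓛) (S : List (Sec A 𝓛)) :
    sepForm (a :: S) = (a.tgtDeg * degSum Sec.formDeg S).negOnePow •
      wedge (a.form : Forms A) (sepForm S) := by
  rw [sepForm, sepForm, sepSign, wedgeAll, wedge_units_smul_right, smul_smul]

theorem sepForm_mem (S : List (Sec A 𝓛)) : sepForm S ∈ homog A (degSum Sec.formDeg S) := by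
  rw [sepForm]
  rcases Int.units_eq_one_or (sepSign S) with h | h
  · simpa [h] using wedgeAll_mem S
  · simpa [h] using (homog A _).neg_mem (wedgeAll_mem S)

theorem sepForm_append (S R : List (Sec A 𝓛)) :
    sepForm (S ++ R) = (degSum Sec.tgtDeg S * degSum Sec.formDeg R).negOnePow •
      wedge (sepForm S) (sepForm R) := by
  induction S with
  | nil => simp [sepForm, sepSign, wedgeAll]
  | cons a S ih =>
    rw [List.cons_append, sepForm_cons, sepForm_cons, ih, wedge_units_smul_left,
      wedge_units_smul_right, wedge_assoc]
    simp only [smul_smul, ← Int.negOnePow_add, degSum_cons, degSum_append]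
    congr 2; ring

theorem Sec.deg_sum (S : List (Sec A 𝓛)) :
    degSum Sec.deg S = degSum Sec.formDeg S + degSum Sec.tgtDeg S := by
  induction S with
  | nil => simp
  | cons a S ih => simp [ih, Sec.deg]; ring

theorem degSum_vecs (S : List (Sec A 𝓛)) :
    degSum Sigma.fst (vecs S) = degSum Sec.tgtDeg S := by
  simp [degSum, vecs, Function.comp_def]

theorem sepForm_middle (S R : List (Sec A 𝓛)) (a : Sec A 𝓛) :
    sepForm (S ++ a :: R) =
      (a.deg * degSum Sec.deg S + a.tgtDeg * degSum Sec.tgtDeg S).negOnePow •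
        sepForm (a :: (S ++ R)) := by
  rw [sepForm_append, sepForm_cons, sepForm_cons, sepForm_append, wedge_units_smul_right,
    wedge_units_smul_right, ← wedge_assoc, ← wedge_assoc, wedge_comm (sepForm_mem S) a.form.2,
    wedge_units_smul_left]
  simp only [smul_smul, ← Int.negOnePow_add, degSum_cons, degSum_append, Sec.deg_sum, Sec.deg]
  refine units_smul_congr ⟨-a.tgtDeg * degSum Sec.tgtDeg S - a.tgtDeg * degSum Sec.formDeg S, ?_⟩ _
  ring

/-- Separating forms and vectors intertwines the two unshuffle coproducts. -/
theorem unshuffle_sepForm {N : Type*} [AddCommGroup N] [Module ℝ N] (B : Forms A →ₗ[ℝ] L →ₗ[ℝ] N)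
    (g : List (Σ i, 𝓛 i) → List (Σ i, 𝓛 i) → L) (S : List (Sec A 𝓛)) :
    unshuffle Sec.deg (fun S₁ S₂ => B (sepForm (S₁ ++ S₂)) (g (vecs S₁) (vecs S₂))) S =
      B (sepForm S) (unshuffle Sigma.fst g (vecs S)) := by
  have hu : ∀ (u : ℤˣ) (B : Forms A →ₗ[ℝ] L →ₗ[ℝ] N) (α : Forms A) (y : L),
      B (u • α) y = u • B α y := by
    intro u B α y
    rcases Int.units_eq_one_or u with rfl | rfl <;> simp
  have hu' : ∀ (u : ℤˣ) (B : Forms A →ₗ[ℝ] L →ₗ[ℝ] N) (α : Forms A) (y : L),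
      B α (u • y) = u • B α y := by
    intro u B α y
    rcases Int.units_eq_one_or u with rfl | rfl <;> simp
  induction S generalizing B g with
  | nil => rfl
  | cons a t ih =>
    have hv : vecs (a :: t) = ⟨a.tgtDeg, a.vec⟩ :: vecs t := rfl
    rw [hv, unshuffle_cons, unshuffle_cons, map_add]
    have e1 := ih (B ∘ₗ wedgeLeft (a.form : Forms A)) (fun S R => g (⟨a.tgtDeg, a.vec⟩ :: S) R)
    have e2 := ih (B ∘ₗ wedgeLeft (a.form : Forms A)) (fun S R => (a.tgtDeg * degSum Sigma.fst S).negOnePow •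
      g S (⟨a.tgtDeg, a.vec⟩ :: R))
    simp only [LinearMap.comp_apply, wedgeLeft_apply] at e1 e2
    rw [sepForm_cons, hu, hu, ← e1, ← e2, ← unshuffle_units_smul, ← unshuffle_units_smul]
    congr 1
    · refine unshuffle_congr fun S R _ _ hp => ?_
      rw [List.cons_append, sepForm_cons, hu, degSum_perm _ hp]
      rfl
    · refine unshuffle_congr fun S R _ _ hp => ?_
      rw [sepForm_middle, sepForm_cons, degSum_perm _ hp]
      simp only [hu, hu', smul_smul, ← Int.negOnePow_add, degSum_vecs]
      exact units_smul_congr ⟨a.deg * degSum Sec.deg S, by ring⟩ _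

end Brst

/-! ### The homological vector field -/

section BrstSquare

variable {A : Type*} [CommRing A] [Algebra ℝ A]
variable {L : Type*} [AddCommGroup L] [Module ℝ L] {𝓛 : ℤ → Submodule ℝ L}
variable {M : Type*} [AddCommGroup M] [Module ℝ M]

/-- The Taylor coefficients of the linear vector field `Q_DR`: the twisted de Rham operator on
single sections, and a zero section of the appropriate degree on all other lists. -/
def deRhamField : List (Sec A 𝓛) → Sec A 𝓛
  | [a] => deRhamSec a
  | S => ⟨degSum Sec.deg S + 1, 0, 0, 0⟩

theorem deRhamField_deg (S : List (Sec A 𝓛)) :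
    (deRhamField S).deg = degSum Sec.deg S + 1 := by
  rcases S with _ | ⟨a, _ | ⟨b, S⟩⟩
  · simp [deRhamField, Sec.deg]
  · simp [deRhamField, Sec.deg, deRhamSec]; ring
  · simp [deRhamField, Sec.deg]

theorem bracketSec_deg (Q : LInfinity 𝓛) (S : List (Sec A 𝓛)) :
    (bracketSec Q S).deg = degSum Sec.deg S + 1 := by
  rw [Sec.deg_sum, ← degSum_vecs]
  exact (add_assoc _ _ _).symm

theorem bracketSec_form (Q : LInfinity 𝓛) (S : List (Sec A 𝓛)) :
    ((bracketSec Q S).form : Forms A) = (degSum Sec.formDeg S).negOnePow • sepForm S := by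
  rw [sepForm, smul_smul]
  have h : ∀ (u : ℤˣ) (x : homog A (degSum Sec.formDeg S)),
      ((u • x : homog A _) : Forms A) = u • (x : Forms A) := by
    intro u x
    rcases Int.units_eq_one_or u with rfl | rfl <;> simp
  exact h _ _

theorem evalBracket_nil (Q : LInfinity 𝓛) : evalBracket (𝓛 := 𝓛) Q.bracket [] = 0 := by
  change Q.bracket 0 _ = 0
  rw [Q.bracket_zero]
  rfl

theorem evalBracket_cons (l : ∀ k : ℕ, MultilinearMap ℝ (fun _ : Fin k => L) L)
    (x : Σ i, 𝓛 i) (t : List (Σ i, 𝓛 i)) :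
    evalBracket l (x :: t) = evalBracket (fun k => (l (k + 1)).curryLeft (x.2 : L)) t := by
  change l (t.length + 1) _ = l (t.length + 1) (Fin.cons _ _)
  congr 1
  funext k
  refine Fin.cases rfl (fun k => rfl) k

/-- A bracket is linear in each entry of its list of arguments. -/
theorem evalBracket_middle (l : ∀ k : ℕ, MultilinearMap ℝ (fun _ : Fin k => L) L)
    (s t : List (Σ i, 𝓛 i)) (i : ℤ) :
    ∃ E : 𝓛 i →ₗ[ℝ] L, ∀ y, evalBracket l (s ++ ⟨i, y⟩ :: t) = E y := by
  induction s generalizing l with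
  | nil =>
    let w : Fin t.length → L := fun k => ((t.get k).2 : L)
    exact ⟨{  toFun := fun y => (l (t.length + 1)).curryLeft (y : L) w
              map_add' := fun y y' => by simp
              map_smul' := fun c y => by simp }, fun y => evalBracket_cons l ⟨i, y⟩ t⟩
  | cons x s ih =>
    obtain ⟨E, hE⟩ := ih fun k => (l (k + 1)).curryLeft (x.2 : L)
    exact ⟨E, fun y => by rw [List.cons_append, evalBracket_cons, hE]⟩

/-- The bracket of sections, evaluated by a bilinear map. -/
theorem apply_bracketSec {Φ : Sec A 𝓛 → M} (Q : LInfinity 𝓛) {j i : ℤ}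
    {B : Forms A →ₗ[ℝ] L →ₗ[ℝ] M}
    (hB : ∀ (u : homog A j) (y : 𝓛 i), Φ ⟨j, i, u, y⟩ = B (u : Forms A) (y : L))
    {S : List (Sec A 𝓛)} (hj : degSum Sec.formDeg S = j) (hi : degSum Sec.tgtDeg S + 1 = i) :
    Φ (bracketSec Q S) = j.negOnePow • B (sepForm S) (evalBracket Q.bracket (vecs S)) := by
  rw [← degSum_vecs] at hi
  subst hj hi
  refine (hB _ _).trans ?_
  change B ((bracketSec Q S).form : Forms A) _ = _
  rw [bracketSec_form]
  rcases Int.units_eq_one_or (degSum Sec.formDeg S).negOnePow with h | h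
  · simp [h]
  · simp [h]

/-- The identity `hB` for a section whose bidegree is `(j, i)` only propositionally. -/
theorem apply_of_deg {Φ : Sec A 𝓛 → M} {j i : ℤ} {B : Forms A →ₗ[ℝ] L →ₗ[ℝ] M}
    (hB : ∀ (u : homog A j) (y : 𝓛 i), Φ ⟨j, i, u, y⟩ = B (u : Forms A) (y : L))
    {a : Sec A 𝓛} (hj : a.formDeg = j) (hi : a.tgtDeg = i) :
    Φ a = B (a.form : Forms A) (a.vec : L) := by
  subst hj hi
  exact hB _ _

theorem bilin_units_smul (u : ℤˣ) (B : Forms A →ₗ[ℝ] L →ₗ[ℝ] M) (α : Forms A) (y : L) :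
    B (u • α) y = u • B α y := by
  rcases Int.units_eq_one_or u with rfl | rfl <;> simp

theorem bilin_units_smul_right (u : ℤˣ) (B : Forms A →ₗ[ℝ] L →ₗ[ℝ] M) (α : Forms A) (y : L) :
    B α (u • y) = u • B α y := by
  rcases Int.units_eq_one_or u with rfl | rfl <;> simp

theorem vecs_append (S R : List (Sec A 𝓛)) : vecs (S ++ R) = vecs S ++ vecs R :=
  List.map_append

/-- The bracket of sections is graded symmetric. -/
theorem gsym_bracketSec {Φ : Sec A 𝓛 → M} (hΦ : SecLinear Φ) (Q : LInfinity 𝓛) :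
    GSym Sec.deg fun S => Φ (bracketSec Q S) := by
  intro s a b t
  obtain ⟨B, hB⟩ := hΦ.exists_bilin (degSum Sec.formDeg (s ++ a :: b :: t))
    (degSum Sec.tgtDeg (s ++ a :: b :: t) + 1)
  have hp : (s ++ b :: a :: t).Perm (s ++ a :: b :: t) := (List.Perm.swap a b t).append_left s
  dsimp only
  rw [apply_bracketSec Q hB rfl rfl, apply_bracketSec Q hB (degSum_perm _ hp)
    (by rw [degSum_perm _ hp])]
  have e1 : sepForm (s ++ a :: b :: t) = (a.deg * b.deg + a.tgtDeg * b.tgtDeg).negOnePow •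
      sepForm (s ++ b :: a :: t) := by
    have h1 := sepForm_middle (s ++ [a]) t b
    have h2 := sepForm_middle s (a :: t) b
    simp only [List.append_assoc, List.singleton_append] at h1
    rw [h1, h2, smul_smul, ← Int.negOnePow_add]
    refine units_smul_congr ⟨0, ?_⟩ _
    simp
    ring
  have e2 : evalBracket Q.bracket (vecs (s ++ a :: b :: t)) =
      (a.tgtDeg * b.tgtDeg).negOnePow • evalBracket Q.bracket (vecs (s ++ b :: a :: t)) := by
    rw [vecs_append, vecs_append]
    exact Q.symm (vecs s) ⟨a.tgtDeg, a.vec⟩ ⟨b.tgtDeg, b.vec⟩ (vecs t)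
  rw [e1, e2, bilin_units_smul, bilin_units_smul_right]
  simp only [smul_smul, ← Int.negOnePow_add]
  exact units_smul_congr ⟨a.tgtDeg * b.tgtDeg, by ring⟩ _

theorem gsym_deRhamField {Φ : Sec A 𝓛 → M} (hΦ : SecLinear Φ) :
    GSym Sec.deg fun S => Φ (deRhamField S) := by
  intro s a b t
  have h : ∀ x y : Sec A 𝓛, Φ (deRhamField (s ++ x :: y :: t)) = 0 := by
    intro x y
    refine hΦ.vec_zero ?_
    rcases s with _ | ⟨c, _ | ⟨d, s⟩⟩ <;> rfl
  dsimp only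
  rw [h, h, smul_zero]

/-- The bracket of sections is multilinear. -/
theorem bracketSec_linRel {F : Sec A 𝓛 → Forms A} (hF : SecLinear F) (Q : LInfinity 𝓛) :
    IsMultilinear (fun S => F (bracketSec Q S) : Cochain A 𝓛) := by
  refine isMultilinear_iff_linRel.mpr fun j i c₁ c₂ => ?_
  have hsF : ∀ (s t : List (Sec A 𝓛)) (x : Sec A 𝓛), sepForm (s ++ x :: t) =
      (x.deg * degSum Sec.deg s + x.tgtDeg * degSum Sec.tgtDeg s).negOnePow •
        (x.tgtDeg * degSum Sec.formDeg (s ++ t)).negOnePow •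
          wedge (x.form : Forms A) (sepForm (s ++ t)) := by
    intro s t x
    rw [sepForm_middle, sepForm_cons]
  have hu : ∀ (u : ℤˣ) (c : ℝ) (y : Forms A), u • c • y = c • u • y := fun u c y =>
    smul_comm u c y
  constructor
  · intro u u' y s t
    have hd : ∀ u'' : homog A j, degSum Sec.formDeg (s ++ (⟨j, i, u'', y⟩ : Sec A 𝓛) :: t) =
        degSum Sec.formDeg s + (j + degSum Sec.formDeg t) ∧
        degSum Sec.tgtDeg (s ++ (⟨j, i, u'', y⟩ : Sec A 𝓛) :: t) + 1 =
        degSum Sec.tgtDeg s + (i + degSum Sec.tgtDeg t) + 1 := fun u'' => by simp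
    obtain ⟨B, hB⟩ := hF.exists_bilin (degSum Sec.formDeg s + (j + degSum Sec.formDeg t))
      (degSum Sec.tgtDeg s + (i + degSum Sec.tgtDeg t) + 1)
    dsimp only
    rw [apply_bracketSec Q hB (hd _).1 (hd _).2, apply_bracketSec Q hB (hd _).1 (hd _).2,
      apply_bracketSec Q hB (hd _).1 (hd _).2]
    have hv : ∀ u'' : homog A j, vecs (s ++ (⟨j, i, u'', y⟩ : Sec A 𝓛) :: t) =
        vecs s ++ ⟨i, y⟩ :: vecs t := fun u'' => by simp [vecs]
    have hw : ∀ β : Forms A, wedge (c₁ • (u : Forms A) + c₂ • (u' : Forms A)) β =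
        c₁ • wedge (u : Forms A) β + c₂ • wedge (u' : Forms A) β := by
      intro β
      simp only [real_smul_forms, wedge_add_left, wedge_smul_left]
    simp only [hv, hsF, bilin_units_smul]
    simp only [Sec.deg, Submodule.coe_add, Submodule.coe_smul, hw, map_add, map_smul,
      LinearMap.add_apply, LinearMap.smul_apply, smul_add, hu]
  · intro u y y' s t
    have hd : ∀ y'' : 𝓛 i, degSum Sec.formDeg (s ++ (⟨j, i, u, y''⟩ : Sec A 𝓛) :: t) =
        degSum Sec.formDeg s + (j + degSum Sec.formDeg t) ∧
        degSum Sec.tgtDeg (s ++ (⟨j, i, u, y''⟩ : Sec A 𝓛) :: t) + 1 =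
        degSum Sec.tgtDeg s + (i + degSum Sec.tgtDeg t) + 1 := fun u'' => by simp
    obtain ⟨B, hB⟩ := hF.exists_bilin (degSum Sec.formDeg s + (j + degSum Sec.formDeg t))
      (degSum Sec.tgtDeg s + (i + degSum Sec.tgtDeg t) + 1)
    dsimp only
    rw [apply_bracketSec Q hB (hd _).1 (hd _).2, apply_bracketSec Q hB (hd _).1 (hd _).2,
      apply_bracketSec Q hB (hd _).1 (hd _).2]
    obtain ⟨E, hE⟩ := evalBracket_middle Q.bracket (vecs s) (vecs t) i
    have hv : ∀ y'' : 𝓛 i, vecs (s ++ (⟨j, i, u, y''⟩ : Sec A 𝓛) :: t) =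
        vecs s ++ ⟨i, y''⟩ :: vecs t := fun u'' => by simp [vecs]
    simp only [hv, hE, hsF, bilin_units_smul]
    simp only [Sec.deg, map_add, map_smul, smul_add, hu]

theorem deRhamField_linRel {F : Sec A 𝓛 → Forms A} (hF : SecLinear F) :
    IsMultilinear (fun S => F (deRhamField S) : Cochain A 𝓛) := by
  have h0 : ∀ (s t : List (Sec A 𝓛)), ¬ (s = [] ∧ t = []) → ∀ x : Sec A 𝓛,
      F (deRhamField (s ++ x :: t)) = 0 := by
    intro s t h x
    refine hF.vec_zero ?_
    rcases s with _ | ⟨c, _ | ⟨d, s⟩⟩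
    · rcases t with _ | ⟨d, t⟩
      · exact absurd ⟨rfl, rfl⟩ h
      · rfl
    · rfl
    · rfl
  intro s t j i
  by_cases h : s = [] ∧ t = []
  · obtain ⟨rfl, rfl⟩ := h
    obtain ⟨B, hB⟩ := hF.exists_bilin (j + 1) i
    have h1 : ∀ (u : homog A j) (y : 𝓛 i),
        F (deRhamField [(⟨j, i, u, y⟩ : Sec A 𝓛)]) = B (extD (u : Forms A)) (y : L) :=
      fun u y => hB _ _
    simp only [List.nil_append, h1]
    refine ⟨fun u u' y => ?_, fun u y y' => ?_, fun c u y => ?_, fun c u y => ?_⟩ <;> simp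
  · simp only [h0 s t h]
    simp

/-- The evolutionary vector field `Q_L` squares to zero. -/
theorem unshuffle_bracketSec_bracketSec {Φ : Sec A 𝓛 → M} (hΦ : SecLinear Φ) (Q : LInfinity 𝓛)
    (S : List (Sec A 𝓛)) :
    unshuffle Sec.deg (fun S₁ S₂ => Φ (bracketSec Q (bracketSec Q S₁ :: S₂))) S = 0 := by
  obtain ⟨B, hB⟩ := hΦ.exists_bilin (degSum Sec.formDeg S) (degSum Sec.tgtDeg S + 1 + 1)
  have h : unshuffle Sec.deg (fun S₁ S₂ => Φ (bracketSec Q (bracketSec Q S₁ :: S₂))) S =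
      unshuffle Sec.deg (fun S₁ S₂ => B (sepForm (S₁ ++ S₂)) (evalBracket Q.bracket
        (⟨_, ⟨evalBracket Q.bracket (vecs S₁), Q.degree (vecs S₁)⟩⟩ :: vecs S₂))) S := by
    refine unshuffle_congr fun S₁ S₂ _ _ hp => ?_
    have hj := degSum_perm Sec.formDeg hp
    have hi := degSum_perm Sec.tgtDeg hp
    rw [degSum_append] at hj hi
    have hb : degSum Sec.tgtDeg [bracketSec Q S₁] = degSum Sec.tgtDeg S₁ + 1 := by
      rw [← degSum_vecs S₁]; simp [bracketSec]
    rw [apply_bracketSec Q hB (by rw [← hj]; simp [bracketSec])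
      (by rw [← hi, degSum_cons]; simp only [degSum_cons, degSum_nil] at hb; rw [add_zero] at hb; rw [hb]; ring)]
    rw [sepForm_cons, bracketSec_form, wedge_units_smul_left, sepForm_append]
    have ht : (bracketSec Q S₁).tgtDeg = degSum Sec.tgtDeg S₁ + 1 := by
      rw [← degSum_vecs S₁]; rfl
    simp only [bilin_units_smul, smul_smul, ← Int.negOnePow_add, ht]
    change _ = (_ : ℤˣ) • B _ (evalBracket Q.bracket (vecs (bracketSec Q S₁ :: S₂)))
    refine units_smul_congr ⟨degSum Sec.formDeg S₁ + degSum Sec.formDeg S₂, ?_⟩ _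
    rw [← hj]
    ring
  rw [h, unshuffle_sepForm B (fun V₁ V₂ => evalBracket Q.bracket
    (⟨_, ⟨evalBracket Q.bracket V₁, Q.degree V₁⟩⟩ :: V₂)), Q.square_zero, map_zero]

/-- `Q_DR` is a derivation of the brackets: the sum of the terms in which `d` is applied to one
argument is `d` applied to the exterior product. -/
theorem unshuffle_deRham_bracket {G : List (Sec A 𝓛) → M} (hG : GSym Sec.deg G) (Q : LInfinity 𝓛)
    (B : Forms A →ₗ[ℝ] L →ₗ[ℝ] M) (s S : List (Sec A 𝓛))
    (h : ∀ S', degSum Sec.formDeg S' = degSum Sec.formDeg s + degSum Sec.formDeg S + 1 →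
      degSum Sec.tgtDeg S' = degSum Sec.tgtDeg s + degSum Sec.tgtDeg S →
      G S' = B (sepForm S') (evalBracket Q.bracket (vecs S'))) :
    unshuffle Sec.deg (single fun a R => G (s ++ deRhamSec a :: R)) S =
      (degSum Sec.tgtDeg s * (degSum Sec.formDeg S + 1)).negOnePow •
        B (wedge (sepForm s) (extD (sepForm S))) (evalBracket Q.bracket (vecs (s ++ S))) := by
  induction S generalizing s with
  | nil =>
    have : extD (sepForm ([] : List (Sec A 𝓛))) = 0 := by simp [sepForm, sepSign, wedgeAll]
    rw [this, wedge_zero_right]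
    simp [unshuffle_nil, single]
  | cons a t ih =>
    rw [unshuffle_single_cons]
    have e1 : (fun b R => (a.deg * b.deg).negOnePow • G (s ++ deRhamSec b :: a :: R)) =
        fun b R => a.deg.negOnePow • G ((s ++ [a]) ++ deRhamSec b :: R) := by
      funext b R
      have hb : (deRhamSec b).deg = b.deg + 1 := by simp [Sec.deg, deRhamSec]; ring
      rw [hG s (deRhamSec b) a R, smul_smul, ← Int.negOnePow_add, hb, List.append_assoc]
      exact units_smul_congr ⟨a.deg * b.deg, by ring⟩ _
    have e2 : unshuffle Sec.deg
          (single fun b R => a.deg.negOnePow • G ((s ++ [a]) ++ deRhamSec b :: R)) t =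
        a.deg.negOnePow • unshuffle Sec.deg
          (single fun b R => G ((s ++ [a]) ++ deRhamSec b :: R)) t := by
      rw [← unshuffle_units_smul]
      refine unshuffle_congr fun S R _ _ _ => ?_
      rcases S with _ | ⟨b, _ | ⟨c, S⟩⟩
      · exact (smul_zero _).symm
      · rfl
      · exact (smul_zero _).symm
    rw [e1, e2, ih (s ++ [a]) (fun S' h1 h2 => h S' (by rw [h1]; simp; ring)
      (by rw [h2]; simp; ring)),
      h _ (by simp [deRhamSec]; ring) (by simp [deRhamSec])]
    have ev : vecs (s ++ deRhamSec a :: t) = vecs (s ++ a :: t) := by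
      simp [vecs, deRhamSec]
    have ev' : vecs ((s ++ [a]) ++ t) = vecs (s ++ a :: t) := by simp
    have ea : sepForm [a] = (a.form : Forms A) := by
      rw [sepForm_cons]; simp [sepForm, sepSign, wedgeAll]
    have ed : ((deRhamSec a).form : Forms A) = extD (a.form : Forms A) := rfl
    rw [ev, ev', sepForm_append, sepForm_append, ea, sepForm_cons (deRhamSec a),
      sepForm_cons a, extD_units_smul,
      extD_wedge, parity_of_mem a.form.2, ed, smul_add, wedge_add_right, map_add,
      LinearMap.add_apply, smul_add]
    simp only [wedge_units_smul_left, wedge_units_smul_right, bilin_units_smul, smul_smul,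
      ← Int.negOnePow_add, wedge_assoc]
    congr 1
    · refine units_smul_congr ⟨0, ?_⟩ _
      simp [deRhamSec]; ring
    · refine units_smul_congr ⟨a.tgtDeg, ?_⟩ _
      simp only [Sec.deg, degSum_append, degSum_cons, degSum_nil]; ring

/-- `Q_DR` and `Q_L` anticommute. -/
theorem unshuffle_bracketSec_deRham {Φ : Sec A 𝓛 → M} (hΦ : SecLinear Φ) (Q : LInfinity 𝓛)
    (S : List (Sec A 𝓛)) :
    unshuffle Sec.deg (fun S₁ S₂ => Φ (bracketSec Q (deRhamField S₁ :: S₂)) +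
      Φ (deRhamField (bracketSec Q S₁ :: S₂))) S = 0 := by
  obtain ⟨B, hB⟩ := hΦ.exists_bilin (degSum Sec.formDeg S + 1) (degSum Sec.tgtDeg S + 1)
  rw [unshuffle_add]
  have h2 : unshuffle Sec.deg (fun S₁ S₂ => Φ (deRhamField (bracketSec Q S₁ :: S₂))) S =
      Φ (deRhamSec (bracketSec Q S)) := by
    refine unshuffle_of_right_nil (fun S₁ S₂ h => ?_) S
    cases S₂ with
    | nil => exact absurd rfl h
    | cons b S₂ => exact hΦ.vec_zero rfl
  have h1 : unshuffle Sec.deg (fun S₁ S₂ => Φ (bracketSec Q (deRhamField S₁ :: S₂))) S =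
      unshuffle Sec.deg (single fun a R => Φ (bracketSec Q ([] ++ deRhamSec a :: R))) S := by
    refine unshuffle_congr fun S₁ S₂ _ _ _ => ?_
    have hz : ∀ a : Sec A 𝓛, (a.vec : L) = 0 → Φ (bracketSec Q (a :: S₂)) = 0 := by
      intro a ha
      refine hΦ.vec_zero ?_
      change evalBracket Q.bracket (⟨a.tgtDeg, a.vec⟩ :: vecs S₂) = 0
      rw [evalBracket_cons, ha]
      change Q.bracket _ _ = 0
      exact (Q.bracket _).map_coord_zero 0 rfl
    rcases S₁ with _ | ⟨b, _ | ⟨c, S₁⟩⟩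
    · exact hz _ rfl
    · rfl
    · exact hz _ rfl
  rw [h1, h2, unshuffle_deRham_bracket (gsym_bracketSec hΦ Q) Q
    ((degSum Sec.formDeg S + 1).negOnePow • B) [] S]
  · rw [apply_of_deg hB rfl (by rw [← degSum_vecs S]; rfl)]
    have e : ((deRhamSec (bracketSec Q S)).form : Forms A) =
        (degSum Sec.formDeg S).negOnePow • extD (sepForm S) := by
      rw [← extD_units_smul, ← bracketSec_form]
      rfl
    have e' : sepForm ([] : List (Sec A 𝓛)) = oneForm := by simp [sepForm, sepSign, wedgeAll]
    rw [e, e', oneForm_wedge, bilin_units_smul, Int.negOnePow_succ]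
    simp [deRhamSec, bracketSec, Units.smul_def]
  · intro S' hj hi
    rw [apply_bracketSec Q hB (by rw [hj]; simp) (by rw [hi]; simp)]
    rcases Int.units_eq_one_or (degSum Sec.formDeg S + 1).negOnePow with h | h <;> simp [h]

theorem deRhamField_deRhamField {Φ : Sec A 𝓛 → M} (hΦ : SecLinear Φ) (S₁ S₂ : List (Sec A 𝓛)) :
    Φ (deRhamField (deRhamField S₁ :: S₂)) = 0 := by
  rcases S₂ with _ | ⟨b, S₂⟩
  · refine hΦ.form_zero ?_
    change extD ((deRhamField S₁).form : Forms A) = 0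
    rcases S₁ with _ | ⟨b, _ | ⟨c, S₁⟩⟩
    · exact map_zero _
    · exact extD_extD _
    · exact map_zero _
  · exact hΦ.vec_zero rfl

end BrstSquare

/-! ### The BRST differential squares to zero and preserves locality -/

section BrstOperator

variable {A : Type*} [CommRing A] [Algebra ℝ A]
variable {L : Type*} [AddCommGroup L] [Module ℝ L] {𝓛 : ℤ → Submodule ℝ L}

/-- The component of `d α` of degree `m + 1` only depends on the component of `α` of degree `m`. -/
theorem extD_apply_succ_eq_zero {m : ℕ} {α : Forms A} (h : α m = 0) : extD α (m + 1) = 0 := by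
  induction m generalizing α with
  | zero =>
    refine form_succ_ext (β := 0) fun v => ?_
    rw [contract_extD, map_zero]
    ext w
    have e : extD (contract v α) 0 = 0 := rfl
    rw [Pi.sub_apply, e, sub_zero, lieD_apply, h]
    simp
  | succ m ih =>
    refine form_succ_ext (β := 0) fun v => ?_
    rw [contract_extD, map_zero]
    ext w
    have e : contract v α m = 0 := by
      ext w
      rw [contract_apply, h]
      rfl
    rw [Pi.sub_apply, ih e, sub_zero, lieD_apply, h]
    simp

theorem degSum_bracketTerm {Q : LInfinity 𝓛} {S R as : List (Sec A 𝓛)} (hp : (S ++ R).Perm as) :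
    degSum Sec.deg (bracketSec Q S :: R) = degSum Sec.deg as + 1 := by
  rw [degSum_cons, bracketSec_deg, ← degSum_perm _ hp, degSum_append]; ring

theorem degSum_deRhamTerm {S R as : List (Sec A 𝓛)} (hp : (S ++ R).Perm as) :
    degSum Sec.deg (deRhamField S :: R) = degSum Sec.deg as + 1 := by
  rw [degSum_cons, deRhamField_deg, ← degSum_perm _ hp, degSum_append]; ring

theorem parity_apply_eq_zero {α : Forms A} {q : ℕ} (h : α q = 0) : parity α q = 0 := by
  change (-1 : A) ^ q • α q = 0
  rw [h, smul_zero]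

/-- The value of `s F` on a list of total degree `m` only involves values of `F` on lists of total
degree `m + 1`, in the same form degree. -/
theorem brst_apply_eq_zero (Q : LInfinity 𝓛) {F : Cochain A 𝓛} {as : List (Sec A 𝓛)} {q : ℕ}
    (h : ∀ bs : List (Sec A 𝓛), degSum Sec.deg bs = degSum Sec.deg as + 1 → F bs q = 0) :
    brst Q F as q = 0 := by
  refine parity_apply_eq_zero ?_
  refine unshuffle_rel Sec.deg (fun (α : Forms A) (_ : Forms A) => α q = 0) ?_ ?_ _
    (fun _ _ => 0) as ?_
  · intro a _ b _ ha hb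
    rw [Pi.add_apply, ha, hb, add_zero]
  · intro u a _ ha
    rw [Pi.smul_apply, ha, smul_zero]
  · intro S R _ _ hp
    rcases S with _ | ⟨a, _ | ⟨b, S⟩⟩
    · rfl
    · change F _ q + F _ q = 0
      have h1 := degSum_deRhamTerm hp
      rw [h (deRhamSec a :: R) h1, h _ (degSum_bracketTerm hp), add_zero]
    · exact h _ (degSum_bracketTerm hp)

theorem brst_apply_congr (Q : LInfinity 𝓛) {F G : Cochain A 𝓛} {as : List (Sec A 𝓛)} {q : ℕ}
    (h : ∀ bs, F bs q = G bs q) : brst Q F as q = brst Q G as q := by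
  rw [← sub_eq_zero]
  have h1 : brst Q F as q - brst Q G as q = brst Q (F - G) as q := by
    rw [map_sub]
    rfl
  rw [h1]
  exact brst_apply_eq_zero Q fun bs _ => sub_eq_zero.mpr (h bs)

theorem brstTerm_eq (Q : LInfinity 𝓛) {F : Cochain A 𝓛} (hF : IsMultilinear F)
    (S R : List (Sec A 𝓛)) :
    brstTerm Q F R S = F (deRhamField S :: R) + F (bracketSec Q S :: R) := by
  rcases S with _ | ⟨a, _ | ⟨b, S⟩⟩
  · have h1 := (hF.secLinear_cons R).vec_zero (a := deRhamField []) rfl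
    have h2 := (hF.secLinear_cons R).vec_zero (a := bracketSec Q []) (evalBracket_nil Q)
    rw [h1, h2, add_zero]
    rfl
  · rfl
  · have h1 := (hF.secLinear_cons R).vec_zero (a := deRhamField (a :: b :: S)) rfl
    rw [h1, zero_add]
    rfl

theorem brst_apply (Q : LInfinity 𝓛) {F : Cochain A 𝓛} (hF : IsMultilinear F)
    (as : List (Sec A 𝓛)) :
    brst Q F as = parity (evol (M := Forms A) Sec.deg deRhamField F as +
      evol (M := Forms A) Sec.deg (bracketSec Q) F as) := by
  change parity (unshuffle Sec.deg (fun S R => brstTerm Q F R S) as) = _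
  rw [show (fun S R => brstTerm Q F R S) = _ from funext fun S => funext fun R =>
    brstTerm_eq Q hF S R, unshuffle_add]
  rfl

theorem evol_isMultilinear {q : List (Sec A 𝓛) → Sec A 𝓛} {F : Cochain A 𝓛} (hF : IsMultilinear F)
    (hq : ∀ R, IsMultilinear (fun S => F (q S :: R) : Cochain A 𝓛)) :
    IsMultilinear (evol (M := Forms A) Sec.deg q F : Cochain A 𝓛) := by
  refine isMultilinear_iff_linRel.mpr fun j i c₁ c₂ => ⟨fun u u' y => ?_, fun u y y' => ?_⟩
  · have h1 := fun R => (isMultilinear_iff_linRel.mp (hq R) j i c₁ c₂).1 u u' y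
    have h2 := fun S => ((isMultilinear_iff_linRel.mp hF j i c₁ c₂).1 u u' y).cons (q S)
    exact LinRel.unshuffle (deg := Sec.deg) (by rfl) (by rfl) h1 h2
  · have h1 := fun R => (isMultilinear_iff_linRel.mp (hq R) j i c₁ c₂).2 u y y'
    have h2 := fun S => ((isMultilinear_iff_linRel.mp hF j i c₁ c₂).2 u y y').cons (q S)
    exact LinRel.unshuffle (deg := Sec.deg) (by rfl) (by rfl) h1 h2

theorem symCochains_comp {F : Cochain A 𝓛} (hF : F ∈ symCochains A 𝓛) (φ : Forms A →ₗ[ℝ] Forms A) :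
    (fun as => φ (F as) : Cochain A 𝓛) ∈ symCochains A 𝓛 := by
  obtain ⟨h1, h2, h3⟩ := hF
  refine ⟨fun s t j i => ?_, fun s a b t => ?_, ?_⟩
  · obtain ⟨e1, e2, e3, e4⟩ := h1 s t j i
    refine ⟨fun u u' y => ?_, fun u y y' => ?_, fun c u y => ?_, fun c u y => ?_⟩
    · dsimp only; rw [e1, map_add]
    · dsimp only; rw [e2, map_add]
    · dsimp only; rw [e3, map_smul]
    · dsimp only; rw [e4, map_smul]
  · dsimp only
    rw [h2 s a b t]
    rcases Int.units_eq_one_or (a.deg * b.deg).negOnePow with h | h <;> simp [h]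
  · dsimp only
    rw [h3, map_zero]

theorem dH_mem_symCochains {F : Cochain A 𝓛} (hF : F ∈ symCochains A 𝓛) :
    dH A 𝓛 F ∈ symCochains A 𝓛 := symCochains_comp hF extD

variable (A) in
/-- The parity operator as a real-linear map. -/
def parityₗ : Forms A →ₗ[ℝ] Forms A where
  toFun := parity
  map_add' := map_add _
  map_smul' c α := by rw [real_smul_forms, map_smul, ← real_smul_forms, RingHom.id_apply]

theorem brst_mem_symCochains (Q : LInfinity 𝓛) {F : Cochain A 𝓛} (hF : F ∈ symCochains A 𝓛) :
    brst Q F ∈ symCochains A 𝓛 := by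
  have h : brst Q F = fun as => parityₗ A ((fun as => evol (M := Forms A) Sec.deg deRhamField F as +
      evol (M := Forms A) Sec.deg (bracketSec Q) F as : Cochain A 𝓛) as) :=
    funext fun as => brst_apply Q hF.1 as
  rw [h]
  refine symCochains_comp (Submodule.add_mem (symCochains A 𝓛)
    (x := (evol (M := Forms A) Sec.deg deRhamField F : Cochain A 𝓛))
    (y := (evol (M := Forms A) Sec.deg (bracketSec Q) F : Cochain A 𝓛)) ⟨?_, ?_, ?_⟩ ⟨?_, ?_, ?_⟩) _
  · exact evol_isMultilinear hF.1 fun R => deRhamField_linRel (hF.1.secLinear_cons R)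
  · exact GSym.unshuffle (fun R => gsym_deRhamField (hF.1.secLinear_cons R))
      (fun S => GSym.cons (M := Forms A) hF.2.1 _)
  · exact (hF.1.secLinear_cons []).vec_zero (a := deRhamField []) rfl
  · exact evol_isMultilinear hF.1 fun R => bracketSec_linRel (hF.1.secLinear_cons R) Q
  · exact GSym.unshuffle (fun R => gsym_bracketSec (hF.1.secLinear_cons R) Q)
      (fun S => GSym.cons (M := Forms A) hF.2.1 _)
  · exact (hF.1.secLinear_cons []).vec_zero (a := bracketSec Q []) (evalBracket_nil Q)

theorem eq_zero_of_add_self {x : Forms A} (h : x + x = 0) : x = 0 := by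
  have h2 : (2 : ℝ) • x = 0 := by rw [two_smul]; exact h
  exact (smul_eq_zero_iff_right (two_ne_zero)).mp h2

/-- The BRST differential squares to zero. -/
theorem brst_brst (Q : LInfinity 𝓛) {F : Cochain A 𝓛} (hF : F ∈ symCochains A 𝓛) :
    brst Q (brst Q F) = 0 := by
  funext as
  have hG : GSym (M := Forms A) Sec.deg F := hF.2.1
  have hd := evol_anticomm (M := Forms A) deRhamField_deg deRhamField_deg hG as
  have hl := evol_anticomm (M := Forms A) (bracketSec_deg Q) (bracketSec_deg Q) hG as
  have hm := evol_anticomm (M := Forms A) (bracketSec_deg Q) deRhamField_deg hG as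
  have zd : evol (M := Forms A) Sec.deg deRhamField
      (evol (M := Forms A) Sec.deg deRhamField F) as = 0 := by
    refine eq_zero_of_add_self (hd.trans (unshuffle_eq_zero fun S R _ _ _ =>
      unshuffle_eq_zero fun S₁ S₂ _ _ _ => ?_))
    have := deRhamField_deRhamField (hF.1.secLinear_cons R) S₁ S₂
    rw [this, add_zero]
  have zl : evol (M := Forms A) Sec.deg (bracketSec Q)
      (evol (M := Forms A) Sec.deg (bracketSec Q) F) as = 0 := by
    refine eq_zero_of_add_self (hl.trans (unshuffle_eq_zero fun S R _ _ _ => ?_))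
    have := unshuffle_bracketSec_bracketSec (hF.1.secLinear_cons R) Q S
    rw [unshuffle_add, this, add_zero]
  have zm := hm.trans (unshuffle_eq_zero fun S R _ _ _ =>
    unshuffle_bracketSec_deRham (hF.1.secLinear_cons R) Q S)
  -- The parity in the inner operator `s` passes through the outer sum over unshuffles, and there
  -- it cancels the outer parity.
  have ep : ∀ (q : List (Sec A 𝓛) → Sec A 𝓛), evol (M := Forms A) Sec.deg q (brst Q F) as =
      parity (evol (M := Forms A) Sec.deg q (evol (M := Forms A) Sec.deg deRhamField F) as +
        evol (M := Forms A) Sec.deg q (evol (M := Forms A) Sec.deg (bracketSec Q) F) as) := by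
    intro q
    refine Eq.trans ?_ (map_unshuffle (parityₗ A).toAddMonoidHom _ as).symm
      |>.trans (congrArg parity (unshuffle_add _ _ _ as))
    refine unshuffle_congr fun S R _ _ _ => ?_
    exact brst_apply Q hF.1 _
  rw [brst_apply Q (brst_mem_symCochains Q hF).1, ep, ep, ← map_add, parity_parity, zd, zl,
    zero_add, add_zero, zm]
  rfl

theorem dH_dH (F : Cochain A 𝓛) : dH A 𝓛 (dH A 𝓛 F) = 0 :=
  funext fun as => extD_extD (F as)

/-- The BRST and the horizontal differential anticommute. -/
theorem brst_dH (Q : LInfinity 𝓛) (F : Cochain A 𝓛) :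
    brst Q (dH A 𝓛 F) = -dH A 𝓛 (brst Q F) := by
  funext as
  change parity (unshuffle Sec.deg (fun S R => brstTerm Q (dH A 𝓛 F) R S) as) =
    -extD (parity (unshuffle Sec.deg (fun S R => brstTerm Q F R S) as))
  rw [extD_parity, neg_neg]
  congr 1
  refine Eq.trans ?_ (map_unshuffle (extD (A := A)).toAddMonoidHom _ as).symm
  refine unshuffle_congr fun S R _ _ _ => ?_
  rcases S with _ | ⟨a, _ | ⟨b, S⟩⟩
  · exact (map_zero (extD (A := A))).symm
  · exact (map_add (extD (A := A)) _ _).symm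
  · rfl

section Locality

variable {X : Type*} {𝔪 : X → Ideal A}

theorem jetVanishes_iff {k : ℕ} {x : X} {α : Forms A} :
    JetVanishes 𝔪 k x α ↔ α ∈ flat (𝔪 x) (k + 1) := Iff.rfl

theorem wedgeAll_flat {I : Ideal A} {m : ℕ} {S : List (Sec A 𝓛)}
    (h : ∃ a ∈ S, (a.form : Forms A) ∈ flat I m) : wedgeAll S ∈ flat I m := by
  induction S with
  | nil => simp at h
  | cons b S ih =>
    obtain ⟨a, ha, haf⟩ := h
    rcases List.mem_cons.mp ha with rfl | ha
    · exact flat_wedge_left haf _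
    · exact flat_wedge_right _ (ih ⟨a, ha, haf⟩)

theorem bracketSec_flat (Q : LInfinity 𝓛) {I : Ideal A} {m : ℕ} {S : List (Sec A 𝓛)}
    (h : ∃ a ∈ S, (a.form : Forms A) ∈ flat I m) :
    ((bracketSec Q S).form : Forms A) ∈ flat I m := by
  rw [bracketSec_form]
  exact flat_units_smul _ (flat_units_smul _ (wedgeAll_flat h))

theorem deRhamField_flat {I : Ideal A} {m : ℕ} {S : List (Sec A 𝓛)}
    (h : ∃ a ∈ S, (a.form : Forms A) ∈ flat I (m + 1)) :
    ((deRhamField S).form : Forms A) ∈ flat I m := by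
  obtain ⟨a, ha, haf⟩ := h
  rcases S with _ | ⟨b, _ | ⟨c, S⟩⟩
  · exact zero_mem _
  · rw [List.mem_singleton] at ha
    subst ha
    exact flat_extD haf
  · exact zero_mem _

/-- The BRST differential raises the order by one: an argument occurs in `s F` differentiated at
most once more than in `F`. -/
theorem brst_jetLocalAt (Q : LInfinity 𝓛) {F : Cochain A 𝓛} (hF : IsMultilinear F) {k : ℕ}
    {as : List (Sec A 𝓛)}
    (h : ∀ S R : List (Sec A 𝓛), S.Sublist as → R.Sublist as →
      JetLocalAt 𝔪 F k (deRhamField S :: R) ∧ JetLocalAt 𝔪 F k (bracketSec Q S :: R)) :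
    JetLocalAt 𝔪 (brst Q F) (k + 1) as := by
  rintro x ⟨a, ha, hax⟩
  rw [jetVanishes_iff] at hax ⊢
  refine flat_parity ?_
  refine unshuffle_rel Sec.deg (fun (α : Forms A) (_ : Forms A) => α ∈ flat (𝔪 x) (0 + 1)) ?_ ?_ _
    (fun _ _ => 0) as ?_
  · intro a _ b _ ha hb
    exact add_mem ha hb
  · intro u a _ ha
    exact flat_units_smul u ha
  · intro S R hS hR hp
    rw [brstTerm_eq Q hF]
    obtain ⟨h1, h2⟩ := h S R hS hR
    rcases List.mem_append.mp (hp.mem_iff.mpr ha) with haS | haR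
    · exact add_mem (h1 x ⟨_, List.mem_cons_self, deRhamField_flat ⟨a, haS, hax⟩⟩)
        (h2 x ⟨_, List.mem_cons_self, bracketSec_flat Q ⟨a, haS, flat_mono (Nat.le_succ _) hax⟩⟩)
    · exact add_mem (h1 x ⟨a, List.mem_cons_of_mem _ haR, flat_mono (Nat.le_succ _) hax⟩)
        (h2 x ⟨a, List.mem_cons_of_mem _ haR, flat_mono (Nat.le_succ _) hax⟩)

/-- The BRST differential preserves the formal cochains. -/
theorem brst_mem_formalCochains (Q : LInfinity 𝓛) {F : Cochain A 𝓛}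
    (hF : F ∈ formalCochains 𝓛 𝔪) : brst Q F ∈ formalCochains 𝓛 𝔪 := by
  obtain ⟨hs, hF⟩ := hF
  choose κ hκ using hF
  refine ⟨brst_mem_symCochains Q hs, fun τ => ?_⟩
  -- The bidegrees of `Q(S)` are functions of those of `S`.
  let ty : List (Sec A 𝓛) → List (ℤ × ℤ) := List.map fun a => (a.formDeg, a.tgtDeg)
  let tl : List (ℤ × ℤ) → ℤ × ℤ := fun σ => ((σ.map Prod.fst).sum, (σ.map Prod.snd).sum + 1)
  let td : List (ℤ × ℤ) → ℤ × ℤ := fun σ =>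
    if σ.length = 1 then ((σ.map Prod.fst).sum + 1, (σ.map Prod.snd).sum)
    else ((σ.map Prod.fst).sum + (σ.map Prod.snd).sum + 1, 0)
  have htl : ∀ S : List (Sec A 𝓛), ((bracketSec Q S).formDeg, (bracketSec Q S).tgtDeg) = tl (ty S) := by
    intro S
    change (degSum Sec.formDeg S, degSum Sigma.fst (vecs S) + 1) = _
    rw [degSum_vecs]
    simp [tl, ty, degSum, Function.comp_def]
  have htd : ∀ S : List (Sec A 𝓛), ((deRhamField S).formDeg, (deRhamField S).tgtDeg) = td (ty S) := by
    intro S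
    have h : degSum Sec.deg S + 1 = ((ty S).map Prod.fst).sum + ((ty S).map Prod.snd).sum + 1 := by
      rw [Sec.deg_sum]
      simp [ty, degSum, Function.comp_def]
    rcases S with _ | ⟨a, _ | ⟨b, S⟩⟩
    · simp [td, ty, deRhamField]
    · simp [td, ty, deRhamField, deRhamSec]
    · rw [show td (ty (a :: b :: S)) = _ from if_neg (by simp [ty]), ← h]
      rfl
  let P : Finset (List (ℤ × ℤ) × List (ℤ × ℤ)) := τ.sublists.toFinset ×ˢ τ.sublists.toFinset
  refine ⟨P.sup (fun σ => max (κ (td σ.1 :: σ.2)) (κ (tl σ.1 :: σ.2))) + 1, fun as has => ?_⟩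
  refine brst_jetLocalAt Q hs.1 fun S R hS hR => ?_
  have hmem : (ty S, ty R) ∈ P := by
    simp only [P, Finset.mem_product, List.mem_toFinset, List.mem_sublists]
    rw [← has]
    exact ⟨hS.map _, hR.map _⟩
  have hle := Finset.le_sup (f := fun σ : List (ℤ × ℤ) × List (ℤ × ℤ) =>
    max (κ (td σ.1 :: σ.2)) (κ (tl σ.1 :: σ.2))) hmem
  constructor
  · refine (hκ (td (ty S) :: ty R) _ ?_).mono 𝔪 ((le_max_left _ _).trans hle)
    rw [List.map_cons, htd]
  · refine (hκ (tl (ty S) :: ty R) _ ?_).mono 𝔪 ((le_max_right _ _).trans hle)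
    rw [List.map_cons, htl]

/-- The BRST differential of a polynomial vector field preserves the polynomial cochains. -/
theorem brst_mem_polyCochains {Q : LInfinity 𝓛} (hQ : Q.IsPolynomial) {F : Cochain A 𝓛}
    (hF : F ∈ polyCochains 𝓛 𝔪) : brst Q F ∈ polyCochains 𝓛 𝔪 := by
  classical
  obtain ⟨hs, N, k, D, h1, h2⟩ := hF
  choose ν Δ hνΔ using hQ
  refine ⟨brst_mem_symCochains Q hs, N + D.sup ν + 1, k + 1, D ∪ D.biUnion Δ, fun as has => ?_,
    fun as => brst_jetLocalAt Q hs.1 fun S R _ _ => ⟨h2 _, h2 _⟩⟩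
  by_contra hcon
  apply has
  suffices h : unshuffle Sec.deg (fun S R => brstTerm Q F R S) as = 0 by
    change parity (unshuffle Sec.deg (fun S R => brstTerm Q F R S) as) = 0
    rw [h, map_zero]
  refine unshuffle_eq_zero fun S R _ _ hp => ?_
  by_contra hne
  apply hcon
  rw [brstTerm_eq Q hs.1] at hne
  have hlen := hp.length_eq
  rw [List.length_append] at hlen
  have hmem : ∀ a, a ∈ as ↔ a ∈ S ∨ a ∈ R := fun a => by rw [← hp.mem_iff, List.mem_append]
  by_cases hd : F (deRhamField S :: R) = 0
  · rw [hd, zero_add] at hne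
    obtain ⟨hN, hD⟩ := h1 _ hne
    have hv : evalBracket Q.bracket (vecs S) ≠ 0 := fun h0 =>
      hne ((hs.1.secLinear_cons R).vec_zero (a := bracketSec Q S) h0)
    have hr : (bracketSec Q S).tgtDeg ∈ D := hD _ List.mem_cons_self
    obtain ⟨hν, hΔ⟩ := hνΔ _ (vecs S) rfl hv
    have hle : ν (bracketSec Q S).tgtDeg ≤ D.sup ν := Finset.le_sup hr
    have hS : (vecs S).length = S.length := List.length_map _
    refine ⟨?_, fun a ha => ?_⟩
    · rw [← hlen]
      rw [List.length_cons] at hN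
      have : S.length ≤ ν (bracketSec Q S).tgtDeg := hS ▸ hν
      omega
    · rcases (hmem a).mp ha with haS | haR
      · refine Finset.mem_union_right _ (Finset.mem_biUnion.mpr ⟨_, hr, ?_⟩)
        exact hΔ ⟨a.tgtDeg, a.vec⟩ (List.mem_map.mpr ⟨a, haS, rfl⟩)
      · exact Finset.mem_union_left _ (hD a (List.mem_cons_of_mem _ haR))
  · obtain ⟨hN, hD⟩ := h1 _ hd
    rcases S with _ | ⟨a, _ | ⟨b, S⟩⟩
    · exact absurd ((hs.1.secLinear_cons R).vec_zero (a := deRhamField []) rfl) hd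
    · refine ⟨?_, fun b hb => Finset.mem_union_left _ ?_⟩
      · rw [← hlen]
        simp only [List.length_cons, List.length_nil] at hN ⊢
        omega
      · rcases (hmem b).mp hb with hbS | hbR
        · rw [List.mem_singleton] at hbS
          subst hbS
          exact hD (deRhamSec b) List.mem_cons_self
        · exact hD b (List.mem_cons_of_mem _ hbR)
    · exact absurd ((hs.1.secLinear_cons R).vec_zero (a := deRhamField (a :: b :: S)) rfl) hd

end Locality

end BrstOperator

/-! ### Descent -/

section Descent

variable {A : Type*} [CommRing A] [Algebra ℝ A]
variable {L : Type*} [AddCommGroup L] [Module ℝ L] {𝓛 : ℤ → Submodule ℝ L}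

variable (A 𝓛) in
/-- Taking the component of a fixed form degree, as a linear map. -/
def componentₗ (p : ℕ) : Cochain A 𝓛 →ₗ[ℝ] Cochain A 𝓛 where
  toFun := component p
  map_add' F G := funext fun as => Pi.single_add p (F as p) (G as p)
  map_smul' c F := funext fun as => Pi.single_smul p c (F as p)

theorem component_apply_self (p : ℕ) (F : Cochain A 𝓛) (as : List (Sec A 𝓛)) :
    component p F as p = F as p := Pi.single_eq_same _ _

theorem component_apply_of_ne {p q : ℕ} (h : q ≠ p) (F : Cochain A 𝓛) (as : List (Sec A 𝓛)) :
    component p F as q = 0 := Pi.single_eq_of_ne h _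

theorem cochain_ext {F G : Cochain A 𝓛} (h : ∀ as q, F as q = G as q) : F = G :=
  funext fun as => funext fun q => h as q

theorem dH_apply_succ_congr {F G : Cochain A 𝓛} {as : List (Sec A 𝓛)} {q : ℕ}
    (h : F as q = G as q) : dH A 𝓛 F as (q + 1) = dH A 𝓛 G as (q + 1) := by
  rw [← sub_eq_zero]
  have e : extD (F as - G as) (q + 1) = 0 :=
    extD_apply_succ_eq_zero (by rw [Pi.sub_apply, h, sub_self])
  rw [map_sub] at e
  exact e

theorem dH_apply_eq_zero {F : Cochain A 𝓛} {as : List (Sec A 𝓛)} {q : ℕ}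
    (h : ∀ q', q' + 1 = q → F as q' = 0) : dH A 𝓛 F as q = 0 := by
  cases q with
  | zero => rfl
  | succ q => exact extD_apply_succ_eq_zero (h q rfl)

variable {C : Submodule ℝ (Cochain A 𝓛)} {Q : LInfinity 𝓛}

variable (Q) in
/-- The total differential `s + d_h`. -/
abbrev totalD : Cochain A 𝓛 →ₗ[ℝ] Cochain A 𝓛 := brst Q + dH A 𝓛

theorem totalD_eq (F : Cochain A 𝓛) : totalD Q F = brst Q F + dH A 𝓛 F := rfl

theorem total_apply (F : Cochain A 𝓛) (as : List (Sec A 𝓛)) (q : ℕ) :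
    totalD Q F as q = brst Q F as q + dH A 𝓛 F as q := rfl

theorem bigraded_le_totalGraded {p g m : ℤ} (h : p + g = m) :
    bigraded C p g ≤ totalGraded C m := fun F hF =>
  ⟨hF.1, fun as q hq => hF.2 as q fun hpg => hq (by omega)⟩

theorem component_mem_bigraded (hc : ∀ F ∈ C, ∀ p, component p F ∈ C) {m g : ℤ} {p : ℕ}
    (h : p + g = m) {F : Cochain A 𝓛} (hF : F ∈ totalGraded C m) :
    component p F ∈ bigraded C p g := by
  refine ⟨hc F hF.1 p, fun as q hq => ?_⟩
  by_cases hqp : q = p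
  · subst hqp
    rw [component_apply_self]
    exact hF.2 as q fun h' => hq ⟨rfl, by omega⟩
  · exact component_apply_of_ne hqp F as

theorem bigraded_apply_eq_zero {p g : ℤ} {F : Cochain A 𝓛} (hF : F ∈ bigraded C p g)
    (as : List (Sec A 𝓛)) {q : ℕ} (hq : (q : ℤ) ≠ p) : F as q = 0 :=
  hF.2 as q fun h => hq h.1

theorem total_mem_totalGraded (hd : ∀ F ∈ C, dH A 𝓛 F ∈ C) (hs : ∀ F ∈ C, brst Q F ∈ C) {m : ℤ}
    {F : Cochain A 𝓛} (hF : F ∈ totalGraded C m) :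
    totalD Q F ∈ totalGraded C (m + 1) := by
  refine ⟨add_mem (hs F hF.1) (hd F hF.1), fun as q hq => ?_⟩
  rw [total_apply, brst_apply_eq_zero Q fun bs hbs => hF.2 bs q (by omega), zero_add]
  refine dH_apply_eq_zero fun q' hq' => hF.2 as q' ?_
  push_cast [← hq'] at hq
  omega

theorem total_total (hs2 : ∀ F ∈ C, brst Q (brst Q F) = 0) {F : Cochain A 𝓛} (hF : F ∈ C) :
    totalD Q (totalD Q F) = 0 := by
  simp only [totalD_eq, map_add, hs2 F hF, dH_dH, brst_dH]
  abel

/-- The component of highest degree of a total cocycle is `d_h`-closed. -/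
theorem dH_component_eq_zero {r : ℕ} {z : Cochain A 𝓛} (hz : totalD Q z = 0)
    (hr : ∀ as, z as (r + 1) = 0) : dH A 𝓛 (component r z) = 0 := by
  refine cochain_ext fun as q => ?_
  by_cases hq : q = r + 1
  · subst hq
    rw [dH_apply_succ_congr (component_apply_self r z as)]
    have h := congrArg (fun F : Cochain A 𝓛 => F as (r + 1)) hz
    rw [total_apply, brst_apply_eq_zero Q fun bs _ => hr bs, zero_add] at h
    exact h
  · exact dH_apply_eq_zero fun q' hq' => component_apply_of_ne (by omega) z as

/-- Exactness of `d_h` in the degrees below `n`. -/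
def ExactBelow (C : Submodule ℝ (Cochain A 𝓛)) (n : ℕ) : Prop :=
  ∀ p : ℕ, p < n → ∀ (g : ℤ), ∀ F ∈ bigraded C p g, dH A 𝓛 F = 0 →
    ∃ G ∈ bigraded C (p - 1) g, dH A 𝓛 G = F

/-- A total cocycle without components of degree `≥ r` is a coboundary, for `r ≤ n`. -/
theorem exists_primitive_of_vanish (hd : ∀ F ∈ C, dH A 𝓛 F ∈ C) (hs : ∀ F ∈ C, brst Q F ∈ C)
    (hs2 : ∀ F ∈ C, brst Q (brst Q F) = 0) (hc : ∀ F ∈ C, ∀ p, component p F ∈ C) {n : ℕ}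
    (hex : ExactBelow C n) {m : ℤ} (r : ℕ) (hr : r ≤ n) (z : Cochain A 𝓛)
    (hz : z ∈ totalCocycles C Q m) (hv : ∀ as q, r ≤ q → z as q = 0) :
    z ∈ totalCoboundaries C Q m := by
  induction r generalizing z with
  | zero =>
    have : z = 0 := cochain_ext fun as q => hv as q (Nat.zero_le q)
    rw [this]
    exact zero_mem _
  | succ r ih =>
    have hy := component_mem_bigraded hc (p := r) (g := m - r) (by omega) hz.1
    -- The component of degree `r` is `d_h G`; subtracting `(s + d_h) G` removes it.
    obtain ⟨G, hG, hdG⟩ := hex r (by omega) _ _ hy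
      (dH_component_eq_zero hz.2 fun as => hv as _ le_rfl)
    have hGt : G ∈ totalGraded C (m - 1) := bigraded_le_totalGraded (by omega) hG
    have hD := total_mem_totalGraded hd hs hGt
    rw [sub_add_cancel] at hD
    have hz' : z - totalD Q G ∈ totalCocycles C Q m := by
      refine ⟨sub_mem hz.1 hD, ?_⟩
      have h0 : totalD Q z = 0 := hz.2
      rw [SetLike.mem_coe, LinearMap.mem_ker, map_sub, total_total hs2 hG.1, h0, sub_zero]
    have key := ih (by omega) _ hz' fun as q hq => ?_
    · have hsum := add_mem key
        (Submodule.mem_map_of_mem hGt : totalD Q G ∈ totalCoboundaries C Q m)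
      rwa [sub_add_cancel] at hsum
    · change z as q - (brst Q G as q + dH A 𝓛 G as q) = 0
      rw [hdG, brst_apply_eq_zero Q fun bs _ => bigraded_apply_eq_zero hG bs (by omega), zero_add]
      by_cases hqr : q = r
      · subst hqr
        rw [component_apply_self, sub_self]
      · rw [component_apply_of_ne hqr, hv as q (by omega), sub_zero]

/-- A cochain whose total differential has no components of degree `≥ r`, with `r ≤ n`, can be
completed to a total cocycle by changing its components of degree `< r`. -/
theorem exists_cocycle_of_vanish (hd : ∀ F ∈ C, dH A 𝓛 F ∈ C) (hs : ∀ F ∈ C, brst Q F ∈ C)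
    (hs2 : ∀ F ∈ C, brst Q (brst Q F) = 0) (hc : ∀ F ∈ C, ∀ p, component p F ∈ C) {n : ℕ}
    (hex : ExactBelow C n) {m : ℤ} (r : ℕ) (hr : r ≤ n) (y : Cochain A 𝓛)
    (hy : y ∈ totalGraded C m) (hv : ∀ as q, r ≤ q → totalD Q y as q = 0) :
    ∃ z ∈ totalCocycles C Q m, ∀ as q, r ≤ q → z as q = y as q := by
  induction r generalizing y with
  | zero =>
    exact ⟨y, ⟨hy, cochain_ext fun as q => hv as q (Nat.zero_le q)⟩, fun _ _ _ => rfl⟩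
  | succ r ih =>
    have hR := component_mem_bigraded hc (p := r) (g := m + 1 - r) (by omega)
      (total_mem_totalGraded hd hs hy)
    -- The obstruction in degree `r` is `d_h G`; subtracting `G` from `y` removes it, at the cost
    -- of `s G`, which has the form degree `r - 1` of `G`.
    obtain ⟨G, hG, hdG⟩ := hex r (by omega) _ _ hR
      (dH_component_eq_zero (total_total hs2 hy.1) fun as => hv as _ le_rfl)
    have hGt : G ∈ totalGraded C m := bigraded_le_totalGraded (by omega) hG
    have hv' : ∀ as q, r ≤ q → totalD Q (y - G) as q = 0 := by
      intro as q hq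
      rw [map_sub]
      change totalD Q y as q - (brst Q G as q + dH A 𝓛 G as q) = 0
      rw [hdG, brst_apply_eq_zero Q fun bs _ => bigraded_apply_eq_zero hG bs (by omega), zero_add]
      by_cases hqr : q = r
      · subst hqr
        rw [component_apply_self, sub_self]
      · rw [component_apply_of_ne hqr, hv as q (by omega), sub_zero]
    obtain ⟨z, hz, hzy⟩ := ih (by omega) (y - G) (sub_mem hy hGt) hv'
    refine ⟨z, hz, fun as q hq => (hzy as q (by omega)).trans ?_⟩
    change y as q - G as q = y as q
    rw [bigraded_apply_eq_zero hG as (by omega), sub_zero]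

/-- The descent argument: if `d_h` is exact below the top degree `n`, the total cohomology is
isomorphic to the iterated cohomology in top degree, by taking the top component. -/
theorem exists_equiv_of_exactBelow (hd : ∀ F ∈ C, dH A 𝓛 F ∈ C) (hs : ∀ F ∈ C, brst Q F ∈ C)
    (hs2 : ∀ F ∈ C, brst Q (brst Q F) = 0) (hc : ∀ F ∈ C, ∀ p, component p F ∈ C) {n : ℕ}
    (hex : ExactBelow C n) (htop : ∀ p, n < p → Subsingleton (Form A p)) (g : ℤ) :
    ∃ e : TotalCohomology C Q (g + n) ≃ₗ[ℝ] IteratedCohomology C Q g n,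
      ∀ z : totalCocycles C Q (g + n), ∃ w : iteratedCocycles C Q g n,
        w.1 = component n z.1 ∧ e (Submodule.Quotient.mk z) = Submodule.Quotient.mk w := by
  have hzero : ∀ (F : Cochain A 𝓛) (as : List (Sec A 𝓛)) (p : ℕ), n < p → F as p = 0 :=
    fun F as p hp => (htop p hp).elim _ _
  -- The top component of `s F + d_h F` for an arbitrary cochain `F`.
  have htopD : ∀ F : Cochain A 𝓛, F ∈ C → ∀ m g' : ℤ, F ∈ totalGraded C m → n - 1 + g' = m →
      ∃ G ∈ bigraded C ((n : ℤ) - 1) g',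
        component n (totalD Q F) = brst Q (component n F) + dH A 𝓛 G := by
    intro F hF m g' hFm hg'
    have h1 : component n (brst Q F) = brst Q (component n F) := by
      refine cochain_ext fun as q => ?_
      by_cases hq : q = n
      · subst hq
        rw [component_apply_self]
        exact brst_apply_congr Q fun bs => (component_apply_self q F bs).symm
      · rw [component_apply_of_ne hq]
        exact (brst_apply_eq_zero Q fun bs _ => component_apply_of_ne hq F bs).symm
    have h2 : component n (totalD Q F) =
        component n (brst Q F) + component n (dH A 𝓛 F) := map_add (componentₗ A 𝓛 n) _ _
    rw [h2, h1]
    cases n with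
    | zero =>
      refine ⟨0, zero_mem _, ?_⟩
      rw [map_zero]
      congr 1
      refine cochain_ext fun as q => ?_
      by_cases hq : q = 0
      · subst hq
        rw [component_apply_self]
        rfl
      · exact component_apply_of_ne hq _ _
    | succ n =>
      refine ⟨component n F, ?_, ?_⟩
      · have := component_mem_bigraded hc (p := n) (g := g') (by push_cast at hg'; omega) hFm
        simpa using this
      · congr 1
        refine cochain_ext fun as q => ?_
        by_cases hq : q = n + 1
        · subst hq
          rw [component_apply_self]
          exact dH_apply_succ_congr (component_apply_self n F as).symm
        · rw [component_apply_of_ne hq]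
          exact (dH_apply_eq_zero fun q' hq' => component_apply_of_ne (by omega) F as).symm
  have hclosed : ∀ F : Cochain A 𝓛, (∀ as q, q ≠ n → F as q = 0) → dH A 𝓛 F = 0 := by
    intro F hF
    refine cochain_ext fun as q => ?_
    by_cases hq : q = n + 1
    · exact hzero _ as q (by omega)
    · exact dH_apply_eq_zero fun q' hq' => hF as q' (by omega)
  have hmap : ∀ z ∈ totalCocycles C Q (g + n), componentₗ A 𝓛 n z ∈ iteratedCocycles C Q g n := by
    intro z hz
    refine ⟨⟨component_mem_bigraded hc (by omega) hz.1,
      hclosed _ fun as q hq => component_apply_of_ne hq z as⟩, ?_⟩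
    obtain ⟨G, hG, hGe⟩ := htopD z hz.1.1 (g + n) (g + 1) hz.1 (by omega)
    have h0 : totalD Q z = 0 := hz.2
    rw [h0, show component n (0 : Cochain A 𝓛) = 0 from map_zero (componentₗ A 𝓛 n)] at hGe
    refine ⟨-G, neg_mem hG, ?_⟩
    rw [map_neg]
    exact (eq_neg_of_add_eq_zero_left hGe.symm).symm
  let φ : totalCocycles C Q (g + n) →ₗ[ℝ] IteratedCohomology C Q g n :=
    (Submodule.mkQ _) ∘ₗ (componentₗ A 𝓛 n).restrict hmap
  have hφ : ∀ z, φ z = Submodule.Quotient.mk ⟨component n z.1, hmap z.1 z.2⟩ := fun z => rfl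
  have hφ0 : ∀ z, φ z = 0 ↔ component n z.1 ∈ iteratedCoboundaries C Q g n := fun z =>
    (Submodule.Quotient.mk_eq_zero _).trans Iff.rfl
  have hker : (totalCoboundaries C Q (g + n)).submoduleOf (totalCocycles C Q (g + n)) =
      LinearMap.ker φ := by
    ext z
    rw [LinearMap.mem_ker, hφ0]
    constructor
    · rintro ⟨F, hF, hFz⟩
      obtain ⟨G, hG, hGe⟩ := htopD F hF.1 _ g hF (by omega)
      have e : z.1 = totalD Q F := hFz.symm
      rw [e, hGe]
      refine Submodule.add_mem_sup (Submodule.mem_map_of_mem ⟨?_, ?_⟩) (Submodule.mem_map_of_mem hG)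
      · exact component_mem_bigraded hc (by omega) hF
      · exact hclosed _ fun as q hq => component_apply_of_ne hq F as
    · intro hz
      obtain ⟨_, ⟨F, hF, rfl⟩, _, ⟨G, hG, rfl⟩, hsum⟩ := Submodule.mem_sup.mp hz
      have hFt : F ∈ totalGraded C (g + n - 1) := bigraded_le_totalGraded (by omega) hF.1
      have hGt : G ∈ totalGraded C (g + n - 1) := bigraded_le_totalGraded (by omega) hG
      have hFG := add_mem hFt hGt
      have hD := total_mem_totalGraded hd hs hFG
      rw [sub_add_cancel] at hD
      have hz' : z.1 - totalD Q (F + G) ∈ totalCocycles C Q (g + n) := by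
        refine ⟨sub_mem z.2.1 hD, ?_⟩
        have h0 : totalD Q z.1 = 0 := z.2.2
        rw [SetLike.mem_coe, LinearMap.mem_ker, map_sub, total_total hs2 hFG.1, h0, sub_zero]
      -- After the top component is removed, the cocycle is a coboundary by exactness.
      have key := exists_primitive_of_vanish hd hs hs2 hc hex n le_rfl _ hz' fun as q hq => ?_
      · have hsum := add_mem key
          (Submodule.mem_map_of_mem hFG : totalD Q (F + G) ∈ totalCoboundaries C Q (g + n))
        rw [sub_add_cancel] at hsum
        exact hsum
      · rcases hq.lt_or_eq with hq | rfl
        · exact hzero _ as q hq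
        · have h1 : totalD Q (F + G) = (brst Q F + dH A 𝓛 G) + brst Q G := by
            have h2 : dH A 𝓛 F = 0 := hF.2
            rw [totalD_eq, map_add, map_add, h2]
            abel
          rw [h1, hsum]
          change z.1 as n - (component n z.1 as n + brst Q G as n) = 0
          rw [component_apply_self,
            brst_apply_eq_zero Q fun bs _ => bigraded_apply_eq_zero hG bs (by omega)]
          abel
  have hsurj : Function.Surjective φ := by
    intro x
    obtain ⟨w, rfl⟩ := Submodule.Quotient.mk_surjective _ x
    obtain ⟨⟨hw1, hw2⟩, G, hG, hGe⟩ := w.2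
    have hw2 : dH A 𝓛 w.1 = 0 := hw2
    have hwt : w.1 ∈ totalGraded C (g + n) := bigraded_le_totalGraded (by omega) hw1
    have hGt : G ∈ totalGraded C (g + n) := bigraded_le_totalGraded (by omega) hG
    -- The relation `s w = d_h G` says that `w - G` is a cocycle up to lower form degrees.
    obtain ⟨z, hz, hzw⟩ := exists_cocycle_of_vanish hd hs hs2 hc hex n le_rfl (w.1 - G)
      (sub_mem hwt hGt) fun as q hq => by
        have h1 : totalD Q (w.1 - G) = -brst Q G := by
          rw [map_sub, totalD_eq, totalD_eq, hw2, ← hGe]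
          abel
        rw [h1]
        change -(brst Q G as q) = 0
        rw [brst_apply_eq_zero Q fun bs _ => bigraded_apply_eq_zero hG bs (by omega), neg_zero]
    refine ⟨⟨z, hz⟩, ?_⟩
    rw [hφ]
    congr 1
    refine Subtype.ext (cochain_ext fun as q => ?_)
    by_cases hq : q = n
    · subst hq
      change component q z as q = w.1 as q
      rw [component_apply_self, hzw as q le_rfl]
      change w.1 as q - G as q = w.1 as q
      rw [bigraded_apply_eq_zero hG as (by omega), sub_zero]
    · rw [bigraded_apply_eq_zero hw1 as (by omega)]
      exact component_apply_of_ne hq z as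
  refine ⟨(Submodule.quotEquivOfEq _ _ hker).trans (φ.quotKerEquivOfSurjective hsurj), fun z =>
    ⟨⟨component n z.1, hmap z.1 z.2⟩, rfl, ?_⟩⟩
  rw [← hφ]
  rfl

end Descent

/-! ### Differential operators in local coordinates -/

section Operators

variable {A : Type*} [CommRing A] [Algebra ℝ A]

/-- The differential of a function, as a form of degree `1`. -/
def dForm (f : A) : Forms A := extD (f • oneForm)

theorem parity_smul_oneForm (f : A) : parity (f • oneForm : Forms A) = f • oneForm := by
  rw [map_smul, parity_oneForm]

theorem extD_smul (f : A) (α : Forms A) : extD (f • α) = wedge (dForm f) α + f • extD α := by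
  have h : f • α = wedge (f • oneForm) α := by rw [wedge_smul_left, oneForm_wedge]
  rw [h, extD_wedge, parity_smul_oneForm, wedge_smul_left, oneForm_wedge]
  rfl

theorem contract_dForm (v : Derivation ℝ A A) (f : A) :
    contract v (dForm f) = v f • oneForm := by
  have h : contract v (f • oneForm : Forms A) = 0 := by
    rw [map_smul, contract_oneForm, smul_zero]
  rw [dForm, contract_extD, h, map_zero, sub_zero]
  funext p
  ext w
  rw [lieD_apply]
  cases p with
  | zero => simp [oneForm]
  | succ p => simp [oneForm]

theorem parity_dForm (f : A) : parity (dForm f) = -dForm f := by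
  rw [dForm, ← neg_eq_iff_eq_neg, ← extD_parity, parity_smul_oneForm]

theorem contract_dForm_wedge (v : Derivation ℝ A A) (f : A) (α : Forms A) :
    contract v (wedge (dForm f) α) = v f • α - wedge (dForm f) (contract v α) := by
  rw [contract_wedge, contract_dForm, parity_dForm, wedge_smul_left, oneForm_wedge,
    wedge_neg_left, ← sub_eq_add_neg]

theorem contract_comm (v w : Derivation ℝ A A) (α : Forms A) :
    contract v (contract w α) = -contract w (contract v α) := by
  have h := contract_self (v + w) α
  simp only [contract_add, map_add, contract_self, zero_add, add_zero] at h
  exact eq_neg_of_add_eq_zero_right h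

variable {X : Type*} (ev : X → A →ₐ[ℝ] ℝ)

/-- The ideal of the functions that vanish at a point. -/
abbrev ptIdeal (x : X) : Ideal A := RingHom.ker (ev x)

variable {ev}

theorem mem_ptIdeal {x : X} {f : A} : f ∈ ptIdeal ev x ↔ ev x f = 0 := Iff.rfl

theorem mem_flat_one {x : X} {α : Forms A} : α ∈ flat (ptIdeal ev x) 1 ↔
    ∀ (p : ℕ) (w : Fin p → Derivation ℝ A A), ev x (α p w) = 0 := by
  simp only [mem_flat, pow_one, mem_ptIdeal]

theorem sub_const_mem (x : X) (f : A) : f - algebraMap ℝ A (ev x f) ∈ ptIdeal ev x := by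
  rw [mem_ptIdeal, map_sub, AlgHom.commutes]
  exact sub_self _

/-- Forms are equal if their values are equal at every point. -/
theorem forms_ext_of_flat (sep : ∀ f : A, (∀ x, ev x f = 0) → f = 0) {α β : Forms A}
    (h : ∀ x, α - β ∈ flat (ptIdeal ev x) 1) : α = β := by
  rw [← sub_eq_zero]
  funext p
  ext w
  exact sep _ fun x => mem_flat_one.mp (h x) p w

variable (ev) in
/-- Coordinates on a neighbourhood of the points of a set `V`: functions `x i`, and derivations
`v i` that restrict to the coordinate vector fields near `V`, together with the consequences that
are used: duality, the expansion of derivations, and Hadamard's lemma. -/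
structure LocalCoords (n : ℕ) where
  V : Set X
  v : Fin n → Derivation ℝ A A
  x : Fin n → A
  dual : ∀ p ∈ V, ∀ i j, ev p (v i (x j)) = if i = j then 1 else 0
  expand : ∀ p ∈ V, ∃ ψ : A, ev p ψ = 1 ∧ ∀ w : Derivation ℝ A A, ψ • w = ψ • ∑ i, w (x i) • v i
  hadamard : ∀ p ∈ V, ∀ f, ev p f = 0 → (∀ i, ev p (v i f) = 0) → f ∈ ptIdeal ev p ^ 2

namespace LocalCoords

variable {n : ℕ} (c : LocalCoords ev n)

/-- The operator `∑ dxⁱ ∧ ι_{vᵢ}`, which multiplies forms by their degree. -/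
def degreeOp (α : Forms A) : Forms A := ∑ i, wedge (dForm (c.x i)) (contract (c.v i) α)

theorem smul_contract {ψ : A} (hψ : ∀ w : Derivation ℝ A A, ψ • w = ψ • ∑ i, w (c.x i) • c.v i)
    (w : Derivation ℝ A A) (α : Forms A) :
    ψ • contract w α = ψ • ∑ i, w (c.x i) • contract (c.v i) α := by
  have hs : ∀ s : Finset (Fin n), contract (∑ i ∈ s, w (c.x i) • c.v i) α =
      ∑ i ∈ s, w (c.x i) • contract (c.v i) α := by
    classical
    intro s
    induction s using Finset.induction_on with
    | empty =>
      have := contract_smul (0 : A) 0 α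
      simpa using this
    | insert a s ha ih =>
      rw [Finset.sum_insert ha, Finset.sum_insert ha, contract_add, contract_smul, ih]
  rw [← hs, ← contract_smul, ← contract_smul, hψ]

/-- Near a point at which coordinates are available, `∑ dxⁱ ∧ ι_{vᵢ}` multiplies `m`-forms by `m`.
The function `ψ` localizes the identity to such a neighbourhood. -/
theorem smul_degreeOp {ψ : A} (hψ : ∀ w : Derivation ℝ A A, ψ • w = ψ • ∑ i, w (c.x i) • c.v i)
    (m : ℕ) (α : Forms A) : (ψ • c.degreeOp α) m = (m : ℝ) • (ψ • α) m := by
  induction m generalizing α with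
  | zero =>
    rw [Nat.cast_zero, zero_smul]
    have h : c.degreeOp α 0 = 0 := by
      rw [degreeOp, Finset.sum_apply]
      refine Finset.sum_eq_zero fun i _ => ?_
      ext w
      exact zero_mul _
    rw [Pi.smul_apply, h, smul_zero]
  | succ m ih =>
    refine form_succ_ext (β := ((m + 1 : ℕ) : ℝ) • (ψ • α)) fun u => ?_
    have h1 : contract u (c.degreeOp α) =
        ∑ i, u (c.x i) • contract (c.v i) α + c.degreeOp (contract u α) := by
      rw [degreeOp, degreeOp, map_sum, ← Finset.sum_add_distrib]
      refine Finset.sum_congr rfl fun i _ => ?_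
      rw [contract_dForm_wedge, contract_comm u, wedge_neg_right, sub_neg_eq_add]
    have h2 : contract u (((m + 1 : ℕ) : ℝ) • (ψ • α)) =
        ((m + 1 : ℕ) : ℝ) • ψ • contract u α := rfl
    rw [h2, map_smul, h1, smul_add, ← c.smul_contract hψ, Pi.add_apply, ih, Pi.smul_apply,
      Nat.cast_succ, add_smul, one_smul, add_comm]
    rfl

/-- There are no forms of degree larger than the number of coordinates. -/
theorem form_apply_eq_zero {p : ℕ} (hp : n < p) (α : Form A p) (w : Fin p → Derivation ℝ A A)
    {x : X} (hx : x ∈ c.V) : ev x (α w) = 0 := by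
  obtain ⟨ψ, h1, hψ⟩ := c.expand x hx
  have h2 : α (fun k => ψ • w k) = (∏ _k : Fin p, ψ) • α w :=
    α.toMultilinearMap.map_smul_univ (fun _ => ψ) w
  have h3 : α (fun k => ψ • w k) = (∏ _k : Fin p, ψ) • α fun k => ∑ i, w k (c.x i) • c.v i := by
    rw [show (fun k => ψ • w k) = fun k => ψ • ∑ i, w k (c.x i) • c.v i from
      funext fun k => hψ (w k)]
    exact α.toMultilinearMap.map_smul_univ (fun _ => ψ) _
  have h4 : α (fun k => ∑ i, w k (c.x i) • c.v i) = 0 := by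
    refine (α.toMultilinearMap.map_sum _).trans (Finset.sum_eq_zero fun r _ => ?_)
    have h5 := α.toMultilinearMap.map_smul_univ (fun k => w k (c.x (r k))) fun k => c.v (r k)
    refine h5.trans ?_
    obtain ⟨i, j, hij, hr⟩ := Fintype.exists_ne_map_eq_of_card_lt r (by simpa using hp)
    have h6 : α (fun k => c.v (r k)) = 0 := α.map_eq_zero_of_eq _ (by rw [hr]) hij
    change _ • α (fun k => c.v (r k)) = 0
    rw [h6, smul_zero]
  rw [h2, h4, smul_zero] at h3
  have h7 := congrArg (ev x) h3
  simpa [map_mul, map_prod, h1] using h7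

/-- A homogeneous form whose coefficients vanish to order `k + 1` is a combination of forms whose
coefficients vanish to order `k`, with coefficients that vanish at the point. -/
theorem flat_succ_homog {x : X} (hx : x ∈ c.V) (k q : ℕ) {α : Forms A} (hα : α ∈ homog A q)
    (hf : α ∈ flat (ptIdeal ev x) (k + 1)) :
    α ∈ ptIdeal ev x • flat (ptIdeal ev x) k := by
  induction q generalizing α with
  | zero =>
    have h : α = α 0 ![] • oneForm := by
      funext p
      cases p with
      | zero =>
        refine form_zero_ext (β := α 0 ![] • oneForm) ?_
        change _ = _ * (1 : A)
        rw [mul_one]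
      | succ p => rw [hα (p + 1) (by push_cast; omega), Pi.smul_apply, oneForm, smul_zero]
    have h0 := hf 0 ![]
    rw [h]
    rw [pow_succ'] at h0
    refine Submodule.mul_induction_on h0 (fun f hf g hg => ?_) (fun f g hf hg => ?_)
    · rw [mul_smul]
      refine Submodule.smul_mem_smul hf ?_
      simpa using mul_flat hg (flat_zero (ptIdeal ev x) (oneForm : Forms A))
    · rw [add_smul]
      exact add_mem hf hg
  | succ q ih =>
    obtain ⟨ψ, h1, hψ⟩ := c.expand x hx
    have hdeg : c.degreeOp α ∈ ptIdeal ev x • flat (ptIdeal ev x) k := by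
      refine sum_mem fun i _ => ?_
      have hi := ih (by simpa using contract_mem hα (c.v i)) (flat_contract (c.v i) hf)
      refine Submodule.smul_induction_on hi (fun f hf β hβ => ?_) (fun β γ hβ hγ => ?_)
      · rw [wedge_smul_right]
        exact Submodule.smul_mem_smul hf (flat_wedge_right _ hβ)
      · rw [wedge_add_right]
        exact add_mem hβ hγ
    have e : ψ • c.degreeOp α = ((q + 1 : ℕ) : ℝ) • ψ • α := by
      funext m
      rw [c.smul_degreeOp hψ]
      by_cases hm : (m : ℤ) = ((q + 1 : ℕ) : ℤ)
      · rw [Nat.cast_inj.mp hm]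
        rfl
      · change (m : ℝ) • ψ • α m = ((q + 1 : ℕ) : ℝ) • ψ • α m
        rw [hα m hm, smul_zero, smul_zero, smul_zero]
    have e2 : α = algebraMap ℝ A ((q + 1 : ℕ) : ℝ)⁻¹ • ψ • c.degreeOp α + (1 - ψ) • α := by
      rw [e, ← real_smul_forms, smul_smul, inv_mul_cancel₀ (by positivity), one_smul, ← add_smul,
        add_sub_cancel, one_smul]
    rw [e2]
    refine add_mem (Submodule.smul_mem _ _ (Submodule.smul_mem _ _ hdeg))
      (Submodule.smul_mem_smul ?_ (flat_mono (Nat.le_succ k) hf))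
    rw [mem_ptIdeal, map_sub, map_one, h1, sub_self]

end LocalCoords

/-- Real-linear operators on differential forms. -/
abbrev Op (A : Type*) [CommRing A] [Algebra ℝ A] : Type _ := Forms A →ₗ[ℝ] Forms A

variable (A) in
/-- Multiplication by a function. -/
def mulOp (f : A) : Op A where
  toFun α := f • α
  map_add' := smul_add f
  map_smul' c α := smul_comm f c α

/-- The commutator with the multiplication by a function. -/
def commOp (f : A) : Op A →ₗ[ℝ] Op A where
  toFun P := P ∘ₗ mulOp A f - mulOp A f ∘ₗ P
  map_add' P R := by rw [LinearMap.add_comp, LinearMap.comp_add]; abel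
  map_smul' c P := by
    ext1 α
    change c • P (f • α) - f • c • P α = c • (P (f • α) - f • P α)
    rw [smul_sub c (P (f • α)), smul_comm f c (P α)]

theorem commOp_apply (f : A) (P : Op A) (α : Forms A) : commOp f P α = P (f • α) - f • P α := rfl

theorem op_smul (f : A) (P : Op A) (α : Forms A) : P (f • α) = f • P α + commOp f P α := by
  rw [commOp_apply]; abel

theorem commOp_comm (f g : A) (P : Op A) : commOp f (commOp g P) = commOp g (commOp f P) := by
  ext1 α
  simp only [commOp_apply, smul_sub]
  rw [smul_comm f g α, smul_comm f g (P α)]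
  abel

variable (ev) in
/-- Differential operators of order less than `m`: the value at a point vanishes on forms whose
coefficients vanish to order `m` at this point. -/
def OrdLT (P : Op A) (m : ℕ) : Prop :=
  ∀ x, ∀ α ∈ flat (ptIdeal ev x) m, P α ∈ flat (ptIdeal ev x) 1

theorem OrdLT.commOp_sub {P : Op A} (x : X) (f : A) (α : Forms A) :
    commOp f P α = P ((f - algebraMap ℝ A (ev x f)) • α) -
      (f - algebraMap ℝ A (ev x f)) • P α := by
  rw [commOp_apply, sub_smul f _ α, sub_smul f _ (P α), map_sub, ← real_smul_forms,
    ← real_smul_forms, map_smul P (ev x f) α]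
  abel

/-- The commutator with a function lowers the order by one. -/
theorem OrdLT.commOp {P : Op A} {m : ℕ} (hP : OrdLT ev P (m + 1)) (f : A) :
    OrdLT ev (commOp f P) m := by
  intro x α hα
  rw [OrdLT.commOp_sub x]
  have h := sub_const_mem (ev := ev) x f
  rw [← pow_one (ptIdeal ev x)] at h
  refine sub_mem (hP x _ ?_) (mul_flat h (flat_zero _ _))
  rw [add_comm]
  exact mul_flat h hα

theorem OrdLT.eq_zero (sep : ∀ f : A, (∀ x, ev x f = 0) → f = 0) {P : Op A}
    (hP : OrdLT ev P 0) : P = 0 := by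
  ext1 α
  refine forms_ext_of_flat sep fun x => ?_
  rw [LinearMap.zero_apply, sub_zero]
  exact hP x α (flat_zero _ _)

/-- A differential operator of order less than `m` maps forms that vanish to order `m + r` to
forms that vanish to order `r + 1`. -/
theorem OrdLT.flat (sep : ∀ f : A, (∀ x, ev x f = 0) → f = 0)
    (hflat : ∀ x k, flat (ptIdeal ev x) (k + 1) ≤ ptIdeal ev x • LocalBRST.flat (ptIdeal ev x) k)
    {P : Op A} {m : ℕ} (hP : OrdLT ev P m) {x : X} {r : ℕ} {α : Forms A}
    (hα : α ∈ LocalBRST.flat (ptIdeal ev x) (m + r)) :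
    P α ∈ LocalBRST.flat (ptIdeal ev x) (r + 1) := by
  induction m generalizing P r α with
  | zero =>
    rw [hP.eq_zero sep]
    exact zero_mem _
  | succ m ihm =>
    induction r generalizing α with
    | zero => exact hP x α hα
    | succ r ihr =>
      have h := hflat x (m + 1 + r) hα
      refine Submodule.smul_induction_on h (fun f hf β hβ => ?_) (fun β γ hβ hγ => ?_)
      · rw [op_smul]
        rw [← pow_one (ptIdeal ev x)] at hf
        refine add_mem ?_ (ihm (hP.commOp f) ?_)
        · rw [add_comm (r + 1) 1]
          exact mul_flat hf (ihr hβ)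
        · exact flat_mono (by omega) hβ
      · rw [map_add]
        exact add_mem hβ hγ

end Operators

/-! ### The local contracting homotopy -/

section Homotopy

variable {A : Type*} [CommRing A] [Algebra ℝ A] {X : Type*} {ev : X → A →ₐ[ℝ] ℝ}

/-- The form degree of the values of an operator. -/
def HasDegree (P : Op A) (q : ℤ) : Prop := ∀ α, P α ∈ homog A q

variable (ev) in
/-- The values of an operator vanish to infinite order outside of `V`. -/
def SupportedIn (P : Op A) (V : Set X) : Prop :=
  ∀ x, x ∉ V → ∀ α m, P α ∈ flat (ptIdeal ev x) m

variable (A) in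
/-- Composition with the exterior derivative. -/
def dOp : Op A →ₗ[ℝ] Op A where
  toFun P := extD ∘ₗ P
  map_add' _ _ := LinearMap.comp_add _ _ _
  map_smul' _ _ := LinearMap.comp_smul _ _ _

theorem real_smul_mem {N : Submodule A (Forms A)} (c : ℝ) {α : Forms A} (h : α ∈ N) : c • α ∈ N := by
  rw [real_smul_forms]
  exact N.smul_mem _ h

namespace LocalCoords

variable {n : ℕ} (c : LocalCoords ev n)

/-- The Koszul contraction `P ↦ ∑ ι_{vᵢ} ∘ [P, xⁱ]`. -/
def koszul : Op A →ₗ[ℝ] Op A where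
  toFun P :=
    { toFun := fun α => ∑ i, contract (c.v i) (commOp (c.x i) P α)
      map_add' := fun α β => by simp only [map_add, Finset.sum_add_distrib]
      map_smul' := fun r α => by
        have h : ∀ (v : Derivation ℝ A A) (β : Forms A), contract v (r • β) = r • contract v β :=
          fun _ _ => rfl
        simp only [map_smul, h, Finset.smul_sum, RingHom.id_apply] }
  map_add' P R := by
    ext1 α
    change ∑ i, contract (c.v i) (commOp (c.x i) (P + R) α) =
      ∑ i, contract (c.v i) (commOp (c.x i) P α) + ∑ i, contract (c.v i) (commOp (c.x i) R α)
    simp only [map_add, LinearMap.add_apply, Finset.sum_add_distrib]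
  map_smul' r P := by
    ext1 α
    change ∑ i, contract (c.v i) (commOp (c.x i) (r • P) α) =
      r • ∑ i, contract (c.v i) (commOp (c.x i) P α)
    have h : ∀ (v : Derivation ℝ A A) (β : Forms A), contract v (r • β) = r • contract v β :=
      fun _ _ => rfl
    simp only [map_smul, LinearMap.smul_apply, h, Finset.smul_sum]

theorem koszul_apply (P : Op A) (α : Forms A) :
    c.koszul P α = ∑ i, contract (c.v i) (commOp (c.x i) P α) := rfl

/-- A form that vanishes to order `k + 1` at `x` is a combination, with coefficients vanishing at
`x`, of forms that vanish to order `k`. The absence of forms of degree above `n` reduces this to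
homogeneous forms. -/
theorem flat_succ (htop : ∀ p, n < p → Subsingleton (Form A p)) {x : X} (hx : x ∈ c.V) (k : ℕ) :
    flat (ptIdeal ev x) (k + 1) ≤ ptIdeal ev x • flat (ptIdeal ev x) k := by
  intro α hα
  have h : α = ∑ q ∈ Finset.range (n + 1), homogProj A q α := by
    funext p
    rw [Finset.sum_apply]
    by_cases hp : p < n + 1
    · rw [Finset.sum_eq_single_of_mem p (Finset.mem_range.mpr hp), homogProj_apply, if_pos rfl]
      intro q _ hq
      rw [homogProj_apply, if_neg (by exact_mod_cast hq.symm)]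
    · exact (htop p (by omega)).elim _ _
  rw [h]
  exact sum_mem fun q _ => c.flat_succ_homog hx k q (homogProj_mem _ _) (flat_homogProj _ hα)

/-- On symbols, the operator `∑ vᵢ ∘ [P, xⁱ]` is the Euler operator: it multiplies the part of
order `m` by `m`. -/
theorem euler (sep : ∀ f : A, (∀ x, ev x f = 0) → f = 0)
    (hflat : ∀ x k, flat (ptIdeal ev x) (k + 1) ≤ ptIdeal ev x • flat (ptIdeal ev x) k)
    {P : Op A} {m : ℕ} (hP : OrdLT ev P (m + 1)) {p : X} (hp : p ∈ c.V) {α : Forms A}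
    (hα : α ∈ flat (ptIdeal ev p) m) (q : ℕ) (w : Fin q → Derivation ℝ A A) :
    ∑ i, ev p (c.v i (commOp (c.x i) P α q w)) = m * ev p (P α q w) := by
  induction m generalizing P α with
  | zero =>
    rw [Nat.cast_zero, zero_mul]
    refine Finset.sum_eq_zero fun i _ => ?_
    rw [(hP.commOp (c.x i)).eq_zero sep]
    simp
  | succ m ih =>
    refine Submodule.smul_induction_on (hflat p m hα) (fun f hf β hβ => ?_) (fun β γ hβ hγ => ?_)
    · have hf0 : ev p f = 0 := hf
      have e1 : ∀ i, ev p (c.v i (commOp (c.x i) P (f • β) q w)) =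
          ev p (c.v i f) * ev p (commOp (c.x i) P β q w) +
            ev p (c.v i (commOp (c.x i) (commOp f P) β q w)) := by
        intro i
        rw [op_smul, commOp_comm f]
        have : (f • commOp (c.x i) P β + commOp (c.x i) (commOp f P) β) q w =
            f * commOp (c.x i) P β q w + commOp (c.x i) (commOp f P) β q w := rfl
        rw [this, map_add, map_add, Derivation.leibniz, smul_eq_mul, smul_eq_mul, map_add, map_mul,
          map_mul, hf0, zero_mul, zero_add, mul_comm]
      simp only [e1, Finset.sum_add_distrib]
      rw [ih (hP.commOp f) hβ]
      have e2 : ev p (commOp f P β q w) = ev p (P (f • β) q w) := by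
        have : commOp f P β q w = P (f • β) q w - f * P β q w := rfl
        rw [this, map_sub, map_mul, hf0, zero_mul, sub_zero]
      have e3 : ∀ i, ev p (commOp (c.x i) P β q w) =
          ev p (P ((c.x i - algebraMap ℝ A (ev p (c.x i))) • β) q w) := by
        intro i
        have h := sub_const_mem (ev := ev) p (c.x i)
        rw [mem_ptIdeal] at h
        rw [OrdLT.commOp_sub p (c.x i)]
        have : (P ((c.x i - algebraMap ℝ A (ev p (c.x i))) • β) -
            (c.x i - algebraMap ℝ A (ev p (c.x i))) • P β) q w =
            P ((c.x i - algebraMap ℝ A (ev p (c.x i))) • β) q w -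
            (c.x i - algebraMap ℝ A (ev p (c.x i))) * P β q w := rfl
        rw [this, map_sub, map_mul, h, zero_mul, sub_zero]
      -- The difference between `f` and its first-order Taylor polynomial.
      let T : A := ∑ i, algebraMap ℝ A (ev p (c.v i f)) *
        (c.x i - algebraMap ℝ A (ev p (c.x i)))
      have hT : f - T ∈ ptIdeal ev p ^ 2 := by
        refine c.hadamard p hp _ ?_ fun j => ?_
        · rw [map_sub, hf0, map_sum, zero_sub, neg_eq_zero]
          refine Finset.sum_eq_zero fun i _ => ?_
          have h := sub_const_mem (ev := ev) p (c.x i)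
          rw [mem_ptIdeal] at h
          rw [map_mul, h, mul_zero]
        · rw [map_sub, map_sum, map_sub, map_sum]
          have : ∀ i, ev p (c.v j (algebraMap ℝ A (ev p (c.v i f)) *
              (c.x i - algebraMap ℝ A (ev p (c.x i))))) =
              ev p (c.v i f) * if j = i then 1 else 0 := by
            intro i
            rw [← Algebra.smul_def, Derivation.map_smul, map_sub, Derivation.map_algebraMap,
              sub_zero, map_smul, c.dual p hp, smul_eq_mul]
          simp only [this]
          simp
      have e4 : ∑ i, ev p (c.v i f) * ev p (commOp (c.x i) P β q w) = ev p (P (T • β) q w) := by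
        have : P (T • β) = ∑ i, ev p (c.v i f) •
            P ((c.x i - algebraMap ℝ A (ev p (c.x i))) • β) := by
          rw [Finset.sum_smul, map_sum]
          refine Finset.sum_congr rfl fun i _ => ?_
          rw [mul_smul, ← real_smul_forms, map_smul P (ev p (c.v i f))]
        rw [this]
        simp only [e3]
        have hs : ∀ s : Finset (Fin n), (∑ i ∈ s, ev p (c.v i f) •
            P ((c.x i - algebraMap ℝ A (ev p (c.x i))) • β)) q w =
            ∑ i ∈ s, ev p (c.v i f) • P ((c.x i - algebraMap ℝ A (ev p (c.x i))) • β) q w := by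
          classical
          intro s
          induction s using Finset.induction_on with
          | empty => rfl
          | insert a s ha ih =>
            rw [Finset.sum_insert ha, Finset.sum_insert ha, ← ih]
            rfl
        rw [hs, map_sum]
        refine Finset.sum_congr rfl fun i _ => ?_
        exact (map_smul (ev p) (ev p (c.v i f)) _).symm
      have e5 : ev p (P (f • β) q w) = ev p (P (T • β) q w) := by
        have h1 : P ((f - T) • β) ∈ flat (ptIdeal ev p) 1 := by
          refine hP p _ ?_
          have := mul_flat hT hβ
          rwa [add_comm] at this
        rw [sub_smul f T β, map_sub] at h1
        have h2 := mem_flat_one.mp h1 q w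
        have h3 : (P (f • β) - P (T • β)) q w = P (f • β) q w - P (T • β) q w := rfl
        rw [h3, map_sub] at h2
        exact sub_eq_zero.mp h2
      rw [e4, e2, ← e5]
      push_cast
      ring
    · have e1 : ∀ i, ev p (c.v i (commOp (c.x i) P (β + γ) q w)) =
          ev p (c.v i (commOp (c.x i) P β q w)) + ev p (c.v i (commOp (c.x i) P γ q w)) := by
        intro i
        rw [map_add, ← map_add (ev p), ← map_add (c.v i)]
        rfl
      simp only [e1, Finset.sum_add_distrib]
      rw [hβ, hγ, ← mul_add, ← map_add (ev p), map_add P]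
      rfl

/-- The homotopy formula: on closed operators of order at most `m` with values in `q`-forms, the
operator `d ∘ koszul` is multiplication by `n - q + m`, up to operators of lower order. -/
theorem extD_koszul (sep : ∀ f : A, (∀ x, ev x f = 0) → f = 0)
    (hflat : ∀ x k, flat (ptIdeal ev x) (k + 1) ≤ ptIdeal ev x • flat (ptIdeal ev x) k)
    {P : Op A} {m q : ℕ} (hP : OrdLT ev P (m + 1)) (hcl : ∀ α, extD (P α) = 0) {p : X}
    (hp : p ∈ c.V) {α : Forms A} (hα : α ∈ flat (ptIdeal ev p) m) (w : Fin q → Derivation ℝ A A) :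
    ev p (extD (c.koszul P α) q w) = ((n : ℝ) - q + m) * ev p (P α q w) := by
  have e0 : ∀ i, extD (commOp (c.x i) P α) = -wedge (dForm (c.x i)) (P α) := by
    intro i
    rw [commOp_apply, map_sub, hcl, extD_smul, hcl, smul_zero, add_zero, zero_sub]
  have e1 : extD (c.koszul P α) = ∑ i, lieD (c.v i) (commOp (c.x i) P α) +
      (∑ i, c.v i (c.x i) • P α - c.degreeOp (P α)) := by
    rw [koszul_apply, map_sum, degreeOp, ← Finset.sum_sub_distrib, ← Finset.sum_add_distrib]
    refine Finset.sum_congr rfl fun i _ => ?_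
    rw [← contract_dForm_wedge, lieD_eq, e0, map_neg]
    abel
  have hs : ∀ (s : Finset (Fin n)) (F : Fin n → Forms A),
      ev p ((∑ i ∈ s, F i) q w) = ∑ i ∈ s, ev p (F i q w) := by
    classical
    intro s F
    induction s using Finset.induction_on with
    | empty => exact map_zero _
    | insert a s ha ih =>
      rw [Finset.sum_insert ha, Finset.sum_insert ha, ← ih, ← map_add (ev p)]
      rfl
  have e2 : ev p (extD (c.koszul P α) q w) =
      ev p ((∑ i, lieD (c.v i) (commOp (c.x i) P α)) q w) +
      (ev p ((∑ i, c.v i (c.x i) • P α) q w) - ev p (c.degreeOp (P α) q w)) := by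
    rw [e1, ← map_sub (ev p), ← map_add (ev p)]
    rfl
  have e3 : ev p (c.degreeOp (P α) q w) = q * ev p (P α q w) := by
    obtain ⟨ψ, h1, hψ⟩ := c.expand p hp
    have h := congrArg (fun F : Form A q => ev p (F w)) (c.smul_degreeOp hψ q (P α))
    have h2 : ev p (ψ * c.degreeOp (P α) q w) = ev p ((q : ℝ) • (ψ * P α q w)) := h
    rwa [map_mul, map_smul, map_mul, h1, one_mul, one_mul, smul_eq_mul] at h2
  have e4 : ev p ((∑ i, c.v i (c.x i) • P α) q w) = n * ev p (P α q w) := by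
    rw [hs]
    have : ∀ i, ev p ((c.v i (c.x i) • P α) q w) = ev p (P α q w) := by
      intro i
      change ev p (c.v i (c.x i) * P α q w) = _
      rw [map_mul, c.dual p hp, if_pos rfl, one_mul]
    rw [Finset.sum_congr rfl fun i _ => this i]
    simp
  have e5 : ev p ((∑ i, lieD (c.v i) (commOp (c.x i) P α)) q w) = m * ev p (P α q w) := by
    rw [hs, ← c.euler sep hflat hP hp hα q w]
    refine Finset.sum_congr rfl fun i _ => ?_
    rw [lieD_apply, map_sub, map_sum]
    have h1 := mem_flat_one.mp ((hP.commOp (c.x i)) p α hα)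
    rw [Finset.sum_eq_zero fun k _ => h1 q _, sub_zero]
  rw [e2, e3, e4, e5]
  ring

/-- Subtraction of `r` times the homotopy formula. -/
def lowerOrder (r : ℝ) : Op A →ₗ[ℝ] Op A where
  toFun P := P - r • dOp A (c.koszul P)
  map_add' P R := by
    rw [map_add, map_add, smul_add]
    abel
  map_smul' s P := by
    rw [map_smul, map_smul, smul_comm r s, RingHom.id_apply]
    exact (smul_sub s P _).symm

/-- The contracting homotopy for closed operators of order less than `m` with values in `q`-forms:
the homotopy formula is used to lower the order step by step. -/
def localHomotopy (q : ℕ) : ℕ → (Op A →ₗ[ℝ] Op A)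
  | 0 => 0
  | m + 1 =>
    { toFun := fun P => ((n : ℝ) - q + m)⁻¹ • c.koszul P +
        localHomotopy q m (c.lowerOrder ((n : ℝ) - q + m)⁻¹ P)
      map_add' := fun P R => by
        simp only [map_add, smul_add]
        abel
      map_smul' := fun s P => by
        simp only [map_smul, RingHom.id_apply, smul_add, smul_comm _ s] }

theorem localHomotopy_zero (q : ℕ) (P : Op A) (α : Forms A) : c.localHomotopy q 0 P α = 0 := rfl

theorem localHomotopy_succ (q m : ℕ) (P : Op A) (α : Forms A) :
    c.localHomotopy q (m + 1) P α = ((n : ℝ) - q + m)⁻¹ • c.koszul P α +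
      c.localHomotopy q m (P - ((n : ℝ) - q + m)⁻¹ • dOp A (c.koszul P)) α := rfl

theorem koszul_mem {P : Op A} {D : Submodule A (Forms A)} {I : Ideal A} {r : ℕ}
    (h : ∀ α ∈ D, P α ∈ flat I r) {α : Forms A} (hα : α ∈ D) : c.koszul P α ∈ flat I r := by
  rw [koszul_apply]
  exact sum_mem fun i _ => flat_contract _ (sub_mem (h _ (D.smul_mem _ hα))
    (Submodule.smul_mem _ _ (h _ hα)))

theorem koszul_hasDegree {P : Op A} {q : ℤ} (h : HasDegree P q) : HasDegree (c.koszul P) (q - 1) := by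
  intro α
  rw [koszul_apply]
  refine sum_mem fun i _ => contract_mem ?_ _
  have h2 : c.x i • P α ∈ homog A q := fun k hk => by rw [Pi.smul_apply, h α k hk, smul_zero]
  exact (homog A q).sub_mem (h _) h2

theorem step_hasDegree {P : Op A} {q : ℤ} (h : HasDegree P q) (r : ℝ) :
    HasDegree (P - r • dOp A (c.koszul P)) q := fun α => by
  have := extD_mem (c.koszul_hasDegree h α)
  rw [sub_add_cancel] at this
  exact sub_mem (h α) (Submodule.smul_mem _ _ this)

theorem localHomotopy_hasDegree {P : Op A} {d : ℤ} (h : HasDegree P d) (q m : ℕ) :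
    HasDegree (c.localHomotopy q m P) (d - 1) := by
  induction m generalizing P with
  | zero => exact fun α => (homog A (d - 1)).zero_mem
  | succ m ih =>
    intro α
    rw [localHomotopy_succ]
    exact add_mem (Submodule.smul_mem _ _ (c.koszul_hasDegree h α)) (ih (c.step_hasDegree h _) α)

/-- Locality of the homotopy: it loses at most `m` orders of vanishing, since each of its `m` steps
differentiates once. -/
theorem localHomotopy_mem {P : Op A} {D : Submodule A (Forms A)} {I : Ideal A} {r : ℕ} (q m : ℕ)
    (h : ∀ α ∈ D, P α ∈ flat I (r + m)) {α : Forms A} (hα : α ∈ D) :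
    c.localHomotopy q m P α ∈ flat I r := by
  induction m generalizing P α with
  | zero => exact (flat I r).zero_mem
  | succ m ih =>
    rw [localHomotopy_succ]
    refine add_mem (real_smul_mem _ (flat_mono (by omega) (c.koszul_mem h hα))) (ih (fun β hβ => ?_) hα)
    exact sub_mem (flat_mono (by omega) (h β hβ))
      (real_smul_mem _ (flat_extD (c.koszul_mem h hβ)))

theorem localHomotopy_supportedIn {P : Op A} {V : Set X} (h : SupportedIn ev P V) (q m : ℕ) :
    SupportedIn ev (c.localHomotopy q m P) V := fun x hx _ _ =>
  c.localHomotopy_mem (D := ⊤) q m (fun β _ => h x hx β _) trivial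

/-- In form degree `q < n` the factors `n - q + m` of the homotopy formula are nonzero, so closed
operators with values in `q`-forms are `d` of their local homotopy. Outside of the coordinate
neighbourhood the homotopy formula is not available; there the operator vanishes to infinite
order. -/
theorem extD_localHomotopy (sep : ∀ f : A, (∀ x, ev x f = 0) → f = 0)
    (hflat : ∀ x k, flat (ptIdeal ev x) (k + 1) ≤ ptIdeal ev x • flat (ptIdeal ev x) k)
    {P : Op A} {m q : ℕ} (hq : q < n) (hP : OrdLT ev P m) (hdeg : HasDegree P q)
    (hsupp : SupportedIn ev P c.V) (hcl : ∀ α, extD (P α) = 0) (α : Forms A) :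
    extD (c.localHomotopy q m P α) = P α := by
  induction m generalizing P with
  | zero =>
    rw [hP.eq_zero sep, localHomotopy_zero, map_zero, LinearMap.zero_apply]
  | succ m ih =>
    have hpos : (n : ℝ) - q + m ≠ 0 := by
      have : (q : ℝ) < n := by exact_mod_cast hq
      have hm : (0 : ℝ) ≤ m := Nat.cast_nonneg m
      linarith
    rw [localHomotopy_succ, map_add, ih]
    · change extD _ + (P α - ((n : ℝ) - q + m)⁻¹ • extD (c.koszul P α)) = P α
      rw [map_smul]
      abel
    · intro x β hβ
      by_cases hx : x ∈ c.V
      · rw [mem_flat_one]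
        intro k w
        by_cases hk : (k : ℤ) = q
        · obtain rfl : k = q := by exact_mod_cast hk
          have h := c.extD_koszul sep hflat hP hcl hx hβ w
          change ev x (P β k w - ((n : ℝ) - k + m)⁻¹ • extD (c.koszul P β) k w) = 0
          rw [map_sub, map_smul, h, smul_eq_mul, inv_mul_cancel_left₀ hpos, sub_self]
        · rw [c.step_hasDegree hdeg _ β k hk]
          exact map_zero _
      · exact sub_mem (hsupp x hx β 1) (real_smul_mem _ (flat_extD
          (c.koszul_mem (D := ⊤) (fun β _ => hsupp x hx β 2) trivial)))
    · exact c.step_hasDegree hdeg _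
    · exact fun x hx β r => sub_mem (hsupp x hx β r) (real_smul_mem _ (flat_extD
          (c.koszul_mem (D := ⊤) (fun β _ => hsupp x hx β (r + 1)) trivial)))
    · intro β
      change extD (P β - ((n : ℝ) - q + m)⁻¹ • extD (c.koszul P β)) = 0
      rw [map_sub, map_smul, extD_extD, hcl, smul_zero, sub_zero]

end LocalCoords

end Homotopy

/-! ### Gluing the local homotopies -/

section Cover

variable {A : Type*} [CommRing A] [Algebra ℝ A] {X : Type*}

/-- A cover by coordinate neighbourhoods, with what is needed to glue: functions `χ a` supported
in `V a` that sum up to `1`, functions `η a` that are `1` on `V a`, and the locally finite sum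
`f ↦ ∑ η a * f a`, which coincides at each point to infinite order with a finite sum. -/
structure CoordCover (ev : X → A →ₐ[ℝ] ℝ) (n : ℕ) (ι : Type*) where
  c : ι → LocalCoords ev n
  χ : ι → A
  η : ι → A
  glue : (ι → A) →ₗ[A] A
  sep : ∀ f : A, (∀ x, ev x f = 0) → f = 0
  χ_flat : ∀ a p, p ∉ (c a).V → ∀ m, χ a ∈ ptIdeal ev p ^ m
  η_one : ∀ a, ∀ p ∈ (c a).V, ev p (η a) = 1
  glue_spec : ∀ p, ∃ s : Finset ι, ∀ f m, glue f - ∑ a ∈ s, η a * f a ∈ ptIdeal ev p ^ m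
  glue_χ : glue χ = 1

namespace CoordCover

variable {ev : X → A →ₐ[ℝ] ℝ} {n : ℕ} {ι : Type*} (U : CoordCover ev n ι)

theorem exists_mem (p : X) : ∃ a, p ∈ (U.c a).V := by
  by_contra! h
  obtain ⟨s, hs⟩ := U.glue_spec p
  have h1 := hs U.χ 1
  have h2 : ∑ a ∈ s, U.η a * U.χ a ∈ ptIdeal ev p ^ 1 :=
    sum_mem fun a _ => Ideal.mul_mem_left _ _ (U.χ_flat a p (h a) 1)
  have h3 := add_mem h1 h2
  rw [sub_add_cancel, U.glue_χ, pow_one, mem_ptIdeal, map_one] at h3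
  exact one_ne_zero h3

/-- There are no nonzero forms of degree above `n`. -/
theorem subsingleton_form (U : CoordCover ev n ι) {p : ℕ} (hp : n < p) : Subsingleton (Form A p) := by
  have h : ∀ α : Form A p, α = 0 := fun α => by
    ext w
    refine U.sep _ fun x => ?_
    obtain ⟨a, ha⟩ := U.exists_mem x
    exact (U.c a).form_apply_eq_zero hp α w ha
  exact ⟨fun α β => (h α).trans (h β).symm⟩

theorem flat_succ (U : CoordCover ev n ι) (x : X) (k : ℕ) :
    flat (ptIdeal ev x) (k + 1) ≤ ptIdeal ev x • flat (ptIdeal ev x) k := by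
  obtain ⟨a, ha⟩ := U.exists_mem x
  exact (U.c a).flat_succ (fun _ => U.subsingleton_form) ha k

theorem η_smul {a : ι} {σ : Forms A} (h : ∀ x, x ∉ (U.c a).V → σ ∈ flat (ptIdeal ev x) 1) :
    U.η a • σ = σ := by
  refine forms_ext_of_flat U.sep fun x => ?_
  by_cases hx : x ∈ (U.c a).V
  · have h1 : U.η a - 1 ∈ ptIdeal ev x ^ 1 := by
      rw [pow_one, mem_ptIdeal, map_sub, U.η_one a x hx, map_one, sub_self]
    have h2 := mul_flat h1 (flat_zero (ptIdeal ev x) σ)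
    rwa [sub_smul (U.η a) 1 σ, one_smul] at h2
  · exact sub_mem (Submodule.smul_mem _ _ (h x hx)) (h x hx)

theorem η_mul_χ (a : ι) : U.η a * U.χ a = U.χ a := by
  rw [← sub_eq_zero]
  refine U.sep _ fun x => ?_
  by_cases hx : x ∈ (U.c a).V
  · rw [map_sub, map_mul, U.η_one a x hx, one_mul, sub_self]
  · have h := U.χ_flat a x hx 1
    rw [pow_one, mem_ptIdeal] at h
    rw [map_sub, map_mul, h, mul_zero, sub_zero]

/-- The locally finite sum `∑ η a • σ a` of differential forms. -/
def glueForm : (ι → Forms A) →ₗ[A] Forms A where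
  toFun σ p := U.glue.compAlternatingMap (AlternatingMap.pi fun a => σ a p)
  map_add' σ σ' := by
    funext p
    ext w
    exact map_add U.glue (fun a => σ a p w) fun a => σ' a p w
  map_smul' f σ := by
    funext p
    ext w
    exact map_smul U.glue f fun a => σ a p w

theorem glueForm_apply (σ : ι → Forms A) (p : ℕ) (w : Fin p → Derivation ℝ A A) :
    U.glueForm σ p w = U.glue fun a => σ a p w := rfl

/-- At each point, `glueForm` is a finite sum and finitely many of the `χ a` sum up to `1`, both up
to terms that vanish to infinite order. -/
theorem glueForm_spec (x : X) : ∃ s : Finset ι, (∀ (σ : ι → Forms A) (m : ℕ),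
      U.glueForm σ - ∑ a ∈ s, U.η a • σ a ∈ flat (ptIdeal ev x) m) ∧
    ∀ m, 1 - ∑ a ∈ s, U.χ a ∈ ptIdeal ev x ^ m := by
  obtain ⟨s, hs⟩ := U.glue_spec x
  refine ⟨s, fun σ m p w => ?_, fun m => ?_⟩
  · have h := hs (fun a => σ a p w) m
    have h2 : ∀ s : Finset ι, (∑ a ∈ s, U.η a • σ a) p w = ∑ a ∈ s, U.η a * σ a p w := by
      classical
      intro s
      induction s using Finset.induction_on with
      | empty => rfl
      | insert a s ha ih =>
        rw [Finset.sum_insert ha, Finset.sum_insert ha, ← ih]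
        rfl
    rw [← h2] at h
    exact h
  · have h := hs U.χ m
    rwa [U.glue_χ, Finset.sum_congr rfl fun a _ => U.η_mul_χ a] at h

/-- The contracting homotopy: the homotopies of the coordinate neighbourhoods are glued. -/
def homotopy (q m : ℕ) : Op A →ₗ[ℝ] Op A where
  toFun P :=
    { toFun := fun α => U.glueForm fun a => (U.c a).localHomotopy q m (P ∘ₗ mulOp A (U.χ a)) α
      map_add' := fun α β => by
        rw [← map_add U.glueForm]
        congr 1
        funext a
        exact map_add _ α β
      map_smul' := fun r α => by
        rw [RingHom.id_apply, real_smul_forms r (U.glueForm _), ← map_smul U.glueForm]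
        congr 1
        funext a
        rw [Pi.smul_apply, ← real_smul_forms]
        exact map_smul ((U.c a).localHomotopy q m (P ∘ₗ mulOp A (U.χ a))) r α }
  map_add' P R := by
    ext1 α
    change U.glueForm _ = U.glueForm _ + U.glueForm _
    rw [← map_add U.glueForm]
    congr 1
    funext a
    rw [LinearMap.add_comp, map_add]
    rfl
  map_smul' r P := by
    ext1 α
    change U.glueForm _ = r • U.glueForm _
    rw [real_smul_forms, ← map_smul U.glueForm]
    congr 1
    funext a
    rw [Pi.smul_apply, ← real_smul_forms, LinearMap.smul_comp, map_smul]
    rfl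

theorem homotopy_apply (q m : ℕ) (P : Op A) (α : Forms A) : U.homotopy q m P α =
    U.glueForm fun a => (U.c a).localHomotopy q m (P ∘ₗ mulOp A (U.χ a)) α := rfl

theorem homotopy_hasDegree {P : Op A} {d : ℤ} (h : HasDegree P d) (q m : ℕ) :
    HasDegree (U.homotopy q m P) (d - 1) := by
  intro α k hk
  ext w
  rw [homotopy_apply, glueForm_apply]
  have : (fun a => (U.c a).localHomotopy q m (P ∘ₗ mulOp A (U.χ a)) α k w) = 0 := by
    funext a
    have h2 : HasDegree (P ∘ₗ mulOp A (U.χ a)) d := fun β => h _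
    rw [(U.c a).localHomotopy_hasDegree h2 q m α k hk]
    rfl
  rw [this]
  exact map_zero _

/-- Locality of the glued homotopy: at `x` it is a finite sum of local homotopies, up to a form
that vanishes to infinite order. -/
theorem homotopy_mem {P : Op A} {D : Submodule A (Forms A)} {x : X} (q m : ℕ)
    (h : ∀ α ∈ D, P α ∈ flat (ptIdeal ev x) (1 + m)) {α : Forms A} (hα : α ∈ D) :
    U.homotopy q m P α ∈ flat (ptIdeal ev x) 1 := by
  obtain ⟨s, hs, -⟩ := U.glueForm_spec x
  rw [homotopy_apply, ← sub_add_cancel (U.glueForm _) (∑ a ∈ s, U.η a •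
    (U.c a).localHomotopy q m (P ∘ₗ mulOp A (U.χ a)) α)]
  exact add_mem (hs _ 1) (sum_mem fun a _ => Submodule.smul_mem _ _
    ((U.c a).localHomotopy_mem (P := P ∘ₗ mulOp A (U.χ a)) q m
      (fun _ hβ => h _ (D.smul_mem _ hβ)) hα))

/-- The operator `P` is the sum of the operators `P ∘ χ_a`, which are supported in coordinate
neighbourhoods. As `η_a = 1` on the support of `χ_a`, multiplication by `η_a` does not disturb the
local homotopies. -/
theorem extD_homotopy {P : Op A} {m q : ℕ} (hq : q < n) (hP : OrdLT ev P m) (hdeg : HasDegree P q)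
    (hcl : ∀ α, extD (P α) = 0) (α : Forms A) : extD (U.homotopy q m P α) = P α := by
  refine forms_ext_of_flat U.sep fun x => ?_
  obtain ⟨s, hs, hs1⟩ := U.glueForm_spec x
  have hsupp : ∀ a, SupportedIn ev (P ∘ₗ mulOp A (U.χ a)) (U.c a).V := fun a y hy β r =>
    flat_mono (Nat.le_succ r) (hP.flat U.sep U.flat_succ
      (mul_flat (U.χ_flat a y hy (m + r)) (flat_zero _ β)))
  have hloc : ∀ a, extD (U.η a • (U.c a).localHomotopy q m (P ∘ₗ mulOp A (U.χ a)) α) =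
      P (U.χ a • α) := by
    intro a
    rw [U.η_smul fun y hy => (U.c a).localHomotopy_supportedIn (hsupp a) q m y hy α 1]
    exact (U.c a).extD_localHomotopy (P := P ∘ₗ mulOp A (U.χ a)) U.sep U.flat_succ hq
      (fun y _ hβ => hP y _ (Submodule.smul_mem _ _ hβ)) (fun _ => hdeg _) (hsupp a)
      (fun _ => hcl _) α
  -- Near `x` only the finitely many indices in `s` matter, and `1 - ∑ χ_a` vanishes at `x` to an
  -- order that the operator `P` of finite order cannot detect.
  have h1 := flat_extD (hs (fun a => (U.c a).localHomotopy q m (P ∘ₗ mulOp A (U.χ a)) α) 2)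
  rw [map_sub, map_sum, Finset.sum_congr rfl fun a _ => hloc a, ← map_sum,
    ← Finset.sum_smul] at h1
  have h2 : P ((1 - ∑ a ∈ s, U.χ a) • α) ∈ flat (ptIdeal ev x) 1 :=
    hP x _ (mul_flat (hs1 m) (flat_zero _ α))
  rw [sub_smul 1 (∑ a ∈ s, U.χ a) α, one_smul, map_sub] at h2
  have h3 := sub_mem h1 h2
  rwa [sub_sub_sub_cancel_right] at h3

end CoordCover

end Cover

/-! ### The contracting homotopy for the horizontal differential -/

section Single

variable {T M : Type*} {deg : T → ℤ} [AddCommGroup M]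

theorem single_apply_two (f : T → List T → M) (s : List T) (a b : T) (t R : List T) :
    single f (s ++ a :: b :: t) R = 0 := by
  rcases s with _ | ⟨c, _ | ⟨d, s⟩⟩ <;> rfl

theorem single_eq_zero {f : T → List T → M} {S R : List T} (h : ∀ a, S = [a] → f a R = 0) :
    single f S R = 0 := by
  rcases S with _ | ⟨a, _ | ⟨b, S⟩⟩
  · rfl
  · exact h a rfl
  · rfl

theorem GSym.single_left (f : T → List T → M) (R : List T) : GSym deg fun S => single f S R :=
  fun s a b t => by simp only [single_apply_two, smul_zero]

theorem GSym.single_right {f : T → List T → M} (hf : ∀ a, GSym deg (f a)) (S : List T) :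
    GSym deg (single f S) := by
  rcases S with _ | ⟨a, _ | ⟨b, S⟩⟩
  · exact fun _ _ _ _ => (smul_zero _).symm
  · exact hf a
  · exact fun _ _ _ _ => (smul_zero _).symm

theorem LinRel.single_left [Module ℝ M] {c₁ c₂ : ℝ} {x x₁ x₂ : T} {f : T → List T → M}
    {R : List T} (hf : f x R = c₁ • f x₁ R + c₂ • f x₂ R) :
    LinRel c₁ c₂ x x₁ x₂ fun S => single f S R := by
  have h0 : (0 : M) = c₁ • 0 + c₂ • 0 := by rw [smul_zero, smul_zero, add_zero]
  rintro (_ | ⟨a, s⟩) (_ | ⟨b, t⟩)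
  · exact hf
  · exact h0
  · rcases s with _ | ⟨d, s⟩ <;> exact h0
  · rcases s with _ | ⟨d, s⟩ <;> exact h0

theorem LinRel.single_right [Module ℝ M] {c₁ c₂ : ℝ} {x x₁ x₂ : T} {f : T → List T → M}
    (hf : ∀ a, LinRel c₁ c₂ x x₁ x₂ (f a)) (S : List T) :
    LinRel c₁ c₂ x x₁ x₂ (single f S) := by
  have h0 : (0 : M) = c₁ • 0 + c₂ • 0 := by rw [smul_zero, smul_zero, add_zero]
  rcases S with _ | ⟨a, _ | ⟨b, S⟩⟩
  · exact fun _ _ => h0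
  · exact hf a
  · exact fun _ _ => h0

end Single

section CochainHomotopy

variable {A : Type*} [CommRing A] [Algebra ℝ A]
variable {L : Type*} [AddCommGroup L] [Module ℝ L] {𝓛 : ℤ → Submodule ℝ L}

/-- The bidegrees of the arguments. -/
def types (as : List (Sec A 𝓛)) : Multiset (ℤ × ℤ) := as.map fun a => (a.formDeg, a.tgtDeg)

theorem types_perm {as bs : List (Sec A 𝓛)} (h : as.Perm bs) : types as = types bs :=
  Multiset.coe_eq_coe.mpr (h.map _)

theorem types_middle (s t : List (Sec A 𝓛)) (a : Sec A 𝓛) :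
    types (s ++ a :: t) = (a.formDeg, a.tgtDeg) ::ₘ types (s ++ t) :=
  types_perm List.perm_middle

/-- A multilinear cochain as an operator in the form of one of its arguments. -/
def slotOp {F : Cochain A 𝓛} (hF : IsMultilinear F) (s : List (Sec A 𝓛)) (j i : ℤ) (y : 𝓛 i)
    (t : List (Sec A 𝓛)) : Op A where
  toFun α := F (s ++ ⟨j, i, toHomog j α, y⟩ :: t)
  map_add' α β := by rw [map_add, (hF s t j i).1]
  map_smul' c α := by rw [map_smul, (hF s t j i).2.2.1, RingHom.id_apply]

theorem slotOp_apply {F : Cochain A 𝓛} (hF : IsMultilinear F) (s : List (Sec A 𝓛)) (j i : ℤ)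
    (y : 𝓛 i) (t : List (Sec A 𝓛)) (α : Forms A) :
    slotOp hF s j i y t α = F (s ++ ⟨j, i, toHomog j α, y⟩ :: t) := rfl

theorem slotOp_form {F : Cochain A 𝓛} (hF : IsMultilinear F) (s t : List (Sec A 𝓛))
    (a : Sec A 𝓛) : slotOp hF s a.formDeg a.tgtDeg a.vec t (a.form : Forms A) = F (s ++ a :: t) := by
  rw [slotOp_apply, toHomog_coe]

theorem slotOp_linRel {F : Cochain A 𝓛} (hF : IsMultilinear F) {c₁ c₂ : ℝ} {x x₁ x₂ : Sec A 𝓛}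
    (h : LinRel c₁ c₂ (M := Forms A) x x₁ x₂ F) (j i : ℤ) (y : 𝓛 i) :
    LinRel c₁ c₂ x x₁ x₂ (slotOp hF [] j i y) := fun s t =>
  LinearMap.ext fun α => h (⟨j, i, toHomog j α, y⟩ :: s) t

theorem slotOp_vec {F : Cochain A 𝓛} (hF : IsMultilinear F) (c₁ c₂ : ℝ) (j i : ℤ) (y y' : 𝓛 i)
    (t : List (Sec A 𝓛)) : slotOp hF [] j i (c₁ • y + c₂ • y') t =
      c₁ • slotOp hF [] j i y t + c₂ • slotOp hF [] j i y' t :=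
  LinearMap.ext fun α => ((isMultilinear_iff_linRel.mp hF j i c₁ c₂).2 (toHomog j α) y y') [] t

variable {X : Type*} {ev : X → A →ₐ[ℝ] ℝ}

/-- The order of a cochain bounds the orders of the operators in one argument. -/
theorem slotOp_ordLT {F : Cochain A 𝓛} (hF : IsMultilinear F) {s : List (Sec A 𝓛)} {j i : ℤ}
    {y : 𝓛 i} {t : List (Sec A 𝓛)} {k : ℕ}
    (h : ∀ u : homog A j, JetLocalAt (fun x => ptIdeal ev x) F k (s ++ ⟨j, i, u, y⟩ :: t)) :
    OrdLT ev (slotOp hF s j i y t) (k + 1) := fun x _ hα =>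
  h _ x ⟨_, List.mem_append_right _ List.mem_cons_self, flat_homogProj j hα⟩

/-- Differential operators of order at most `k` map forms with vanishing jets of order `k + r` to
forms with vanishing jets of order `r`. -/
theorem apply_mem_flat {F : Cochain A 𝓛} (hF : IsMultilinear F)
    (sep : ∀ f : A, (∀ x, ev x f = 0) → f = 0)
    (hflat : ∀ x k, flat (ptIdeal ev x) (k + 1) ≤ ptIdeal ev x • flat (ptIdeal ev x) k)
    {as : List (Sec A 𝓛)} {k : ℕ}
    (h : ∀ bs : List (Sec A 𝓛), (bs.map fun a => (a.formDeg, a.tgtDeg)) =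
      (as.map fun a => (a.formDeg, a.tgtDeg)) → JetLocalAt (fun x => ptIdeal ev x) F k bs)
    {x : X} {r : ℕ} {a : Sec A 𝓛} (ha : a ∈ as)
    (hax : (a.form : Forms A) ∈ flat (ptIdeal ev x) (k + 1 + r)) :
    F as ∈ flat (ptIdeal ev x) (r + 1) := by
  obtain ⟨s, t, rfl⟩ := List.append_of_mem ha
  rw [← slotOp_form hF]
  exact (slotOp_ordLT hF fun u => h _ (by simp)).flat sep hflat hax

/-- The term of the homotopy in which the argument `a` is the form acted on by differential
operators, the other arguments being `R`. -/
def homotopyTerm {n : ℕ} {ι : Type*} (U : CoordCover ev n ι) (q : ℕ)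
    (ord : Multiset (ℤ × ℤ) → ℕ) {F : Cochain A 𝓛} (hF : IsMultilinear F) (a : Sec A 𝓛)
    (R : List (Sec A 𝓛)) : Forms A :=
  U.homotopy q (ord ((a.formDeg, a.tgtDeg) ::ₘ types R) + 1)
    (slotOp hF [] a.formDeg a.tgtDeg a.vec R) a.form

/-- The contracting homotopy for the horizontal differential: the average over the arguments of
the homotopies for operators in one argument. The number `ord` bounds the order of the operator
in terms of the bidegrees of the arguments. -/
def cochainHomotopy {n : ℕ} {ι : Type*} (U : CoordCover ev n ι) (q : ℕ)
    (ord : Multiset (ℤ × ℤ) → ℕ) {F : Cochain A 𝓛} (hF : IsMultilinear F) : Cochain A 𝓛 :=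
  fun as => (as.length : ℝ)⁻¹ • unshuffle Sec.deg (single (homotopyTerm U q ord hF)) as

variable {n : ℕ} {ι : Type*} (U : CoordCover ev n ι) (q : ℕ) (ord : Multiset (ℤ × ℤ) → ℕ)
  {F : Cochain A 𝓛}

theorem homotopyTerm_linRel_right (hF : IsMultilinear F) {c₁ c₂ : ℝ} {x x₁ x₂ : Sec A 𝓛}
    (h1 : (x₁.formDeg, x₁.tgtDeg) = (x.formDeg, x.tgtDeg))
    (h2 : (x₂.formDeg, x₂.tgtDeg) = (x.formDeg, x.tgtDeg))
    (h : LinRel c₁ c₂ (M := Forms A) x x₁ x₂ F) (a : Sec A 𝓛) :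
    LinRel c₁ c₂ x x₁ x₂ (homotopyTerm U q ord hF a) := by
  intro s t
  simp only [homotopyTerm, types_middle, h1, h2]
  rw [slotOp_linRel hF h a.formDeg a.tgtDeg a.vec s t, map_add, map_smul, map_smul]
  rfl

theorem cochainHomotopy_isMultilinear (hF : IsMultilinear F) :
    IsMultilinear (cochainHomotopy U q ord hF) := by
  have key : ∀ {c₁ c₂ : ℝ} {x x₁ x₂ : Sec A 𝓛}, x₁.deg = x.deg → x₂.deg = x.deg →
      (∀ R, homotopyTerm U q ord hF x R =
        c₁ • homotopyTerm U q ord hF x₁ R + c₂ • homotopyTerm U q ord hF x₂ R) →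
      (∀ a, LinRel c₁ c₂ x x₁ x₂ (homotopyTerm U q ord hF a)) →
      LinRel c₁ c₂ (M := Forms A) x x₁ x₂ (cochainHomotopy U q ord hF) := by
    intro c₁ c₂ x x₁ x₂ h1 h2 hl hr s t
    have h := LinRel.unshuffle (deg := Sec.deg) h1 h2 (fun R => LinRel.single_left (hl R))
      (fun S => LinRel.single_right hr S) s t
    change (_ : ℝ)⁻¹ • _ = c₁ • (_ : ℝ)⁻¹ • _ + c₂ • (_ : ℝ)⁻¹ • _
    rw [h, smul_add, smul_comm c₁, smul_comm c₂]
    simp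
  refine isMultilinear_iff_linRel.mpr fun j i c₁ c₂ => ⟨fun u u' y => ?_, fun u y y' => ?_⟩
  · refine key rfl rfl (fun R => ?_) (homotopyTerm_linRel_right U q ord hF rfl rfl
      ((isMultilinear_iff_linRel.mp hF j i c₁ c₂).1 u u' y))
    have e : ((c₁ • u + c₂ • u' : homog A j) : Forms A) = c₁ • (u : Forms A) + c₂ • (u' : Forms A) :=
      rfl
    simp only [homotopyTerm, e]
    rw [map_add, map_smul _ c₁, map_smul _ c₂]
  · refine key rfl rfl (fun R => ?_) (homotopyTerm_linRel_right U q ord hF rfl rfl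
      ((isMultilinear_iff_linRel.mp hF j i c₁ c₂).2 u y y'))
    simp only [homotopyTerm, slotOp_vec]
    rw [map_add, map_smul, map_smul]
    rfl

theorem cochainHomotopy_isGradedSymmetric (hF : IsMultilinear F) (hF' : IsGradedSymmetric F) :
    IsGradedSymmetric (cochainHomotopy U q ord hF) := by
  have hT : ∀ a, GSym Sec.deg (homotopyTerm U q ord hF a) := by
    intro a s b c t
    have e1 : types (s ++ b :: c :: t) = types (s ++ c :: b :: t) :=
      types_perm ((List.Perm.swap c b t).append_left s)
    have e2 : slotOp hF [] a.formDeg a.tgtDeg a.vec (s ++ b :: c :: t) =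
        (((b.deg * c.deg).negOnePow : ℤ) : ℝ) •
          slotOp hF [] a.formDeg a.tgtDeg a.vec (s ++ c :: b :: t) := by
      refine LinearMap.ext fun α => (hF' (⟨_, _, toHomog a.formDeg α, a.vec⟩ :: s) b c t).trans ?_
      rcases Int.units_eq_one_or (b.deg * c.deg).negOnePow with h | h <;> rw [h]
      · simp [slotOp_apply]
      · simp [slotOp_apply]
    simp only [homotopyTerm, e1, e2]
    rcases Int.units_eq_one_or (b.deg * c.deg).negOnePow with h | h <;> rw [h] <;> simp
  intro s a b t
  have h := GSym.unshuffle (deg := Sec.deg) (fun R => GSym.single_left (homotopyTerm U q ord hF) R)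
    (fun S => GSym.single_right hT S) s a b t
  change (_ : ℝ)⁻¹ • _ = _ • (_ : ℝ)⁻¹ • _
  rw [h, smul_comm]
  simp

theorem cochainHomotopy_mem_symCochains (hF : F ∈ symCochains A 𝓛) :
    cochainHomotopy U q ord hF.1 ∈ symCochains A 𝓛 :=
  ⟨cochainHomotopy_isMultilinear U q ord hF.1,
    cochainHomotopy_isGradedSymmetric U q ord hF.1 hF.2.1, smul_zero _⟩

theorem cochainHomotopy_eq_zero (hF : IsMultilinear F) {as : List (Sec A 𝓛)}
    (h : ∀ (a : Sec A 𝓛) (R : List (Sec A 𝓛)), (a :: R).Perm as → ∀ u : homog A a.formDeg,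
      F (⟨a.formDeg, a.tgtDeg, u, a.vec⟩ :: R) = 0) : cochainHomotopy U q ord hF as = 0 := by
  change (_ : ℝ)⁻¹ • _ = _
  rw [unshuffle_eq_zero, smul_zero]
  rintro S R - - hp
  refine single_eq_zero ?_
  rintro a rfl
  have e : slotOp hF [] a.formDeg a.tgtDeg a.vec R = 0 := LinearMap.ext fun α => h a R hp _
  rw [homotopyTerm, e, map_zero, LinearMap.zero_apply]

theorem cochainHomotopy_mem_homog (hF : IsMultilinear F) {d : ℤ} (h : ∀ as, F as ∈ homog A d)
    (as : List (Sec A 𝓛)) : cochainHomotopy U q ord hF as ∈ homog A (d - 1) := by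
  refine Submodule.smul_of_tower_mem _ _ ?_
  refine unshuffle_rel Sec.deg (fun (α : Forms A) (_ : Forms A) => α ∈ homog A (d - 1)) ?_ ?_ _
    (fun _ _ => 0) as ?_
  · intro a _ b _ ha hb
    exact add_mem ha hb
  · intro u a _ ha
    rcases Int.units_eq_one_or u with rfl | rfl
    · simpa using ha
    · simpa using neg_mem ha
  · intro S R _ _ _
    rcases S with _ | ⟨a, _ | ⟨b, S⟩⟩
    · exact (homog A (d - 1)).zero_mem
    · exact U.homotopy_hasDegree (fun α => h _) _ _ _
    · exact (homog A (d - 1)).zero_mem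

/-- By graded symmetry each of the `l` arguments contributes `F` to `d` of the sum over
unshuffles, whence the factor `l⁻¹`. For `l = 0` the cochain vanishes. -/
theorem dH_cochainHomotopy (hq : q < n) (hF : F ∈ symCochains A 𝓛) (hcl : dH A 𝓛 F = 0)
    (hdeg : ∀ as, F as ∈ homog A q)
    (hord : ∀ as, JetLocalAt (fun x => ptIdeal ev x) F (ord (types as)) as) :
    dH A 𝓛 (cochainHomotopy U q ord hF.1) = F := by
  funext as
  change extD ((as.length : ℝ)⁻¹ • unshuffle Sec.deg (single (homotopyTerm U q ord hF.1)) as) = _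
  have h1 : extD (unshuffle Sec.deg (single (homotopyTerm U q ord hF.1)) as) =
      unshuffle Sec.deg (single fun a R => F ([] ++ a :: R)) as := by
    refine (map_unshuffle (extD : Forms A →ₗ[ℝ] Forms A).toAddMonoidHom _ _).trans
      (unshuffle_congr fun S R _ _ _ => ?_)
    rcases S with _ | ⟨a, _ | ⟨b, S⟩⟩
    · exact map_zero (extD : Forms A →ₗ[ℝ] Forms A)
    · have e1 : OrdLT ev (slotOp hF.1 [] a.formDeg a.tgtDeg a.vec R)
          (ord ((a.formDeg, a.tgtDeg) ::ₘ types R) + 1) := slotOp_ordLT hF.1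
        fun u => hord (⟨a.formDeg, a.tgtDeg, u, a.vec⟩ :: R)
      have e2 : HasDegree (slotOp hF.1 [] a.formDeg a.tgtDeg a.vec R) q := fun α => hdeg _
      have e3 : ∀ α, extD (slotOp hF.1 [] a.formDeg a.tgtDeg a.vec R α) = 0 :=
        fun α => congrFun hcl _
      exact (U.extD_homotopy hq e1 e2 e3 a.form).trans (slotOp_form hF.1 [] R a)
    · exact map_zero (extD : Forms A →ₗ[ℝ] Forms A)
  rw [map_smul, h1, GSym.unshuffle_single (GSym.of_isGradedSymmetric hF.2.1), List.nil_append]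
  rcases as with _ | ⟨a, as⟩
  · rw [hF.2.2]
    simp
  · rw [← Nat.cast_smul_eq_nsmul ℝ, smul_smul, inv_mul_cancel₀, one_smul]
    simp
    positivity

/-- The homotopy of an operator of order `k` has order at most `2 k + 1`: the operator itself
lowers the order of vanishing of its arguments by `k`, and the homotopy by `k + 1`. -/
theorem cochainHomotopy_jetLocalAt (hF : IsMultilinear F)
    (hord : ∀ as, JetLocalAt (fun x => ptIdeal ev x) F (ord (types as)) as) (as : List (Sec A 𝓛)) :
    JetLocalAt (fun x => ptIdeal ev x) (cochainHomotopy U q ord hF) (2 * ord (types as) + 1) as := by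
  rintro x ⟨a, ha, hax⟩
  rw [jetVanishes_iff] at hax ⊢
  refine real_smul_mem _ ?_
  refine unshuffle_rel Sec.deg (fun (α : Forms A) (_ : Forms A) => α ∈ flat (ptIdeal ev x) (0 + 1))
    ?_ ?_ _ (fun _ _ => 0) as ?_
  · intro a _ b _ ha hb
    exact add_mem ha hb
  · intro u a _ ha
    exact flat_units_smul u ha
  · intro S R _ _ hp
    rcases S with _ | ⟨b, _ | ⟨c, S⟩⟩
    · exact zero_mem _
    · have hp' : (b :: R).Perm as := hp
      have ht : (b.formDeg, b.tgtDeg) ::ₘ types R = types as := types_perm hp'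
      have ho : ∀ (u : homog A b.formDeg) (cs : List (Sec A 𝓛)),
          (cs.map fun a => (a.formDeg, a.tgtDeg)) =
            (([] ++ ⟨b.formDeg, b.tgtDeg, u, b.vec⟩ :: R : List (Sec A 𝓛)).map
              fun a => (a.formDeg, a.tgtDeg)) →
          JetLocalAt (fun x => ptIdeal ev x) F (ord (types as)) cs := by
        intro u cs hcs
        have : types cs = types as := by
          rw [← ht, types, hcs]
          rfl
        rw [← this]
        exact hord cs
      change homotopyTerm U q ord hF b R ∈ _
      rw [homotopyTerm, ht]
      rcases List.mem_cons.mp (hp'.mem_iff.mpr ha) with rfl | haR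
      -- The section with vanishing jet is the argument that the homotopy acts on.
      · refine U.homotopy_mem (D := flat (ptIdeal ev x) (2 * ord (types as) + 1 + 1)) _ _
          (fun α hα => ?_) hax
        rw [add_comm]
        refine (slotOp_ordLT hF fun u => ho u _ rfl).flat U.sep U.flat_succ ?_
        exact flat_mono (by omega) hα
      -- It is one of the other arguments; then all values of the operator vanish
        -- at `x` to the order that the homotopy needs.
      · refine U.homotopy_mem (D := ⊤) _ _ (fun α _ => ?_) trivial
        rw [add_comm, slotOp_apply]
        refine apply_mem_flat hF U.sep U.flat_succ (ho _) (List.mem_append_right _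
          (List.mem_cons_of_mem _ haR)) (flat_mono (by omega) hax)
    · exact zero_mem _

end CochainHomotopy

/-! ### Exactness of the horizontal differential below the top degree -/

section Exactness

variable {A : Type*} [CommRing A] [Algebra ℝ A]
variable {L : Type*} [AddCommGroup L] [Module ℝ L] {𝓛 : ℤ → Submodule ℝ L}
variable {X : Type*} {ev : X → A →ₐ[ℝ] ℝ} {F : Cochain A 𝓛}

theorem component_mem_symCochains (hF : F ∈ symCochains A 𝓛) (p : ℕ) :
    component p F ∈ symCochains A 𝓛 :=
  symCochains_comp hF (LinearMap.single ℝ (fun p => Form A p) p ∘ₗ LinearMap.proj p)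

theorem component_jetLocalAt {𝔪 : X → Ideal A} {k : ℕ} {as : List (Sec A 𝓛)}
    (h : JetLocalAt 𝔪 F k as) (p : ℕ) : JetLocalAt 𝔪 (component p F) k as := by
  intro x hx q w
  by_cases hq : q = p
  · subst hq
    rw [component_apply_self]
    exact h x hx q w
  · rw [component_apply_of_ne hq]
    exact Ideal.zero_mem _

theorem component_mem_polyCochains {𝔪 : X → Ideal A} (hF : F ∈ polyCochains 𝓛 𝔪) (p : ℕ) :
    component p F ∈ polyCochains 𝓛 𝔪 := by
  obtain ⟨h1, N, k, D, h2, h3⟩ := hF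
  refine ⟨component_mem_symCochains h1 p, N, k, D, fun as h => h2 as fun h0 => h ?_,
    fun as => component_jetLocalAt (h3 as) p⟩
  rw [component, h0]
  exact Pi.single_zero p

theorem component_mem_formalCochains {𝔪 : X → Ideal A} (hF : F ∈ formalCochains 𝓛 𝔪) (p : ℕ) :
    component p F ∈ formalCochains 𝓛 𝔪 := by
  refine ⟨component_mem_symCochains hF.1 p, fun τ => ?_⟩
  obtain ⟨k, hk⟩ := hF.2 τ
  exact ⟨k, fun as h => component_jetLocalAt (hk as h) p⟩

variable {n : ℕ} {ι : Type*}

theorem dH_jetLocalAt (U : CoordCover ev n ι) (hF : IsMultilinear F) {as : List (Sec A 𝓛)} {k : ℕ}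
    (h : ∀ bs : List (Sec A 𝓛), (bs.map fun a => (a.formDeg, a.tgtDeg)) =
      (as.map fun a => (a.formDeg, a.tgtDeg)) → JetLocalAt (fun x => ptIdeal ev x) F k bs) :
    JetLocalAt (fun x => ptIdeal ev x) (dH A 𝓛 F) (k + 1) as := by
  rintro x ⟨a, ha, hax⟩
  exact flat_extD (apply_mem_flat hF U.sep U.flat_succ h (r := 1) ha hax)

theorem dH_mem_polyCochains (U : CoordCover ev n ι) (hF : F ∈ polyCochains 𝓛 fun x => ptIdeal ev x) :
    dH A 𝓛 F ∈ polyCochains 𝓛 fun x => ptIdeal ev x := by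
  obtain ⟨h1, N, k, D, h2, h3⟩ := hF
  refine ⟨dH_mem_symCochains h1, N, k + 1, D, fun as h => h2 as fun h0 => h ?_,
    fun as => dH_jetLocalAt U h1.1 fun bs _ => h3 bs⟩
  change extD (F as) = 0
  rw [h0]
  exact map_zero (extD : Forms A →ₗ[ℝ] Forms A)

theorem dH_mem_formalCochains (U : CoordCover ev n ι) (hF : F ∈ formalCochains 𝓛 fun x => ptIdeal ev x) :
    dH A 𝓛 F ∈ formalCochains 𝓛 fun x => ptIdeal ev x := by
  refine ⟨dH_mem_symCochains hF.1, fun τ => ?_⟩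
  obtain ⟨k, hk⟩ := hF.2 τ
  exact ⟨k + 1, fun as h => dH_jetLocalAt U hF.1.1 fun bs hbs => hk bs (hbs.trans h)⟩

/-- If the homotopy of closed cochains in `C` is in `C`, then `d_h` is exact on `C` in degrees
below `n`. -/
theorem exactBelow_of_cochainHomotopy (U : CoordCover ev n ι) {C : Submodule ℝ (Cochain A 𝓛)}
    (hC : C ≤ symCochains A 𝓛)
    (h : ∀ F (hF : F ∈ C), ∃ ord : Multiset (ℤ × ℤ) → ℕ,
      (∀ as, JetLocalAt (fun x => ptIdeal ev x) F (ord (types as)) as) ∧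
      ∀ q, cochainHomotopy U q ord (hC hF).1 ∈ C) : ExactBelow C n := by
  intro p hp g F hF hcl
  obtain ⟨ord, hord, hmem⟩ := h F hF.1
  have hdeg : ∀ as, F as ∈ homog A p := fun as q hq => hF.2 as q fun h => hq h.1
  refine ⟨cochainHomotopy U p ord (hC hF.1).1, ⟨hmem p, fun as q hq => ?_⟩,
    dH_cochainHomotopy U p ord hp (hC hF.1) hcl hdeg hord⟩
  by_cases hg : -degSum Sec.deg as = g
  · exact cochainHomotopy_mem_homog U p ord (hC hF.1).1 hdeg as q fun h => hq ⟨h, hg⟩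
  · rw [cochainHomotopy_eq_zero U p ord (hC hF.1).1]
    · rfl
    · intro a R hp u
      funext q
      refine hF.2 _ q fun h => hg ?_
      rw [← h.2, ← degSum_perm _ hp]
      rfl

theorem exactBelow_polyCochains (U : CoordCover ev n ι) :
    ExactBelow (polyCochains 𝓛 fun x => ptIdeal ev x) n := by
  refine exactBelow_of_cochainHomotopy U (fun F hF => hF.1) fun F hF => ?_
  obtain ⟨h1, N, k, D, h2, h3⟩ := hF
  refine ⟨fun _ => k, h3, fun q => ⟨cochainHomotopy_mem_symCochains U q _ h1, N, 2 * k + 1, D,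
    fun as h => ?_, fun as => cochainHomotopy_jetLocalAt U q (fun _ => k) h1.1 h3 as⟩⟩
  by_contra hcon
  refine h (cochainHomotopy_eq_zero U q _ h1.1 fun a R hp u => ?_)
  by_contra h0
  obtain ⟨hN, hD⟩ := h2 _ h0
  refine hcon ⟨by simpa [← hp.length_eq] using hN, fun b hb => ?_⟩
  rcases List.mem_cons.mp (hp.mem_iff.mpr hb) with rfl | hb
  · exact hD ⟨b.formDeg, b.tgtDeg, u, b.vec⟩ List.mem_cons_self
  · exact hD b (List.mem_cons_of_mem _ hb)

theorem exactBelow_formalCochains (U : CoordCover ev n ι) :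
    ExactBelow (formalCochains 𝓛 fun x => ptIdeal ev x) n := by
  classical
  refine exactBelow_of_cochainHomotopy U (fun F hF => hF.1) fun F hF => ?_
  choose k hk using hF.2
  -- The order bounds of a formal cochain depend on the bidegrees of the arguments in their order;
  -- the homotopy permutes the arguments and needs a bound that does not.
  let ord : Multiset (ℤ × ℤ) → ℕ := fun s => s.toList.permutations.toFinset.sup k
  have hord : ∀ as, JetLocalAt (fun x => ptIdeal ev x) F (ord (types as)) as := by
    intro as
    refine (hk _ as rfl).mono _ (Finset.le_sup (f := k) ?_)
    rw [List.mem_toFinset, List.mem_permutations, ← Multiset.coe_eq_coe, Multiset.coe_toList]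
    rfl
  refine ⟨ord, hord, fun q => ⟨cochainHomotopy_mem_symCochains U q _ hF.1, fun τ =>
    ⟨2 * ord τ + 1, fun as h => ?_⟩⟩⟩
  have := cochainHomotopy_jetLocalAt U q ord hF.1.1 hord as
  rwa [types, h] at this

end Exactness

section Main

variable {A : Type*} [CommRing A] [Algebra ℝ A]
variable {L : Type*} [AddCommGroup L] [Module ℝ L] {𝓛 : ℤ → Submodule ℝ L}
variable {X : Type*} {ev : X → A →ₐ[ℝ] ℝ} {n : ℕ} {ι : Type*}

/-- The isomorphism for polynomial cochains, over an algebra with a cover by coordinate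
neighbourhoods. -/
theorem exists_equiv_polyCochains (U : CoordCover ev n ι) {Q : LInfinity 𝓛} (hQ : Q.IsPolynomial)
    (g : ℤ) : ∃ e : TotalCohomology (polyCochains 𝓛 fun x => ptIdeal ev x) Q (g + n) ≃ₗ[ℝ]
          IteratedCohomology (polyCochains 𝓛 fun x => ptIdeal ev x) Q g n,
        ∀ z : totalCocycles (polyCochains 𝓛 fun x => ptIdeal ev x) Q (g + n),
          ∃ w : iteratedCocycles (polyCochains 𝓛 fun x => ptIdeal ev x) Q g n,
            w.1 = component n z.1 ∧ e (Submodule.Quotient.mk z) = Submodule.Quotient.mk w :=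
  exists_equiv_of_exactBelow (fun _ hF => dH_mem_polyCochains U hF)
    (fun _ hF => brst_mem_polyCochains hQ hF) (fun _ hF => brst_brst Q hF.1)
    (fun _ hF p => component_mem_polyCochains hF p) (exactBelow_polyCochains U)
    (fun _ hp => U.subsingleton_form hp) g

/-- The isomorphism for formal cochains, over an algebra with a cover by coordinate
neighbourhoods. -/
theorem exists_equiv_formalCochains (U : CoordCover ev n ι) (Q : LInfinity 𝓛) (g : ℤ) :
    ∃ e : TotalCohomology (formalCochains 𝓛 fun x => ptIdeal ev x) Q (g + n) ≃ₗ[ℝ]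
          IteratedCohomology (formalCochains 𝓛 fun x => ptIdeal ev x) Q g n,
        ∀ z : totalCocycles (formalCochains 𝓛 fun x => ptIdeal ev x) Q (g + n),
          ∃ w : iteratedCocycles (formalCochains 𝓛 fun x => ptIdeal ev x) Q g n,
            w.1 = component n z.1 ∧ e (Submodule.Quotient.mk z) = Submodule.Quotient.mk w :=
  exists_equiv_of_exactBelow (fun _ hF => dH_mem_formalCochains U hF)
    (fun _ hF => brst_mem_formalCochains Q hF) (fun _ hF => brst_brst Q hF.1)
    (fun _ hF p => component_mem_formalCochains hF p) (exactBelow_formalCochains U)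
    (fun _ hp => U.subsingleton_form hp) g

end Main

/-! ### Hadamard's lemma -/

section Hadamard

open MeasureTheory Set

/-- Integrals over `[0, 1]` depend smoothly on parameters. They are written as convolutions with
the indicator function of the interval. -/
theorem contDiff_integral_zero_one {P : Type*} [NormedAddCommGroup P] [NormedSpace ℝ P]
    {h : P × ℝ → ℝ} (hh : ContDiff ℝ ∞ h) : ContDiff ℝ ∞ fun p => ∫ t in (0 : ℝ)..1, h (p, t) := by
  let b : ContDiffBump (0 : ℝ) := ⟨1, 2, one_pos, one_lt_two⟩
  let f : ℝ → ℝ := (Ioc (0 : ℝ) 1).indicator fun _ => 1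
  let g : P → ℝ → ℝ := fun p s => b s * h (p, -s)
  have hf : LocallyIntegrable f volume :=
    ((integrable_indicator_iff measurableSet_Ioc).mpr
      continuous_const.integrableOn_Ioc).locallyIntegrable
  have hg : ContDiffOn ℝ ∞ ↿g (univ ×ˢ univ) := by
    refine ContDiff.contDiffOn ?_
    exact (b.contDiff.comp contDiff_snd).mul (hh.comp (contDiff_fst.prodMk contDiff_snd.neg))
  have hgs : ∀ p, ∀ x, p ∈ (univ : Set P) → x ∉ Metric.closedBall (0 : ℝ) 2 → g p x = 0 := by
    intro p x _ hx
    have : b x = 0 := b.zero_of_le_dist (by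
      rw [Metric.mem_closedBall, not_le] at hx
      exact hx.le)
    simp only [g, this, zero_mul]
  have key := contDiffOn_convolution_right_with_param_comp (𝕜 := ℝ) (n := ⊤)
    (ContinuousLinearMap.mul ℝ ℝ) (v := fun _ : P => (0 : ℝ)) contDiffOn_const isOpen_univ
    (isCompact_closedBall (0 : ℝ) 2) hgs hf hg
  rw [contDiffOn_univ] at key
  refine (congrArg (ContDiff ℝ ∞) (funext fun p => ?_)).mpr key
  rw [convolution_def, intervalIntegral.integral_of_le zero_le_one,
    ← integral_indicator measurableSet_Ioc]
  congr 1
  funext t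
  by_cases ht : t ∈ Ioc (0 : ℝ) 1
  · have hb : b (0 - t) = 1 := b.one_of_mem_closedBall (by
      rw [Metric.mem_closedBall, dist_zero_right, zero_sub, norm_neg, Real.norm_eq_abs, abs_le]
      exact ⟨by linarith [ht.1], ht.2⟩)
    simp only [g, f, indicator_of_mem ht, hb]
    simp
  · simp [f, indicator_of_notMem ht]

/-- Hadamard's lemma: the first-order Taylor formula with smooth coefficients. -/
theorem exists_hadamard {n : ℕ} {f : EuclideanSpace ℝ (Fin n) → ℝ} (hf : ContDiff ℝ ∞ f)
    (y₀ : EuclideanSpace ℝ (Fin n)) : ∃ g : Fin n → EuclideanSpace ℝ (Fin n) → ℝ,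
      (∀ i, ContDiff ℝ ∞ (g i)) ∧ (∀ i, g i y₀ = fderiv ℝ f y₀ (EuclideanSpace.single i 1)) ∧
        ∀ y, f y = f y₀ + ∑ i, (y i - y₀ i) * g i y := by
  have hd : ContDiff ℝ ∞ (fderiv ℝ f) := hf.fderiv_right (by simp)
  refine ⟨fun i y => ∫ t in (0 : ℝ)..1, fderiv ℝ f (y₀ + t • (y - y₀)) (EuclideanSpace.single i 1),
    fun i => ?_, fun i => by simp, fun y => ?_⟩
  · refine contDiff_integral_zero_one
      (h := fun q => fderiv ℝ f (y₀ + q.2 • (q.1 - y₀)) (EuclideanSpace.single i 1)) ?_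
    exact (hd.comp (contDiff_const.add (contDiff_snd.smul (contDiff_fst.sub contDiff_const)))).clm_apply
      contDiff_const
  · have hc : ∀ i, IntervalIntegrable
        (fun t : ℝ => fderiv ℝ f (y₀ + t • (y - y₀)) (EuclideanSpace.single i 1)) volume 0 1 := by
      intro i
      refine Continuous.intervalIntegrable ?_ _ _
      have := hd.continuous
      fun_prop
    have hderiv : ∀ t : ℝ, HasDerivAt (fun t : ℝ => f (y₀ + t • (y - y₀)))
        (∑ i, (y i - y₀ i) * fderiv ℝ f (y₀ + t • (y - y₀)) (EuclideanSpace.single i 1)) t := by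
      intro t
      have h1 : HasDerivAt (fun t : ℝ => y₀ + t • (y - y₀)) (y - y₀) t := by
        simpa using ((hasDerivAt_id t).smul_const (y - y₀)).const_add y₀
      have h2 := ((hf.differentiable (by simp)) (y₀ + t • (y - y₀))).hasFDerivAt.comp_hasDerivAt t h1
      have h3 : y - y₀ = ∑ i, (y i - y₀ i) • EuclideanSpace.single i (1 : ℝ) := by
        ext j
        simp [Finset.sum_apply, Pi.single_apply]
      have h4 : ∀ z, fderiv ℝ f z (y - y₀) =
          ∑ i, (y i - y₀ i) * fderiv ℝ f z (EuclideanSpace.single i 1) := by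
        intro z
        rw [h3, map_sum]
        simp only [map_smul, smul_eq_mul]
      rw [← h4]
      exact h2
    have h := intervalIntegral.integral_eq_sub_of_hasDerivAt (a := 0) (b := 1)
      (fun t _ => hderiv t)
      (Continuous.intervalIntegrable (by have := hd.continuous; fun_prop) _ _)
    rw [intervalIntegral.integral_finsetSum fun i _ => (hc i).const_mul _] at h
    simp only [intervalIntegral.integral_const_mul, one_smul, zero_smul, add_zero,
      add_sub_cancel] at h
    rw [h]
    ring

/-- Hadamard's lemma for a function that is smooth near a point. -/
theorem exists_hadamard_of_contDiffOn {n : ℕ} {f : EuclideanSpace ℝ (Fin n) → ℝ}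
    {s : Set (EuclideanSpace ℝ (Fin n))} (hs : IsOpen s) (hf : ContDiffOn ℝ ∞ f s)
    {y₀ : EuclideanSpace ℝ (Fin n)} (hy₀ : y₀ ∈ s) : ∃ g : Fin n → EuclideanSpace ℝ (Fin n) → ℝ,
      (∀ i, ContDiff ℝ ∞ (g i)) ∧ (∀ i, g i y₀ = fderiv ℝ f y₀ (EuclideanSpace.single i 1)) ∧
        ∀ᶠ y in nhds y₀, f y = f y₀ + ∑ i, (y i - y₀ i) * g i y := by
  obtain ⟨r, hr, hrs⟩ := Metric.isOpen_iff.mp hs y₀ hy₀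
  let b : ContDiffBump y₀ := ⟨r / 3, r / 2, by positivity, by linarith⟩
  have hb : ContDiff ℝ ∞ fun y => b y * f y := by
    refine contDiff_iff_contDiffAt.mpr fun y => ?_
    by_cases hy : y ∈ s
    · exact b.contDiff.contDiffAt.mul (hf.contDiffAt (hs.mem_nhds hy))
    · have hy' : y ∈ (Metric.closedBall y₀ (r / 2))ᶜ := fun h =>
        hy (hrs (Metric.closedBall_subset_ball (by linarith) h))
      refine (contDiffAt_const (c := (0 : ℝ))).congr_of_eventuallyEq ?_
      filter_upwards [Metric.isClosed_closedBall.isOpen_compl.mem_nhds hy'] with z hz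
      rw [b.zero_of_le_dist (not_le.mp fun h => hz (Metric.mem_closedBall.mpr h)).le, zero_mul]
  have he : (fun y => b y * f y) =ᶠ[nhds y₀] f := by
    filter_upwards [b.eventuallyEq_one] with y hy
    rw [hy, Pi.one_apply, one_mul]
  obtain ⟨g, h1, h2, h3⟩ := exists_hadamard hb y₀
  refine ⟨g, h1, fun i => by rw [h2, he.fderiv_eq], ?_⟩
  filter_upwards [he] with y hy
  rw [← hy, ← he.eq_of_nhds]
  exact h3 y

end Hadamard

/-! ### Coordinate covers of manifolds -/

section Manifold

open Set Function Topology

variable {n : ℕ} {X : Type*} [TopologicalSpace X] [ChartedSpace (EuclideanSpace ℝ (Fin n)) X]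

variable (n) in
/-- The evaluation of smooth functions at a point. -/
def evalHom (x : X) : SmoothFun n X →ₐ[ℝ] ℝ :=
  (Pi.evalAlgHom ℝ (fun _ : X => ℝ) x).comp ContMDiffMap.coeFnAlgHom

theorem evalHom_apply (x : X) (f : SmoothFun n X) : evalHom n x f = f x := rfl

theorem ptIdeal_evalHom (x : X) : ptIdeal (evalHom n (X := X)) x = vanishingIdeal n x := by
  ext f
  rfl

variable {c : X} (f : SmoothBumpFunction (𝓡 n) c)

/-- The open set of the points near which a bump function is equal to `1`. -/
def oneSet : Set X := {p | f =ᶠ[𝓝 p] 1}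

theorem isOpen_oneSet : IsOpen (oneSet f) := isOpen_setOfPred_eventually_nhds

theorem apply_of_mem_oneSet {p : X} (hp : p ∈ oneSet f) : f p = 1 := hp.eq_of_nhds

theorem mem_source_of_mem_oneSet {p : X} (hp : p ∈ oneSet f) :
    p ∈ (chartAt (EuclideanSpace ℝ (Fin n)) c).source := by
  refine f.support_subset_source ?_
  rw [mem_support, apply_of_mem_oneSet f hp]
  exact one_ne_zero

variable [IsManifold (𝓡 n) ∞ X]

theorem contDiffOn_comp_symm (c : X) (h : SmoothFun n X) :
    ContDiffOn ℝ ∞ (h ∘ (extChartAt (𝓡 n) c).symm) (extChartAt (𝓡 n) c).target :=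
  (h.contMDiff.comp_contMDiffOn (contMDiffOn_extChartAt_symm c)).contDiffOn

theorem differentiableAt_comp_symm {c x : X} (hx : x ∈ (chartAt (EuclideanSpace ℝ (Fin n)) c).source)
    (h : SmoothFun n X) :
    DifferentiableAt ℝ (h ∘ (extChartAt (𝓡 n) c).symm) (extChartAt (𝓡 n) c x) := by
  rw [← extChartAt_source (𝓡 n)] at hx
  exact ((contDiffOn_comp_symm c h).contDiffAt ((isOpen_extChartAt_target c).mem_nhds
    ((extChartAt (𝓡 n) c).map_source hx))).differentiableAt (by simp)

theorem contMDiffOn_comp_chart {g : EuclideanSpace ℝ (Fin n) → ℝ}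
    (hg : ContDiffOn ℝ ∞ g (extChartAt (𝓡 n) c).target) :
    ContMDiffOn (𝓡 n) 𝓘(ℝ, ℝ) ∞ (fun x => g (extChartAt (𝓡 n) c x))
      (chartAt (EuclideanSpace ℝ (Fin n)) c).source := by
  refine hg.contMDiffOn.comp contMDiffOn_extChartAt fun x hx => ?_
  rw [← extChartAt_source (𝓡 n)] at hx
  exact (extChartAt (𝓡 n) c).map_source hx

variable [T2Space X]

/-- Functions that vanish near a point lie in all powers of the ideal of the point. -/
theorem mem_ptIdeal_pow_of_eventuallyEq {x : X} {f : SmoothFun n X} (hf : f =ᶠ[𝓝 x] 0) (m : ℕ) :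
    f ∈ ptIdeal (evalHom n (X := X)) x ^ m := by
  obtain ⟨b, -, hb⟩ := (SmoothBumpFunction.nhds_basis_tsupport (I := 𝓡 n) x).mem_iff.mp hf
  let β : SmoothFun n X := ⟨b, b.contMDiff⟩
  have h1 : 1 - β ∈ ptIdeal (evalHom n (X := X)) x := by
    rw [mem_ptIdeal, map_sub, map_one, evalHom_apply]
    exact sub_eq_zero.mpr b.eq_one.symm
  have h2 : (1 - β) * f = f := by
    ext y
    change (1 - b y) * f y = f y
    by_cases hy : y ∈ tsupport b
    · have : f y = 0 := hb hy
      rw [this, mul_zero]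
    · rw [image_eq_zero_of_notMem_tsupport hy, sub_zero, one_mul]
  have h3 : (1 - β) ^ m * f = f := by
    induction m with
    | zero => rw [pow_zero, one_mul]
    | succ m ih => rw [pow_succ, mul_assoc, h2, ih]
  rw [← h3]
  exact Ideal.mul_mem_right _ _ (Ideal.pow_mem_pow h1 m)

/-- A function defined on a chart, cut off to a smooth function on the manifold. -/
def cutOff (g : X → ℝ)
    (hg : ContMDiffOn (𝓡 n) 𝓘(ℝ, ℝ) ∞ g (chartAt (EuclideanSpace ℝ (Fin n)) c).source) :
    SmoothFun n X := ⟨fun x => f x • g x, f.contMDiff_smul hg⟩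

/-- The coordinate vector fields, cut off to the manifold. -/
def coordDeriv (i : Fin n) : Derivation ℝ (SmoothFun n X) (SmoothFun n X) :=
  Derivation.mk'
    { toFun := fun h => cutOff f (fun x => fderiv ℝ (h ∘ (extChartAt (𝓡 n) c).symm)
          (extChartAt (𝓡 n) c x) (EuclideanSpace.single i 1))
        (contMDiffOn_comp_chart (((contDiffOn_comp_symm c h).fderiv_of_isOpen
          (isOpen_extChartAt_target c) (by simp)).clm_apply contDiffOn_const))
      map_add' := fun h k => by
        ext x
        change f x * _ = f x * _ + f x * _
        by_cases hx : x ∈ (chartAt (EuclideanSpace ℝ (Fin n)) c).source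
        · have e : ⇑(h + k) ∘ (extChartAt (𝓡 n) c).symm = h ∘ (extChartAt (𝓡 n) c).symm +
              k ∘ (extChartAt (𝓡 n) c).symm := rfl
          beta_reduce
          rw [e, fderiv_add (differentiableAt_comp_symm hx h) (differentiableAt_comp_symm hx k),
            _root_.add_apply, mul_add]
        · rw [notMem_support.mp fun h => hx (f.support_subset_source h)]
          ring
      map_smul' := fun r h => by
        ext x
        change f x * _ = r * (f x * _)
        have e : ⇑(r • h) ∘ (extChartAt (𝓡 n) c).symm = r • (h ∘ (extChartAt (𝓡 n) c).symm) := rfl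
        beta_reduce
        rw [e, fderiv_const_smul_field, Pi.smul_apply]
        exact mul_left_comm (f x) r _ }
    fun h k => by
      ext x
      change f x * _ = h x * (f x * _) + k x * (f x * _)
      by_cases hx : x ∈ (chartAt (EuclideanSpace ℝ (Fin n)) c).source
      · have e : ⇑(h * k) ∘ (extChartAt (𝓡 n) c).symm = (h ∘ (extChartAt (𝓡 n) c).symm) *
            (k ∘ (extChartAt (𝓡 n) c).symm) := rfl
        have e2 : (extChartAt (𝓡 n) c).symm (extChartAt (𝓡 n) c x) = x :=
          (extChartAt (𝓡 n) c).left_inv (by rwa [extChartAt_source])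
        beta_reduce
        rw [e, fderiv_mul (differentiableAt_comp_symm hx h) (differentiableAt_comp_symm hx k)]
        simp only [_root_.add_apply, _root_.smul_apply, comp_apply, e2,
          smul_eq_mul]
        ring
      · rw [notMem_support.mp fun h => hx (f.support_subset_source h)]
        ring

theorem coordDeriv_apply (i : Fin n) (h : SmoothFun n X) (x : X) :
    coordDeriv f i h x = f x * fderiv ℝ (h ∘ (extChartAt (𝓡 n) c).symm)
      (extChartAt (𝓡 n) c x) (EuclideanSpace.single i 1) := rfl

/-- The coordinate functions, cut off to the manifold. -/
def coordFun (i : Fin n) : SmoothFun n X :=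
  cutOff f (fun x => extChartAt (𝓡 n) c x i)
    (contMDiffOn_comp_chart (g := fun y => y i) (by fun_prop))

theorem coordFun_apply (i : Fin n) (x : X) :
    coordFun f i x = f x * extChartAt (𝓡 n) c x i := rfl

theorem coordDeriv_coordFun {p : X} (hp : p ∈ oneSet f) (i j : Fin n) :
    coordDeriv f i (coordFun f j) p = if i = j then 1 else 0 := by
  have hs := mem_source_of_mem_oneSet f hp
  rw [← extChartAt_source (𝓡 n)] at hs
  have ht := (extChartAt (𝓡 n) c).map_source hs
  have e : coordFun f j ∘ (extChartAt (𝓡 n) c).symm =ᶠ[𝓝 (extChartAt (𝓡 n) c p)]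
      fun y => EuclideanSpace.proj (𝕜 := ℝ) j y := by
    have h1 : ∀ᶠ y in 𝓝 (extChartAt (𝓡 n) c p), f ((extChartAt (𝓡 n) c).symm y) = 1 := by
      have hc := continuousAt_extChartAt_symm'' (I := 𝓡 n) ht
      rw [ContinuousAt, (extChartAt (𝓡 n) c).left_inv hs] at hc
      exact hc.eventually hp
    filter_upwards [h1, (isOpen_extChartAt_target c).mem_nhds ht] with y hy hyt
    rw [comp_apply, coordFun_apply, hy, one_mul, (extChartAt (𝓡 n) c).right_inv hyt]
    rfl
  rw [coordDeriv_apply, apply_of_mem_oneSet f hp, one_mul, e.fderiv_eq,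
    ContinuousLinearMap.fderiv]
  simp [eq_comm]

/-- A function with vanishing first-order Taylor polynomial at `p` is a sum of products of two
functions that vanish at `p`, by Hadamard's lemma. -/
theorem mem_sq_of_coordDeriv_eq_zero {p : X} (hp : p ∈ oneSet f) {h : SmoothFun n X} (h0 : h p = 0)
    (hd : ∀ i, coordDeriv f i h p = 0) : h ∈ ptIdeal (evalHom n (X := X)) p ^ 2 := by
  have hs := mem_source_of_mem_oneSet f hp
  have hs' := hs
  rw [← extChartAt_source (𝓡 n)] at hs'
  have ht := (extChartAt (𝓡 n) c).map_source hs'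
  obtain ⟨g, hg, hg0, hgh⟩ := exists_hadamard_of_contDiffOn (isOpen_extChartAt_target c)
    (contDiffOn_comp_symm c h) ht
  let G : Fin n → SmoothFun n X := fun i => cutOff f (fun x => g i (extChartAt (𝓡 n) c x))
    (contMDiffOn_comp_chart (hg i).contDiffOn)
  have hG : ∀ i, G i ∈ ptIdeal (evalHom n (X := X)) p := by
    intro i
    rw [mem_ptIdeal, evalHom_apply]
    change f p * g i (extChartAt (𝓡 n) c p) = 0
    rw [hg0, ← coordDeriv_apply, hd]
  let T : SmoothFun n X := ∑ i, (coordFun f i - algebraMap ℝ _ (evalHom n p (coordFun f i))) * G i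
  have hT : T ∈ ptIdeal (evalHom n (X := X)) p ^ 2 := by
    refine sum_mem fun i _ => ?_
    rw [pow_two]
    exact Ideal.mul_mem_mul (sub_const_mem p _) (hG i)
  have hTx : ∀ x, T x = ∑ i, (f x * extChartAt (𝓡 n) c x i - f p * extChartAt (𝓡 n) c p i) *
      (f x * g i (extChartAt (𝓡 n) c x)) := by
    intro x
    rw [← evalHom_apply x T, map_sum]
    rfl
  have he : ⇑(h - T) =ᶠ[𝓝 p] 0 := by
    have h1 := (continuousAt_extChartAt' (I := 𝓡 n) hs').eventually hgh
    filter_upwards [h1, hp, (chartAt _ c).open_source.mem_nhds hs] with x hx hx1 hxs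
    rw [← extChartAt_source (𝓡 n)] at hxs
    change h x - T x = 0
    rw [hTx, hx1, Pi.one_apply, apply_of_mem_oneSet f hp]
    simp only [one_mul]
    rw [comp_apply, comp_apply, (extChartAt (𝓡 n) c).left_inv hxs,
      (extChartAt (𝓡 n) c).left_inv hs', h0, zero_add] at hx
    rw [hx, sub_self]
  have := add_mem (mem_ptIdeal_pow_of_eventuallyEq he 2) hT
  rwa [sub_add_cancel] at this

/-- Derivations are combinations of the coordinate vector fields. -/
theorem derivation_apply_eq {p : X} (hp : p ∈ oneSet f)
    (w : Derivation ℝ (SmoothFun n X) (SmoothFun n X)) (h : SmoothFun n X) :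
    w h p = ∑ i, w (coordFun f i) p * coordDeriv f i h p := by
  -- The difference of `h` and its first-order Taylor polynomial at `p`.
  let T : SmoothFun n X := algebraMap ℝ _ (h p) + ∑ i, coordDeriv f i h p •
    (coordFun f i - algebraMap ℝ _ (coordFun f i p))
  have hd : ∀ u : Derivation ℝ (SmoothFun n X) (SmoothFun n X),
      evalHom n p (u T) = ∑ i, coordDeriv f i h p * evalHom n p (u (coordFun f i)) := by
    intro u
    rw [map_add, Derivation.map_algebraMap, zero_add, map_sum, map_sum]
    refine Finset.sum_congr rfl fun i _ => ?_
    rw [Derivation.map_smul, map_sub, Derivation.map_algebraMap, sub_zero, map_smul, smul_eq_mul]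
  have h2 : h - T ∈ ptIdeal (evalHom n (X := X)) p ^ 2 := by
    refine mem_sq_of_coordDeriv_eq_zero f hp ?_ fun j => ?_
    · rw [← evalHom_apply p (h - T), map_sub, map_add, map_sum, AlgHom.commutes, evalHom_apply]
      rw [Finset.sum_eq_zero fun i _ => ?_]
      · change h p - (h p + 0) = 0
        ring
      · rw [map_smul, map_sub, AlgHom.commutes, evalHom_apply]
        change _ • (coordFun f i p - coordFun f i p) = _
        rw [sub_self, smul_zero]
    · rw [← evalHom_apply p (coordDeriv f j (h - T)), map_sub, map_sub, hd]
      simp only [evalHom_apply, coordDeriv_coordFun f hp]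
      simp
  have h3 := derivation_pow_mem 1 w h2
  rw [pow_one, mem_ptIdeal, map_sub, map_sub, hd, sub_eq_zero] at h3
  rw [← evalHom_apply p (w h), h3]
  exact Finset.sum_congr rfl fun i _ => mul_comm _ _

theorem derivation_sum_apply {A ι : Type*} [CommRing A] [Algebra ℝ A] (s : Finset ι)
    (D : ι → Derivation ℝ A A) (a : A) : (∑ i ∈ s, D i) a = ∑ i ∈ s, D i a := by
  classical
  induction s using Finset.induction_on with
  | empty => rfl
  | insert i s hi ih => rw [Finset.sum_insert hi, Finset.sum_insert hi, Derivation.add_apply, ih]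

/-- The coordinates on the set where a bump function is `1`. -/
def bumpCoords : LocalCoords (evalHom n (X := X)) n where
  V := oneSet f
  v := coordDeriv f
  x := coordFun f
  dual _ hp i j := coordDeriv_coordFun f hp i j
  expand p hp := by
    obtain ⟨b, -, hb⟩ := (SmoothBumpFunction.nhds_basis_tsupport (I := 𝓡 n) p).mem_iff.mp
      ((isOpen_oneSet f).mem_nhds hp)
    refine ⟨⟨b, b.contMDiff⟩, b.eq_one, fun w => ?_⟩
    ext h x
    have hsum : (∑ i, w (coordFun f i) • coordDeriv f i : Derivation ℝ (SmoothFun n X) _) h x =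
        ∑ i, w (coordFun f i) x * coordDeriv f i h x := by
      rw [← evalHom_apply x, derivation_sum_apply, map_sum]
      rfl
    change b x * w h x = b x * (∑ i, w (coordFun f i) • coordDeriv f i :
      Derivation ℝ (SmoothFun n X) _) h x
    by_cases hx : x ∈ tsupport b
    · rw [hsum, derivation_apply_eq f (hb hx)]
    · rw [image_eq_zero_of_notMem_tsupport hx, zero_mul, zero_mul]
  hadamard _ hp _ h0 hd := mem_sq_of_coordDeriv_eq_zero f hp h0 hd

/-- A `σ`-compact Hausdorff manifold has a cover by coordinate neighbourhoods. -/
theorem exists_coordCover.{u} (n : ℕ) (X : Type u) [TopologicalSpace X] [T2Space X]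
    [SigmaCompactSpace X] [ChartedSpace (EuclideanSpace ℝ (Fin n)) X] [IsManifold (𝓡 n) ∞ X] :
    ∃ ι : Type u, Nonempty (CoordCover (evalHom n (X := X)) n ι) := by
  obtain ⟨ι, f, -⟩ := SmoothBumpCovering.exists_isSubordinate (𝓡 n) (isClosed_univ (X := X))
    (U := fun _ => univ) fun _ _ => Filter.univ_mem
  obtain ⟨χ, hχ⟩ := SmoothPartitionOfUnity.exists_isSubordinate (𝓡 n) (isClosed_univ (X := X))
    (fun i => oneSet (f i)) (fun i => isOpen_oneSet (f i)) fun x _ =>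
      mem_iUnion.mpr (f.eventuallyEq_one' x (mem_univ x))
  have hfin : ∀ (h : ι → SmoothFun n X) (x : X),
      (support fun a => f a x * h a x).Finite := fun h x =>
    (f.point_finite x).subset fun a ha h0 => ha (by simp only [h0, zero_mul])
  refine ⟨ι, ⟨{
    c := fun a => bumpCoords (f a)
    χ := fun a => χ a
    η := fun a => ⟨f a, (f a).contMDiff⟩
    glue := {
      toFun := fun h => ⟨fun x => ∑ᶠ a, f a x * h a x, contMDiff_finsum
        (fun a => (f a).contMDiff.mul (h a).contMDiff)
        (f.locallyFinite.subset fun a x hx h0 => hx (by simp only [h0, zero_mul]))⟩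
      map_add' := fun h k => ?_
      map_smul' := fun r h => ?_ }
    sep := fun h hh => ?_
    χ_flat := fun a p hp m => ?_
    η_one := fun a p hp => apply_of_mem_oneSet (f a) hp
    glue_spec := fun p => ?_
    glue_χ := ?_ }⟩⟩
  · ext x
    change ∑ᶠ a, f a x * (h a x + k a x) = ∑ᶠ a, f a x * h a x + ∑ᶠ a, f a x * k a x
    rw [← finsum_add_distrib (hfin h x) (hfin k x)]
    simp only [mul_add]
  · ext x
    change ∑ᶠ a, f a x * (r x * h a x) = r x * ∑ᶠ a, f a x * h a x
    rw [← smul_eq_mul (r x), smul_finsum]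
    refine finsum_congr fun a => ?_
    rw [smul_eq_mul]
    ring
  · ext x
    exact hh x
  · refine mem_ptIdeal_pow_of_eventuallyEq ?_ m
    exact notMem_tsupport_iff_eventuallyEq.mp fun h => hp (hχ a h)
  · obtain ⟨t, ht, hfin'⟩ := f.locallyFinite p
    refine ⟨hfin'.toFinset, fun h m => mem_ptIdeal_pow_of_eventuallyEq ?_ m⟩
    filter_upwards [ht] with x hx
    rw [← evalHom_apply x (_ - _), map_sub, map_sum, Pi.zero_apply, sub_eq_zero]
    refine (finsum_eq_sum_of_support_subset _ ?_).trans rfl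
    intro a ha
    rw [Finset.mem_coe, Finite.mem_toFinset]
    exact ⟨x, fun h0 => ha (by simp only [h0, zero_mul]), hx⟩
  · ext x
    change ∑ᶠ a, f a x * χ a x = 1
    rw [← χ.sum_eq_one (mem_univ x)]
    refine finsum_congr fun a => ?_
    by_cases hx : x ∈ oneSet (f a)
    · rw [apply_of_mem_oneSet (f a) hx, one_mul]
    · rw [image_eq_zero_of_notMem_tsupport fun h => hx (hχ a h), mul_zero]

end Manifold

end LocalBRST

end

theorem mainTheorem2 (n : ℕ) (X : Type*) [TopologicalSpace X] [T2Space X] [SigmaCompactSpace X]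
    [ChartedSpace (EuclideanSpace ℝ (Fin n)) X] [IsManifold (𝓡 n) ∞ X]
    (L : Type*) [AddCommGroup L] [Module ℝ L] (𝓛 : ℤ → Submodule ℝ L)
    (h𝓛 : DirectSum.IsInternal 𝓛) [∀ i, FiniteDimensional ℝ (𝓛 i)]
    (Q : LInfinity 𝓛) (g : ℤ) :
    (Q.IsPolynomial →
      ∃ e : TotalCohomology (polyCochains 𝓛 (vanishingIdeal n (X := X))) Q (g + n) ≃ₗ[ℝ]
          IteratedCohomology (polyCochains 𝓛 (vanishingIdeal n (X := X))) Q g n,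
        ∀ z : totalCocycles (polyCochains 𝓛 (vanishingIdeal n (X := X))) Q (g + n),
          ∃ w : iteratedCocycles (polyCochains 𝓛 (vanishingIdeal n (X := X))) Q g n,
            w.1 = component n z.1 ∧ e (Submodule.Quotient.mk z) = Submodule.Quotient.mk w) ∧
    (∃ e : TotalCohomology (formalCochains 𝓛 (vanishingIdeal n (X := X))) Q (g + n) ≃ₗ[ℝ]
        IteratedCohomology (formalCochains 𝓛 (vanishingIdeal n (X := X))) Q g n,
      ∀ z : totalCocycles (formalCochains 𝓛 (vanishingIdeal n (X := X))) Q (g + n),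
        ∃ w : iteratedCocycles (formalCochains 𝓛 (vanishingIdeal n (X := X))) Q g n,
          w.1 = component n z.1 ∧ e (Submodule.Quotient.mk z) = Submodule.Quotient.mk w) := by
  obtain ⟨ι, ⟨U⟩⟩ := exists_coordCover n X
  have h : (vanishingIdeal n (X := X)) = fun x => ptIdeal (evalHom n (X := X)) x :=
    funext fun x => (ptIdeal_evalHom x).symm
  rw [h]
  exact ⟨fun hQ => exists_equiv_polyCochains U hQ g, exists_equiv_formalCochains U Q g⟩
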